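/- Notation: $[g,h]=g^{-1}h^{-1}gh$; $(\gamma_i(G))_{i\ge 1}$ is the lower central series, $\gamma_2(G)=G'$. For integers $n\ge 2$, $a\in\{0,1\}$ and $z,w\in\{-1,0,1\}$ let $$G_a^n(z,w)=\langle x,y,s_2,\dots,s_{n-1}\mid s_2=[y,x],\ s_i=[s_{i-1},x]\ (3\le i\le n),\ s_n=1,\ [y,s_2]=s_{n-1}^a,\ [y,s_i]=1\ (3\le i\le n-1),$$ $$x^3=s_{n-1}^w,\ y^3s_2^3s_3=s_{n-1}^z,\ s_i^3s_{i+1}^3s_{i+2}=1\ (2\le i\le n-3),\ s_{n-2}^3=s_{n-1}^3=1\rangle,$$ where $s_i$ is read as $1$ for every index $i$ outside $\{2,\dots,n-1\}$. For a finite $3$-group $G$ generated by $x,y$ put $H_1=\langle y,G'\rangle$, $H_2=\langle x,G'\rangle$, $H_3=\langle xy,G'\rangle$, $H_4=\langle xy^2,G'\rangle$. The shallow transfer kernel type is $\varkappa_s(G)=(\kappa_1,\dots,\kappa_4)$, where $\kappa_i=0$ if the Artin transfer $G/G'\to H_i/H_i'$ has kernel $G/G'$, and $\kappa_i=j$ if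 it has kernel $H_j/G'$. The deep transfer kernel type is $\varkappa_d(G)=(d_1,\dots,d_4)$, where $d_i$ is the order of the kernel of the Artin transfer $H_i/H_i'\to G'/G''$. Theorem. Let $G$ be a finite noncyclic $3$-group of order $3^n$, $n\ge 2$, and of coclass $1$ (that is, of nilpotency class $n-1$). Then $G\cong G_a^n(z,w)$ for the parameters of at least one row of the following table. Moreover, whenever $(n,a,z,w)$ is as in a row of the table and $\varphi:G_a^n(z,w)\to G$ is an isomorphism, then, with $x,y\in G$ the images under $\varphi$ of the generators $x,y$, the groups $H_1,\dots,H_4$ are pairwise distinct and are exactly the maximal subgroups of $G$; if $n\ge 4$, then $H_1$ equals the two-step centralizer $\chi_2(G)=\{g\in G\mid [g,h]\in\gamma_4(G)\text{ for all }h\in G'\}$; and $\varkappa_s(G)$, $\varkappa_d(G)$ are given by that row: $$\begin{array}{llll} G\cong & n & \varkappa_s(G) & \varkappa_d(G)\\ G_0^n(0,0) & n=2 & (0,0,0,0) & (3,3,3,3)\\ G_0^n(0,0) & n\ge 3 & (0,0,0,0) & (9,9,9,9)\\ G_1^n(0,0) & n\ge 5 & (0,0,0,0) & (3,9,3,3)\\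 G_1^n(0,-1) & n\ge 5 & (0,0,0,0) & (3,3,9,9)\\ G_1^n(0,1) & n\ge 5 & (0,0,0,0) & (3,3,3,3)\\ G_0^n(0,1) & n\ge 4 & (1,0,0,0) & (9,3,3,3)\\ G_0^n(-1,0) & n\ge 4\text{ even} & (2,0,0,0) & (9,9,3,3)\\ G_0^n(1,0) & n\ge 5 & (2,0,0,0) & (9,9,3,3)\\ G_0^n(1,0) & n=4 & (2,0,0,0) & (27,9,3,3)\\ G_0^n(0,1) & n=3 & (1,1,1,1) & (9,3,3,3) \end{array}$$ -/

import Mathlib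

namespace CoclassOne

/-- The commutator `[g,h] = g⁻¹h⁻¹gh`. -/
def comm {G : Type*} [Group G] (g h : G) : G := g⁻¹ * h⁻¹ * g * h

section Presentation

/-- The symbols `x, y, s₂, …, s_{n-1}`. -/
inductive Gen (n : ℕ) : Type
  | x : Gen n
  | y : Gen n
  | s (i : ℕ) (h₁ : 2 ≤ i) (h₂ : i < n) : Gen n

/-- The word `x`. -/
def X (n : ℕ) : FreeGroup (Gen n) := FreeGroup.of Gen.x

/-- The word `y`. -/
def Y (n : ℕ) : FreeGroup (Gen n) := FreeGroup.of Gen.y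

/-- The word `s_i`: a generator for `2 ≤ i ≤ n - 1`, and the empty word for every other index. -/
def S (n i : ℕ) : FreeGroup (Gen n) :=
  if h : 2 ≤ i ∧ i < n then FreeGroup.of (Gen.s i h.1 h.2) else 1

/-- `Relation n a z w u v` says that `u = v` is one of the defining relations of `G_a^n(z,w)`. -/
inductive Relation (n : ℕ) (a z w : ℤ) : FreeGroup (Gen n) → FreeGroup (Gen n) → Prop
  | s_two : Relation n a z w (S n 2) (comm (Y n) (X n))
  | s_step (i : ℕ) (h₁ : 3 ≤ i) (h₂ : i ≤ n) :
      Relation n a z w (S n i) (comm (S n (i - 1)) (X n))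
  | s_last : Relation n a z w (S n n) 1
  | y_s_two : Relation n a z w (comm (Y n) (S n 2)) (S n (n - 1) ^ a)
  | y_s (i : ℕ) (h₁ : 3 ≤ i) (h₂ : i + 1 ≤ n) : Relation n a z w (comm (Y n) (S n i)) 1
  | x_cube : Relation n a z w (X n ^ 3) (S n (n - 1) ^ w)
  | y_cube : Relation n a z w (Y n ^ 3 * S n 2 ^ 3 * S n 3) (S n (n - 1) ^ z)
  | s_cube (i : ℕ) (h₁ : 2 ≤ i) (h₂ : i + 3 ≤ n) :
      Relation n a z w (S n i ^ 3 * S n (i + 1) ^ 3 * S n (i + 2)) 1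
  | s_cube_penultimate : Relation n a z w (S n (n - 2) ^ 3) 1
  | s_cube_last : Relation n a z w (S n (n - 1) ^ 3) 1

/-- The relators `u v⁻¹` of `G_a^n(z,w)`. -/
def relators (n : ℕ) (a z w : ℤ) : Set (FreeGroup (Gen n)) :=
  {r | ∃ u v, Relation n a z w u v ∧ r = u * v⁻¹}

/-- The group `G_a^n(z,w)`. -/
abbrev ParamGroup (n : ℕ) (a z w : ℤ) : Type := PresentedGroup (relators n a z w)

/-- The generator `x` of `G_a^n(z,w)`. -/
def ParamGroup.x (n : ℕ) (a z w : ℤ) : ParamGroup n a z w := PresentedGroup.of Gen.x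

/-- The generator `y` of `G_a^n(z,w)`. -/
def ParamGroup.y (n : ℕ) (a z w : ℤ) : ParamGroup n a z w := PresentedGroup.of Gen.y

end Presentation

section Transfer

variable {G : Type*} [Group G]

/-- The Artin transfer `G/G' → H/H'`. -/
noncomputable def artinTransfer (H : Subgroup G) [H.FiniteIndex] :
    Abelianization G →* Abelianization H :=
  Abelianization.lift (MonoidHom.transfer (Abelianization.of : H →* Abelianization H))

/-- The subgroups `H₁ = ⟨y,G'⟩`, `H₂ = ⟨x,G'⟩`, `H₃ = ⟨xy,G'⟩`, `H₄ = ⟨xy²,G'⟩`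
(with indices shifted to `0, 1, 2, 3`). -/
def maxSubgroup (x y : G) (i : Fin 4) : Subgroup G :=
  Subgroup.closure {(![y, x, x * y, x * y ^ 2] : Fin 4 → G) i} ⊔ commutator G

/-- The two-step centralizer `χ₂(G)` of `G'` in `G`, the set of all `g` such that
`[g,h] ∈ γ₄(G)` for all `h ∈ G'`. Mathlib's lower central series starts at index `0`. -/
def twoStepCentralizer (G : Type*) [Group G] : Set G :=
  {g | ∀ h ∈ commutator G, comm g h ∈ (⊤ : Subgroup G).lowerCentralSeries 3}

/-- `κ` is the shallow transfer kernel type of `G` with respect to the ordering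
`H₁, …, H₄` given by `x, y`: one has `κ_i = 0` if the kernel of `G/G' → H_i/H_i'` is `G/G'`,
and `κ_i = j` if that kernel is `H_j/G'`. -/
def IsShallowTKT [Finite G] (x y : G) (κ : Fin 4 → ℕ) : Prop :=
  ∀ i : Fin 4,
    (κ i = 0 ∧ (artinTransfer (maxSubgroup x y i)).ker = ⊤) ∨
    ∃ j : Fin 4, κ i = (j : ℕ) + 1 ∧
      (artinTransfer (maxSubgroup x y i)).ker = (maxSubgroup x y j).map Abelianization.of

/-- The deep transfer kernel type of `G` with respect to the ordering `H₁, …, H₄` given by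
`x, y`: the orders of the kernels of the transfers `H_i/H_i' → G'/G''`. -/
noncomputable def deepTKT [Finite G] (x y : G) (i : Fin 4) : ℕ :=
  Nat.card (artinTransfer ((commutator G).subgroupOf (maxSubgroup x y i))).ker

end Transfer

/-- The rows `(n, a, z, w)` of the table, with the shallow type `κs` and the deep type `κd`. -/
inductive TableRow : (n : ℕ) → (a z w : ℤ) → (κs κd : Fin 4 → ℕ) → Prop
  | a1_root : TableRow 2 0 0 0 ![0, 0, 0, 0] ![3, 3, 3, 3]
  | a1_mainline (n : ℕ) (h : 3 ≤ n) : TableRow n 0 0 0 ![0, 0, 0, 0] ![9, 9, 9, 9]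
  | a1_zero (n : ℕ) (h : 5 ≤ n) : TableRow n 1 0 0 ![0, 0, 0, 0] ![3, 9, 3, 3]
  | a1_neg (n : ℕ) (h : 5 ≤ n) : TableRow n 1 0 (-1) ![0, 0, 0, 0] ![3, 3, 9, 9]
  | a1_pos (n : ℕ) (h : 5 ≤ n) : TableRow n 1 0 1 ![0, 0, 0, 0] ![3, 3, 3, 3]
  | a2 (n : ℕ) (h : 4 ≤ n) : TableRow n 0 0 1 ![1, 0, 0, 0] ![9, 3, 3, 3]
  | a3_neg (n : ℕ) (h : 4 ≤ n) (heven : Even n) :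
      TableRow n 0 (-1) 0 ![2, 0, 0, 0] ![9, 9, 3, 3]
  | a3_pos (n : ℕ) (h : 5 ≤ n) : TableRow n 0 1 0 ![2, 0, 0, 0] ![9, 9, 3, 3]
  | a3_star : TableRow 4 0 1 0 ![2, 0, 0, 0] ![27, 9, 3, 3]
  | A1 : TableRow 3 0 0 1 ![1, 1, 1, 1] ![9, 3, 3, 3]

end CoclassOne

namespace CoclassOne

open Subgroup

/-! ### Commutator calculus and conjugation. -/

section Commutators

variable {G : Type*} [Group G]

/-! Write n = m + 3, t_0 = y and t_{k+1} = [t_k, x] (`iterComm`), so that s_{k+1} = t_k for k ≥ 1,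
and let ζ = t_{m+1} = s_{n-1} be the last term. The presentation then becomes a condition
`IsStandardPair` on two elements x, y. Its relations make the subgroups `tail x y j` = ⟨t_k : k ≥ j⟩
normal with steps of index at most three, so a group generated by a standard pair has order at most
3^n (`finite_card_le`). A generating standard pair in a group of order 3^n therefore gives an
isomorphism with the presented group (`nonempty_mulEquiv`).

Such a pair exists by induction along G → G/Z(G): the centre has order three and the quotient is
again of coclass one (`card_center_of_maximal_class`). Any lifts of the generators work, except that
over a quotient of order 27 they have to be chosen (`exists_commute_comm`). The commutator relations
survive because an element commutes with the cube of anything it commutes with modulo the centre,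
while the cubing relations express t_{k+2} through cubes up to a central factor
(`isLiftPair_of_two_le`). The cubing relations survive because x³ and (xy)³ are central and (xy)³ is
x³ times the product of the conjugates of y under 1, x, x² (`conj_cube`, `trace_y`). The
substitutions x ↦ xy, y ↦ y⁻¹ and x ↦ x⁻¹ act on (a, z, w) modulo 3 and lead to the rows of the
table (`exists_tableRow`); in order 27 the two generators are also exchanged
(`exists_tableRow_zero`).

The transfer to a normal subgroup H of index three sends g ∉ H to g³ modulo H', and the elements
outside H generate the group; so both kernel types are read off from cubes. Here H₁' = ⟨ζ^a⟩ and H₂'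
= `tail x y 2` = γ₃(G). Elements of H₂ outside G' have cube x³ or x⁻³, cubing is a homomorphism on
H₁ with image γ₃(G) in general, and all cubes lie in γ₃(G) if n ≥ 4. The groups H₃ and H₄ are the
groups H₂ of the standard pairs (xy, y) and (xy², y). Order nine is treated separately. -/

theorem comm_eq_one_iff {g h : G} : comm g h = 1 ↔ Commute g h := by
  rw [comm, mul_assoc (g⁻¹ * h⁻¹), ← mul_inv_rev, inv_mul_eq_one, eq_comm]
  rfl

theorem mul_eq_mul_comm (g h : G) : g * h = h * g * comm g h := by
  simp [comm, mul_assoc]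

theorem map_comm {H : Type*} [Group H] (f : G →* H) (g h : G) :
    f (comm g h) = comm (f g) (f h) := by
  simp [comm]

theorem comm_inv (g h : G) : (comm g h)⁻¹ = comm h g := by
  simp [comm, mul_assoc]

open scoped commutatorElement in
theorem comm_eq_commutatorElement (g h : G) : comm g h = ⁅g⁻¹, h⁻¹⁆ := by
  simp [comm, commutatorElement_def]

/-- If `c = [h,g]` is centralized by `g` and `h`, then `(gh)^3 = g^3 h^3 c^3`. -/
theorem mul_cube {g h c : G} (hc : h * g = g * h * c) (h₁ : Commute c g) (h₂ : Commute c h) :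
    (g * h) ^ 3 = g ^ 3 * h ^ 3 * c ^ 3 := by
  have a₁ : h * g = g * (h * c) := by rw [hc, mul_assoc]
  have a₁' (r : G) : h * (g * r) = g * (h * (c * r)) := by
    rw [← mul_assoc, a₁]; simp only [mul_assoc]
  have b₁' (r : G) : c * (g * r) = g * (c * r) := by
    rw [← mul_assoc, h₁.eq, mul_assoc]
  have b₂' (r : G) : c * (h * r) = h * (c * r) := by
    rw [← mul_assoc, h₂.eq, mul_assoc]
  simp only [pow_succ, pow_zero, one_mul, mul_assoc, a₁', b₁', h₂.eq, b₂']

/-- If `[p,q]` is centralized by `p` and `q` and has exponent three, then `p` commutes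
with `q^3`. -/
theorem commute_cube {p q c : G} (hc : p * q = q * p * c) (h₂ : Commute c q)
    (h₃ : c ^ 3 = 1) : Commute p (q ^ 3) := by
  have hs : SemiconjBy p q (p * q * p⁻¹) := by simp [SemiconjBy]
  have key : p⁻¹ * q * p = q * c⁻¹ := by
    rw [mul_assoc, inv_mul_eq_iff_eq_mul, ← mul_assoc, hc, mul_inv_cancel_right]
  have key3 : p⁻¹ * q ^ 3 * p = q ^ 3 := by
    have : p⁻¹ * q ^ 3 * p = (p⁻¹ * q * p) ^ 3 := by simp [pow_succ, mul_assoc]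
    rw [this, key, (h₂.symm.inv_right).mul_pow, inv_pow, h₃, inv_one, mul_one]
  have : p * (p⁻¹ * q ^ 3 * p) = p * q ^ 3 := by rw [key3]
  simpa [mul_assoc, Commute, SemiconjBy, eq_comm] using this

/-- Separates x³ from the product of the conjugates of g under x², x and 1 (the trace of g). Cubes
outside H₁ are computed through this trace. -/
theorem conj_cube (x g : G) :
    (x * g) ^ 3 = x ^ 3 * ((x⁻¹ * (x⁻¹ * g * x) * x) * (x⁻¹ * g * x) * g) := by
  simp [pow_succ, mul_assoc]

theorem conj_of_commute {g h : G} (hc : Commute g h) : g⁻¹ * h * g = h := by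
  rw [mul_assoc, ← hc.eq, inv_mul_cancel_left]

theorem commute_of_conj {g h : G} (hc : g⁻¹ * h * g = h) : Commute g h := by
  have := congrArg (g * ·) hc
  simpa [mul_assoc, Commute, SemiconjBy, eq_comm] using this

/-- Conjugation `h ↦ g⁻¹hg`. -/
def conjBy (g : G) : G ≃* G := MulAut.conj g⁻¹

theorem conjBy_apply (g h : G) : conjBy g h = g⁻¹ * h * g := by
  simp [conjBy]

theorem conjBy_eq_self {g h : G} : conjBy g h = h ↔ Commute g h :=
  ⟨fun hc => commute_of_conj (by rwa [conjBy_apply] at hc),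
    fun hc => by rw [conjBy_apply, conj_of_commute hc]⟩

theorem conjBy_eq_mul_comm (g h : G) : conjBy g h = h * comm h g := by
  simp [conjBy_apply, comm, mul_assoc]

/-- A subgroup with `conjBy s K = K` for all `s` in a generating set is normal. -/
theorem normal_of_map_conjBy {S : Set G} (hS : closure S = ⊤) {K : Subgroup G}
    (h : ∀ s ∈ S, K.map (conjBy s : G →* G) = K) : K.Normal := by
  rw [← normalizer_eq_top_iff, eq_top_iff, ← hS, closure_le]
  intro s hs
  -- `conjBy s` is conjugation by s⁻¹ in Mathlib's convention, so the inverse is what lands in the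
  -- normalizer.
  have : s⁻¹ ∈ normalizer (K : Set G) := mem_normalizer_iff_map_conj_eq.2 (h s hs)
  simpa using this

end Commutators

/-! ### Adjoining an element whose cube is already present. -/

section Cardinality

variable {G : Type*} [Group G]

/-- The cosets of 1, g, g² exhaust N⟨g⟩. Applied along a chain, this bounds the order of the whole
group from above; if that order is known, it bounds the members of the chain from below. -/
theorem finite_card_sup_zpowers (N : Subgroup G) [N.Normal] [Finite N] {g : G}
    (hg : g ^ 3 ∈ N) :
    Finite (N ⊔ zpowers g : Subgroup G) ∧
      Nat.card (N ⊔ zpowers g : Subgroup G) ≤ 3 * Nat.card N := by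
  let f : Fin 3 × N → (N ⊔ zpowers g : Subgroup G) := fun p =>
    ⟨p.2 * g ^ (p.1 : ℕ), mul_mem_sup p.2.2 (pow_mem (mem_zpowers g) _)⟩
  have hf : Function.Surjective f := by
    rintro ⟨k, hk⟩
    obtain ⟨b, hb, c, hc, rfl⟩ := mem_sup_of_normal_left.1 hk
    obtain ⟨i, rfl⟩ := mem_zpowers_iff.1 hc
    have h0 : 0 ≤ i % 3 := Int.emod_nonneg _ (by norm_num)
    have h3 : i % 3 < 3 := Int.emod_lt_of_pos _ (by norm_num)
    have hi : ((i % 3).toNat : ℤ) = i % 3 := Int.toNat_of_nonneg h0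
    refine ⟨(⟨(i % 3).toNat, by omega⟩, ⟨b * (g ^ 3) ^ (i / 3), mul_mem hb (zpow_mem hg _)⟩), ?_⟩
    apply Subtype.ext
    change b * (g ^ 3) ^ (i / 3) * g ^ (i % 3).toNat = b * g ^ i
    rw [← zpow_natCast g (i % 3).toNat, hi, mul_assoc, ← zpow_natCast g 3, ← zpow_mul, ← zpow_add]
    congr 2
    push_cast
    omega
  have hfin := Finite.of_surjective f hf
  refine ⟨hfin, (Nat.card_le_card_of_surjective f hf).trans ?_⟩
  simp

end Cardinality

/-! ### The chain of iterated commutators. -/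

section Chain

variable {G : Type*} [Group G]

/-- The iterated commutators `y, [y,x], [y,x,x], …`. -/
def iterComm (x y : G) : ℕ → G
  | 0 => y
  | k + 1 => comm (iterComm x y k) x

@[simp] theorem iterComm_zero (x y : G) : iterComm x y 0 = y := rfl

theorem iterComm_succ (x y : G) (k : ℕ) :
    iterComm x y (k + 1) = comm (iterComm x y k) x := rfl

theorem conjBy_iterComm (x y : G) (k : ℕ) :
    conjBy x (iterComm x y k) = iterComm x y k * iterComm x y (k + 1) :=
  conjBy_eq_mul_comm _ _

theorem map_iterComm {H : Type*} [Group H] (f : G →* H) (x y : G) (k : ℕ) :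
    f (iterComm x y k) = iterComm (f x) (f y) k := by
  induction k with
  | zero => rfl
  | succ k ih => rw [iterComm_succ, map_comm, ih, iterComm_succ]

theorem iterComm_eq_one_of_le {x y : G} {j k : ℕ} (hj : iterComm x y j = 1) (hjk : j ≤ k) :
    iterComm x y k = 1 := by
  induction k, hjk using Nat.le_induction with
  | base => exact hj
  | succ k _ ih => rw [iterComm_succ, ih]; simp [comm]

/-- The subgroup generated by the `k`-fold commutators `[y,x,…,x]` with `k ≥ j`. -/
def tail (x y : G) (j : ℕ) : Subgroup G := closure {g | ∃ k, j ≤ k ∧ g = iterComm x y k}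

theorem iterComm_mem_tail {x y : G} {j k : ℕ} (h : j ≤ k) : iterComm x y k ∈ tail x y j :=
  subset_closure ⟨k, h, rfl⟩

theorem tail_le_iff {x y : G} {j : ℕ} {H : Subgroup G} :
    tail x y j ≤ H ↔ ∀ k, j ≤ k → iterComm x y k ∈ H := by
  rw [tail, closure_le]
  exact ⟨fun h k hk => h ⟨k, hk, rfl⟩, by rintro h _ ⟨k, hk, rfl⟩; exact h k hk⟩

theorem tail_anti {x y : G} {i j : ℕ} (h : i ≤ j) : tail x y j ≤ tail x y i :=
  tail_le_iff.2 fun _ hk => iterComm_mem_tail (h.trans hk)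

theorem tail_eq_sup (x y : G) (j : ℕ) :
    tail x y j = tail x y (j + 1) ⊔ zpowers (iterComm x y j) := by
  refine le_antisymm (tail_le_iff.2 fun k hk => ?_)
    (sup_le (tail_anti j.le_succ) (zpowers_le.2 (iterComm_mem_tail le_rfl)))
  rcases hk.eq_or_lt with rfl | hk
  · exact mem_sup_right (mem_zpowers _)
  · exact mem_sup_left (iterComm_mem_tail hk)

theorem tail_eq_bot {x y : G} {j : ℕ} (hj : iterComm x y j = 1) : tail x y j = ⊥ :=
  eq_bot_iff.2 (tail_le_iff.2 fun k hk => by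
    simp [iterComm_eq_one_of_le hj hk])

/-- Downward induction from M, where the commutators become trivial: t_k t_{k+1} ∈ H and t_{k+1} ∈ H
give t_k ∈ H. As t_k t_{k+1} is the conjugate of t_k by x, this passes from conjugates to the
elements themselves without assuming finiteness. -/
theorem iterComm_mem_of_mul_mem {x y : G} {M : ℕ} (hM : iterComm x y M = 1) {j : ℕ}
    {H : Subgroup G} (h : ∀ k, j ≤ k → iterComm x y k * iterComm x y (k + 1) ∈ H) :
    ∀ k, j ≤ k → iterComm x y k ∈ H := by
  have aux (i : ℕ) : ∀ k, j ≤ k → M ≤ k + i → iterComm x y k ∈ H := by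
    induction i with
    | zero => intro k _ hk; rw [iterComm_eq_one_of_le hM (k := k) (by omega)]; exact one_mem _
    | succ i ih =>
      intro k hjk hk
      have h₁ := ih (k + 1) (by omega) (by omega)
      exact (H.mul_mem_cancel_right h₁).1 (h k hjk)
  exact fun k hk => aux M k hk (by omega)

theorem map_conjBy_tail {x y : G} {M : ℕ} (hM : iterComm x y M = 1) (j : ℕ) :
    (tail x y j).map (conjBy x : G →* G) = tail x y j := by
  refine le_antisymm ?_ ?_
  · rw [map_le_iff_le_comap, tail_le_iff]
    intro k hk
    simp only [mem_comap, MonoidHom.coe_coe, conjBy_iterComm]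
    exact mul_mem (iterComm_mem_tail hk) (iterComm_mem_tail (by omega))
  · rw [tail_le_iff]
    refine iterComm_mem_of_mul_mem hM fun k hk => ?_
    rw [← conjBy_iterComm]
    exact mem_map_of_mem _ (iterComm_mem_tail hk)

end Chain

/-- The commutator relations of `G_a^{m+3}(z,w)`, in terms of `x` and `y` alone. -/
structure IsCommPair {G : Type*} [Group G] (m : ℕ) (a : ℤ) (x y : G) : Prop where
  last : iterComm x y (m + 2) = 1
  y_one : comm y (iterComm x y 1) = iterComm x y (m + 1) ^ a
  y_ge : ∀ k, 2 ≤ k → Commute y (iterComm x y k)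
  -- For n ≤ 4 this restriction is what makes ζ central (n = 3) and H₁ the two-step centralizer (n =
  -- 4).
  a_eq : m < 2 → a = 0

/-- The relations of `G_a^{m+3}(z,w)`, in terms of `x` and `y` alone. -/
structure IsStandardPair {G : Type*} [Group G] (m : ℕ) (a z w : ℤ) (x y : G) : Prop
    extends IsCommPair m a x y where
  x_cube : x ^ 3 = iterComm x y (m + 1) ^ w
  y_cube : y ^ 3 * iterComm x y 1 ^ 3 * iterComm x y 2 = iterComm x y (m + 1) ^ z
  t_cube : ∀ k, 1 ≤ k →
    iterComm x y k ^ 3 * iterComm x y (k + 1) ^ 3 * iterComm x y (k + 2) = 1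

/-! ### Consequences of the commutator relations. -/

namespace IsCommPair

variable {G : Type*} [Group G] {m : ℕ} {a : ℤ} {x y : G}

theorem map {H : Type*} [Group H] (h : IsCommPair m a x y) (f : G →* H) :
    IsCommPair m a (f x) (f y) where
  last := by rw [← map_iterComm, h.last, map_one]
  y_one := by rw [← map_iterComm, ← map_comm, h.y_one, map_zpow, map_iterComm]
  y_ge k hk := by rw [← map_iterComm]; exact (h.y_ge k hk).map f
  a_eq := h.a_eq

theorem eq_one (h : IsCommPair m a x y) {k : ℕ} (hk : m + 2 ≤ k) : iterComm x y k = 1 :=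
  iterComm_eq_one_of_le h.last hk

/-- Induction on j. Conjugating by x, t_j t_{j+1} commutes with every t_k t_{k+1}, k ≥ 2, hence by
downward induction with every t_k; cancelling t_j leaves t_{j+1}. So the relations for y alone force
`tail x y 1` to be abelian. -/
theorem commute_iterComm_aux (h : IsCommPair m a x y) (j : ℕ) :
    ∀ k, 2 ≤ k → Commute (iterComm x y j) (iterComm x y k) := by
  induction j with
  | zero => exact h.y_ge
  | succ j ih =>
    have h₁ : ∀ k, 2 ≤ k → iterComm x y k ∈ centralizer {conjBy x (iterComm x y j)} := by
      refine iterComm_mem_of_mul_mem h.last fun k hk => ?_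
      rw [← conjBy_iterComm, mem_centralizer_singleton_iff]
      exact (((ih k hk).symm).map (conjBy x))
    intro k hk
    have h₂ : Commute (iterComm x y j * iterComm x y (j + 1)) (iterComm x y k) := by
      rw [← conjBy_iterComm]
      exact Commute.symm (mem_centralizer_singleton_iff.1 (h₁ k hk))
    have := (ih k hk).inv_left.mul_left h₂
    rwa [inv_mul_cancel_left] at this

theorem commute_iterComm (h : IsCommPair m a x y) {j k : ℕ} (hj : 1 ≤ j) (hk : 1 ≤ k) :
    Commute (iterComm x y j) (iterComm x y k) := by
  rcases hk.eq_or_lt with rfl | hk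
  · rcases hj.eq_or_lt with rfl | hj
    · exact Commute.refl _
    · exact (h.commute_iterComm_aux 1 j hj).symm
  · exact h.commute_iterComm_aux j k hk

/-- The last nontrivial iterated commutator commutes with `x`. -/
theorem commute_x_last (h : IsCommPair m a x y) : Commute (iterComm x y (m + 1)) x :=
  comm_eq_one_iff.1 h.last

theorem commute_y_one (h : IsCommPair m a x y) (ha : a = 0) : Commute y (iterComm x y 1) := by
  rw [← comm_eq_one_iff, h.y_one, ha, zpow_zero]

theorem commute_y_last (h : IsCommPair m a x y) : Commute y (iterComm x y (m + 1)) := by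
  rcases Nat.eq_zero_or_pos m with rfl | hm
  · exact h.commute_y_one (h.a_eq (by norm_num))
  · exact h.y_ge _ (by omega)

theorem commute_iterComm_last (h : IsCommPair m a x y) (k : ℕ) :
    Commute (iterComm x y k) (iterComm x y (m + 1)) := by
  rcases Nat.eq_zero_or_pos k with rfl | hk
  · exact h.commute_y_last
  · exact h.commute_iterComm hk (by omega)

theorem last_mem_center (h : IsCommPair m a x y) (hG : closure {x, y} = ⊤) :
    iterComm x y (m + 1) ∈ center G := by
  have : closure {x, y} ≤ centralizer {iterComm x y (m + 1)} := by
    rw [closure_le]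
    rintro g (rfl | rfl)
    · exact mem_centralizer_singleton_iff.2 h.commute_x_last.symm
    · exact mem_centralizer_singleton_iff.2 h.commute_y_last
  rw [hG] at this
  rw [mem_center_iff]
  intro g
  exact mem_centralizer_singleton_iff.1 (this (mem_top g))

/-- Conjugation by y fixes every t_k except t_1, which it multiplies by ζ^(-a); and ζ lies in each
tail that contains t_1. -/
theorem map_conjBy_y_tail (h : IsCommPair m a x y) (j : ℕ) :
    (tail x y j).map (conjBy y : G →* G) = tail x y j := by
  have hk : ∀ k, k ≠ 1 → conjBy y (iterComm x y k) = iterComm x y k := fun k hk => by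
    rw [conjBy_eq_self]
    rcases Nat.eq_zero_or_pos k with rfl | h0
    · exact Commute.refl _
    · exact h.y_ge k (by omega)
  have h1 : conjBy y (iterComm x y 1) = iterComm x y 1 * (iterComm x y (m + 1) ^ a)⁻¹ := by
    rw [conjBy_eq_mul_comm, ← comm_inv, h.y_one]
  have hz : j ≤ 1 → iterComm x y (m + 1) ^ a ∈ tail x y j :=
    fun hj => zpow_mem (iterComm_mem_tail (by omega)) _
  refine le_antisymm ?_ ?_
  · rw [map_le_iff_le_comap, tail_le_iff]
    intro k hjk
    simp only [mem_comap, MonoidHom.coe_coe]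
    by_cases h' : k = 1
    · subst h'
      rw [h1]
      exact mul_mem (iterComm_mem_tail hjk) (inv_mem (hz hjk))
    · rw [hk k h']
      exact iterComm_mem_tail hjk
  · rw [tail_le_iff]
    intro k hjk
    by_cases h' : k = 1
    · subst h'
      refine ⟨iterComm x y 1 * iterComm x y (m + 1) ^ a,
        mul_mem (iterComm_mem_tail hjk) (hz hjk), ?_⟩
      rw [MonoidHom.coe_coe, map_mul, h1, map_zpow, conjBy_eq_self.2 h.commute_y_last,
        inv_mul_cancel_right]
    · exact ⟨_, iterComm_mem_tail hjk, hk k h'⟩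

theorem normal_tail (h : IsCommPair m a x y) (hG : closure {x, y} = ⊤) (j : ℕ) :
    (tail x y j).Normal := by
  refine normal_of_map_conjBy hG ?_
  rintro s (rfl | rfl)
  · exact map_conjBy_tail h.last j
  · exact h.map_conjBy_y_tail j

theorem tail_zero_sup (hG : closure {x, y} = ⊤) : tail x y 0 ⊔ zpowers x = ⊤ := by
  rw [eq_top_iff, ← hG, closure_le]
  rintro g (rfl | rfl)
  · exact mem_sup_right (mem_zpowers _)
  · exact mem_sup_left (iterComm_mem_tail (k := 0) le_rfl)

end IsCommPair

/-! ### Standard pairs and the order of the group they generate. -/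

namespace IsStandardPair

variable {G : Type*} [Group G] {m : ℕ} {a z w : ℤ} {x y : G}

theorem map {H : Type*} [Group H] (h : IsStandardPair m a z w x y) (f : G →* H) :
    IsStandardPair m a z w (f x) (f y) where
  toIsCommPair := h.toIsCommPair.map f
  x_cube := by rw [← map_iterComm, ← map_pow, h.x_cube, map_zpow]
  y_cube := by simp only [← map_iterComm, ← map_pow, ← map_mul, h.y_cube, map_zpow]
  t_cube k hk := by simp only [← map_iterComm, ← map_pow, ← map_mul, h.t_cube k hk, map_one]

theorem last_cube (h : IsStandardPair m a z w x y) : iterComm x y (m + 1) ^ 3 = 1 := by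
  have := h.t_cube (m + 1) (by omega)
  rwa [h.eq_one (k := m + 1 + 1) (by omega), h.eq_one (k := m + 1 + 2) (by omega), one_pow,
    mul_one, mul_one] at this

/-- In each cubing relation everything except the leading cube lies in the next tail; for j = 0 the
relation is the one for y³. -/
theorem cube_mem_tail (h : IsStandardPair m a z w x y) (j : ℕ) :
    iterComm x y j ^ 3 ∈ tail x y (j + 1) := by
  have key : iterComm x y j ^ 3 * iterComm x y (j + 1) ^ 3 * iterComm x y (j + 2)
      ∈ tail x y (j + 1) → iterComm x y j ^ 3 ∈ tail x y (j + 1) := fun hr => by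
    rwa [Subgroup.mul_mem_cancel_right _ (iterComm_mem_tail (by omega)),
      Subgroup.mul_mem_cancel_right _ (pow_mem (iterComm_mem_tail le_rfl) _)] at hr
  refine key ?_
  rcases Nat.eq_zero_or_pos j with rfl | hj
  · have := h.y_cube
    rw [← iterComm_zero x y] at this
    rw [zero_add, zero_add]
    refine (congrArg (· ∈ tail x y 1) this).mpr ?_
    exact zpow_mem (iterComm_mem_tail (by omega)) _
  · rw [h.t_cube j hj]
    exact one_mem _

theorem finite_card_tail (h : IsStandardPair m a z w x y) (hG : closure {x, y} = ⊤)
    {i j : ℕ} (hij : i + j = m + 2) :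
    Finite (tail x y j) ∧ Nat.card (tail x y j) ≤ 3 ^ i := by
  induction i generalizing j with
  | zero =>
    obtain rfl : j = m + 2 := by omega
    rw [tail_eq_bot h.last]
    exact ⟨inferInstance, by simp⟩
  | succ i ih =>
    obtain ⟨h₁, h₂⟩ := ih (j := j + 1) (by omega)
    have := h.normal_tail hG (j + 1)
    have := finite_card_sup_zpowers (tail x y (j + 1)) (h.cube_mem_tail j)
    rw [tail_eq_sup]
    refine ⟨this.1, this.2.trans ?_⟩
    rw [pow_succ']
    omega

theorem x_cube_mem (h : IsStandardPair m a z w x y) {j : ℕ} (hj : j ≤ m + 1) :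
    x ^ 3 ∈ tail x y j := by
  rw [h.x_cube]
  exact zpow_mem (iterComm_mem_tail hj) _

/-- The group presented by the relations of `G_a^{m+3}(z,w)` has at most `3^{m+3}` elements. -/
theorem finite_card_le (h : IsStandardPair m a z w x y) (hG : closure {x, y} = ⊤) :
    Finite G ∧ Nat.card G ≤ 3 ^ (m + 3) := by
  obtain ⟨h₁, h₂⟩ := h.finite_card_tail hG (i := m + 2) (j := 0) rfl
  have := h.normal_tail hG 0
  have := finite_card_sup_zpowers (tail x y 0) (h.x_cube_mem (Nat.zero_le _))
  have hle := this
  rw [IsCommPair.tail_zero_sup hG, card_top] at hle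
  have := hle.1
  have hfin : Finite G := Finite.of_equiv _ (topEquiv (G := G)).toEquiv
  refine ⟨hfin, hle.2.trans ?_⟩
  rw [pow_succ' 3 (m + 2)]
  omega

/-- In a group of order `3^{m+3}` the chain of the subgroups `tail x y j` has steps of index
three. -/
theorem card_tail (h : IsStandardPair m a z w x y) (hG : closure {x, y} = ⊤)
    (hcard : Nat.card G = 3 ^ (m + 3)) {i j : ℕ} (hij : i + j = m + 2) :
    Nat.card (tail x y j) = 3 ^ i := by
  refine le_antisymm (h.finite_card_tail hG hij).2 ?_
  -- Each step of the chain has index at most three, so a total order of 3^{m+3} leaves no slack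
  -- anywhere.
  have low : ∀ j, 3 ^ (m + 2) ≤ 3 ^ j * Nat.card (tail x y j) := by
    intro j
    have := fun k => h.normal_tail hG k
    have hfin : Finite G := (h.finite_card_le hG).1
    induction j with
    | zero =>
      have := finite_card_sup_zpowers (tail x y 0) (h.x_cube_mem (Nat.zero_le _))
      rw [IsCommPair.tail_zero_sup hG, card_top, hcard, pow_succ'] at this
      omega
    | succ j ih =>
      have := (finite_card_sup_zpowers (tail x y (j + 1)) (h.cube_mem_tail j)).2
      rw [← tail_eq_sup] at this
      calc _ ≤ _ := ih
        _ ≤ _ := Nat.mul_le_mul_left _ this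
        _ = _ := by ring
  have := low j
  rw [← hij, pow_add, mul_comm] at this
  exact Nat.le_of_mul_le_mul_left this (by positivity)

end IsStandardPair

end CoclassOne

/-! ### The substitutions x ↦ xy and y ↦ y⁻¹. -/

namespace CoclassOne

open Subgroup

section

variable {G : Type*} [Group G]

theorem commute_comm {c g h : G} (h₁ : Commute c g) (h₂ : Commute c h) : Commute c (comm g h) :=
  ((h₁.inv_right.mul_right h₂.inv_right).mul_right h₁).mul_right h₂

theorem comm_mul_of_commute {c g h : G} (h₁ : Commute c h) (h₂ : Commute c (comm g h)) :
    comm (g * c) h = comm g h := by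
  have : comm (g * c) h = c⁻¹ * comm g h * c := by
    simp [comm, mul_assoc, h₁.eq]
  rw [this, conj_of_commute h₂]

theorem comm_inv_left {g h : G} (hc : Commute g (comm g h)) : comm g⁻¹ h = (comm g h)⁻¹ := by
  have : comm g⁻¹ h = g * (comm g h)⁻¹ * g⁻¹ := by simp [comm, mul_assoc]
  rw [this, hc.inv_right.eq, mul_inv_cancel_right]

end

namespace IsCommPair

variable {G : Type*} [Group G] {m : ℕ} {a z w : ℤ} {x y : G}

theorem conjBy_y_one (h : IsCommPair m a x y) :
    conjBy y (iterComm x y 1) = iterComm x y 1 * iterComm x y (m + 1) ^ (-a) := by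
  rw [conjBy_eq_mul_comm, ← comm_inv, h.y_one, zpow_neg]

theorem one_mul_y (h : IsCommPair m a x y) :
    iterComm x y 1 * y = y * iterComm x y 1 * iterComm x y (m + 1) ^ (-a) := by
  rw [mul_eq_mul_comm, ← comm_inv, h.y_one, zpow_neg]

/-- The product of the conjugates of `y` under the powers of `x`. -/
theorem trace_y (h : IsCommPair m a x y) :
    conjBy x (conjBy x y) * conjBy x y * y =
      y ^ 3 * iterComm x y 1 ^ 3 * iterComm x y 2 * iterComm x y (m + 1) ^ (-5 * a) := by
  have e₀ : conjBy x y = y * iterComm x y 1 := conjBy_iterComm x y 0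
  rw [e₀, map_mul, e₀, conjBy_iterComm]
  have hc := h.one_mul_y
  -- The product is y t_1 t_1 t_2 · y t_1 · y. Moving the second y to the left crosses t_1 twice and
  -- moving the third crosses it three times; each crossing costs ζ^(-a), five in all.
  have hz : iterComm x y (m + 1) ^ (-5 * a) =
      (iterComm x y (m + 1) ^ (-a)) ^ 5 := by
    rw [← zpow_natCast, ← zpow_mul]; congr 1; ring
  have hy : Commute (iterComm x y (m + 1) ^ (-a)) y := (h.commute_y_last.zpow_right _).symm
  have h1 : Commute (iterComm x y (m + 1) ^ (-a)) (iterComm x y 1) :=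
    ((h.commute_iterComm_last 1).zpow_right _).symm
  have h2 : Commute (iterComm x y (m + 1) ^ (-a)) (iterComm x y 2) :=
    ((h.commute_iterComm_last 2).zpow_right _).symm
  rw [hz]
  generalize iterComm x y (m + 1) ^ (-a) = c at *
  have h3 : Commute (iterComm x y 2) (iterComm x y 1) := h.commute_iterComm (by norm_num) le_rfl
  have h4 : Commute (iterComm x y 2) y := (h.y_ge 2 le_rfl).symm
  simp only [Nat.reduceAdd] at *
  generalize iterComm x y 1 = s at *
  generalize iterComm x y 2 = t at *
  have c₁' (r : G) : s * (y * r) = y * (s * (c * r)) := by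
    rw [← mul_assoc, hc]; simp only [mul_assoc]
  have c₂' (r : G) : c * (y * r) = y * (c * r) := by rw [← mul_assoc, hy.eq, mul_assoc]
  have c₃' (r : G) : c * (s * r) = s * (c * r) := by rw [← mul_assoc, h1.eq, mul_assoc]
  have c₅' (r : G) : c * (t * r) = t * (c * r) := by rw [← mul_assoc, h2.eq, mul_assoc]
  have c₄' (r : G) : t * (y * r) = y * (t * r) := by rw [← mul_assoc, h4.eq, mul_assoc]
  simp only [pow_succ, pow_zero, one_mul, mul_assoc, c₁', c₂', c₃', c₅', c₄', h3.eq,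
    h2.eq, hy.eq]

/-- The cubing relations for the iterated commutators follow from those for `x` and `y`. -/
theorem isStandardPair (h : IsCommPair m a x y) (hζ : iterComm x y (m + 1) ^ 3 = 1)
    (hx : x ^ 3 = iterComm x y (m + 1) ^ w)
    (hy : y ^ 3 * iterComm x y 1 ^ 3 * iterComm x y 2 = iterComm x y (m + 1) ^ z) :
    IsStandardPair m a z w x y where
  toIsCommPair := h
  x_cube := hx
  y_cube := hy
  t_cube := by
    intro k hk
    induction k, hk using Nat.le_induction with
    | base =>
      have e₀ : conjBy x y = y * iterComm x y 1 := conjBy_iterComm x y 0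
      -- The right-hand side is fixed by x, so dividing the conjugated relation by the original one
      -- leaves the same relation with all indices raised by one. The induction step repeats this.
      have h₁ := congrArg (conjBy x) hy
      rw [map_zpow, conjBy_eq_self.2 h.commute_x_last.symm, ← hy] at h₁
      simp only [map_mul, map_pow, conjBy_iterComm, e₀] at h₁
      have hc1 : Commute (iterComm x y (m + 1) ^ (-a)) y := (h.commute_y_last.zpow_right _).symm
      have hc2 : Commute (iterComm x y (m + 1) ^ (-a)) (iterComm x y 1) :=
        ((h.commute_iterComm_last 1).zpow_right _).symm
      have hc3 : (iterComm x y (m + 1) ^ (-a)) ^ 3 = 1 := by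
        rw [← zpow_natCast, zpow_comm, zpow_natCast, hζ, one_zpow]
      rw [mul_cube h.one_mul_y hc1 hc2, hc3, mul_one,
        (h.commute_iterComm le_rfl (by norm_num : 1 ≤ 1 + 1)).mul_pow] at h₁
      simp only [mul_assoc, mul_right_inj] at h₁
      have c1 : Commute (iterComm x y (1 + 1)) (iterComm x y (2 + 1)) :=
        h.commute_iterComm (by norm_num) (by norm_num)
      have h₂ : iterComm x y 1 ^ 3 * iterComm x y (1 + 1) ^ 3 * iterComm x y (1 + 2) *
          iterComm x y 2 = 1 * iterComm x y 2 := by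
        rw [one_mul]
        refine Eq.trans ?_ h₁
        simp only [mul_assoc]
        exact congrArg _ (congrArg _ c1.symm.eq)
      exact mul_right_cancel h₂
    | succ k hk ih =>
      have h₁ := congrArg (conjBy x) ih
      have e1 := h.commute_iterComm hk (by omega : 1 ≤ k + 1)
      have e2 := h.commute_iterComm (by omega : 1 ≤ k + 1) (by omega : 1 ≤ k + 1 + 1)
      have d1 := h.commute_iterComm (by omega : 1 ≤ k + 1) (by omega : 1 ≤ k + 2)
      have d2 := h.commute_iterComm (by omega : 1 ≤ k + 1 + 1) (by omega : 1 ≤ k + 2)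
      simp only [map_mul, map_pow, conjBy_iterComm, map_one] at h₁
      rw [e1.mul_pow, e2.mul_pow] at h₁
      have h₂ : iterComm x y k ^ 3 * iterComm x y (k + 1) ^ 3 * iterComm x y (k + 2) *
        (iterComm x y (k + 1) ^ 3 * iterComm x y (k + 1 + 1) ^ 3 * iterComm x y (k + 1 + 2)) = 1 := by
        rw [← h₁]
        simp only [mul_assoc]
        congr 2
        rw [← mul_assoc, ← (d1.pow_left 3).eq, mul_assoc, ← mul_assoc (iterComm x y (k + 2)),
          ← (d2.pow_left 3).eq, mul_assoc]
      rwa [ih, one_mul] at h₂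

end IsCommPair

namespace IsStandardPair

variable {G : Type*} [Group G] {m : ℕ} {a z w : ℤ} {x y : G}

theorem last_zpow_eq (h : IsStandardPair m a z w x y) {i j : ℤ} (hij : i ≡ j [ZMOD 3]) :
    iterComm x y (m + 1) ^ i = iterComm x y (m + 1) ^ j := by
  obtain ⟨k, hk⟩ := hij.dvd
  rw [show j = 3 * k + i by omega, zpow_add, zpow_mul, zpow_ofNat, h.last_cube, one_zpow, one_mul]

/-- The parameters matter only modulo three. -/
theorem congr_params (h : IsStandardPair m a z w x y) {a' z' w' : ℤ} (ha : a ≡ a' [ZMOD 3])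
    (hz : z ≡ z' [ZMOD 3]) (hw : w ≡ w' [ZMOD 3]) (ha' : m < 2 → a' = 0) :
    IsStandardPair m a' z' w' x y where
  last := h.last
  y_one := by rw [h.y_one, h.last_zpow_eq ha]
  y_ge := h.y_ge
  a_eq := ha'
  x_cube := by rw [h.x_cube, h.last_zpow_eq hw]
  y_cube := by rw [h.y_cube, h.last_zpow_eq hz]
  t_cube := h.t_cube

theorem mul_cube_eq (h : IsStandardPair m a z w x y) :
    (x * y) ^ 3 = iterComm x y (m + 1) ^ (w + z - 5 * a) := by
  have := h.trace_y
  simp only [conjBy_apply] at this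
  rw [conj_cube, this, h.x_cube, h.y_cube, ← zpow_add, ← zpow_add]
  congr 1
  ring

theorem iterComm_mul_one (h : IsStandardPair m a z w x y) :
    iterComm (x * y) y 1 = iterComm x y 1 * iterComm x y (m + 1) ^ (-a) := by
  rw [← h.conjBy_y_one, conjBy_apply]
  simp [iterComm_succ, comm, mul_assoc]

/-- The factor ζ^i does not affect the commutator, and conjugation by xy is conjugation by x
followed by conjugation by y. -/
theorem iterComm_mul_succ (h : IsStandardPair m a z w x y) {k : ℕ} {i : ℤ}
    (hk : iterComm (x * y) y k = iterComm x y k * iterComm x y (m + 1) ^ i) :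
    iterComm (x * y) y (k + 1) = (iterComm x y k)⁻¹ * conjBy y (iterComm x y k) *
      conjBy y (iterComm x y (k + 1)) := by
  have e (g : G) : comm g (x * y) = g⁻¹ * conjBy y (conjBy x g) := by
    simp [comm, conjBy_apply, mul_assoc]
  have hx : Commute (iterComm x y (m + 1)) (x * y) :=
    h.commute_x_last.mul_right h.commute_y_last.symm
  rw [iterComm_succ, hk, comm_mul_of_commute (hx.zpow_left i)
    ((commute_comm (h.commute_iterComm_last k).symm hx).zpow_left i), e, conjBy_iterComm, map_mul,
    mul_assoc]

theorem iterComm_mul_two (h : IsStandardPair m a z w x y) :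
    iterComm (x * y) y 2 = iterComm x y 2 * iterComm x y (m + 1) ^ (-a) := by
  rw [h.iterComm_mul_succ h.iterComm_mul_one, h.conjBy_y_one, inv_mul_cancel_left,
    conjBy_eq_self.2 (h.y_ge 2 le_rfl), ((h.commute_iterComm_last 2).zpow_right _).eq]

theorem iterComm_mul_ge (h : IsStandardPair m a z w x y) {k : ℕ} (hk : 3 ≤ k) :
    iterComm (x * y) y k = iterComm x y k := by
  induction k, hk using Nat.le_induction with
  | base =>
    rw [h.iterComm_mul_succ h.iterComm_mul_two, conjBy_eq_self.2 (h.y_ge 2 le_rfl),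
      inv_mul_cancel, one_mul, conjBy_eq_self.2 (h.y_ge 3 (by norm_num))]
  | succ k hk ih =>
    rw [h.iterComm_mul_succ (i := 0) (by rw [ih, zpow_zero, mul_one]),
      conjBy_eq_self.2 (h.y_ge k (by omega)), inv_mul_cancel, one_mul,
      conjBy_eq_self.2 (h.y_ge (k + 1) (by omega))]

theorem iterComm_mul_last (h : IsStandardPair m a z w x y) :
    iterComm (x * y) y (m + 1) = iterComm x y (m + 1) := by
  rcases lt_or_ge m 2 with hm | hm
  · have ha := h.a_eq hm
    interval_cases m
    · rw [zero_add, h.iterComm_mul_one, ha, neg_zero, zpow_zero, mul_one]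
    · rw [h.iterComm_mul_two, ha, neg_zero, zpow_zero, mul_one]
  · exact h.iterComm_mul_ge (by omega)

/-- Replacing `x` by `xy`. -/
theorem mul_left (h : IsStandardPair m a z w x y) :
    IsStandardPair m a (z - a) (w + z - 5 * a) (x * y) y := by
  have hc : IsCommPair m a (x * y) y :=
    { last := by
        rcases Nat.eq_zero_or_pos m with rfl | hm
        · rw [zero_add, h.iterComm_mul_two, h.a_eq (by norm_num), neg_zero, zpow_zero, mul_one]
          exact h.last
        · rw [h.iterComm_mul_ge (by omega), h.last]
      y_one := by
        have hz : Commute (iterComm x y (m + 1) ^ (-a)) y := (h.commute_y_last.zpow_right _).symm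
        have e : conjBy y (iterComm x y 1 * iterComm x y (m + 1) ^ (-a)) =
            iterComm x y 1 * iterComm x y (m + 1) ^ (-a) * iterComm x y (m + 1) ^ (-a) := by
          rw [map_mul, conjBy_eq_self.2 hz.symm, h.conjBy_y_one]
        rw [conjBy_eq_mul_comm, mul_right_inj] at e
        rw [h.iterComm_mul_last, h.iterComm_mul_one, ← comm_inv, e, zpow_neg, inv_inv]
      y_ge := by
        intro k hk
        rcases hk.eq_or_lt with rfl | hk
        · rw [h.iterComm_mul_two]
          exact (h.y_ge 2 le_rfl).mul_right (h.commute_y_last.zpow_right _)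
        · rw [h.iterComm_mul_ge hk]
          exact h.y_ge k hk.le
      a_eq := h.a_eq }
  refine hc.isStandardPair ?_ ?_ ?_
  · rw [h.iterComm_mul_last, h.last_cube]
  · rw [h.iterComm_mul_last, h.mul_cube_eq]
  · have h3 : (iterComm x y (m + 1) ^ (-a)) ^ 3 = 1 := by
      rw [← zpow_natCast, zpow_comm, zpow_natCast, h.last_cube, one_zpow]
    rw [h.iterComm_mul_last, h.iterComm_mul_one, h.iterComm_mul_two,
      ((h.commute_iterComm_last 1).zpow_right (-a)).mul_pow, h3, mul_one, ← mul_assoc, h.y_cube,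
      ← zpow_add, sub_eq_add_neg]

theorem iterComm_inv_one (h : IsStandardPair m a z w x y) :
    iterComm x y⁻¹ 1 = (iterComm x y 1)⁻¹ * iterComm x y (m + 1) ^ (-a) := by
  have e : y * (iterComm x y 1)⁻¹ * y⁻¹ = (iterComm x y 1)⁻¹ * iterComm x y (m + 1) ^ (-a) := by
    rw [mul_inv_eq_iff_eq_mul, mul_assoc, ← (h.commute_y_last.zpow_right _).eq,
      eq_inv_mul_iff_mul_eq, ← mul_assoc, h.one_mul_y, mul_assoc, mul_assoc,
      ((h.commute_iterComm_last 1).inv_left.zpow_right (-a)).symm.eq, mul_inv_cancel_left]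
  rw [← e]
  simp [iterComm_succ, comm, mul_assoc]

theorem iterComm_inv_succ (h : IsStandardPair m a z w x y) {k : ℕ} {i : ℤ} (hk1 : 1 ≤ k)
    (hk : iterComm x y⁻¹ k = (iterComm x y k)⁻¹ * iterComm x y (m + 1) ^ i) :
    iterComm x y⁻¹ (k + 1) = (iterComm x y (k + 1))⁻¹ := by
  rw [iterComm_succ, hk, comm_mul_of_commute (h.commute_x_last.zpow_left i)
    ((commute_comm (h.commute_iterComm_last k).symm.inv_right h.commute_x_last).zpow_left i),
    comm_inv_left (h.commute_iterComm hk1 (k := k + 1) (by omega)), iterComm_succ]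

theorem iterComm_inv_ge (h : IsStandardPair m a z w x y) {k : ℕ} (hk : 2 ≤ k) :
    iterComm x y⁻¹ k = (iterComm x y k)⁻¹ := by
  induction k, hk using Nat.le_induction with
  | base => exact h.iterComm_inv_succ le_rfl h.iterComm_inv_one
  | succ k hk ih =>
    exact h.iterComm_inv_succ (i := 0) (by omega) (by rw [ih, zpow_zero, mul_one])

theorem iterComm_inv_last (h : IsStandardPair m a z w x y) :
    iterComm x y⁻¹ (m + 1) = (iterComm x y (m + 1))⁻¹ := by
  rcases Nat.eq_zero_or_pos m with rfl | hm
  · rw [zero_add, h.iterComm_inv_one, h.a_eq (by norm_num), neg_zero, zpow_zero, mul_one]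
  · exact h.iterComm_inv_ge (by omega)

/-- Replacing `y` by `y⁻¹`. -/
theorem inv_right (h : IsStandardPair m a z w x y) :
    IsStandardPair m (-a) z (-w) x y⁻¹ := by
  have hc : IsCommPair m (-a) x y⁻¹ :=
    { last := by rw [h.iterComm_inv_ge (by omega), h.last, inv_one]
      y_one := by
        have e : comm (iterComm x y 1)⁻¹ y = (comm (iterComm x y 1) y)⁻¹ := by
          refine comm_inv_left ?_
          rw [← comm_inv, h.y_one, ← zpow_neg]
          exact (h.commute_iterComm_last 1).zpow_right _
        have e' : comm y (iterComm x y 1)⁻¹ = iterComm x y (m + 1) ^ (-a) := by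
          rw [← comm_inv, e, inv_inv, ← comm_inv, h.y_one, zpow_neg]
        have hz : Commute y (iterComm x y (m + 1) ^ (-a)) := h.commute_y_last.zpow_right (-a)
        have e'' : comm (y⁻¹) ((iterComm x y 1)⁻¹ * iterComm x y (m + 1) ^ (-a)) =
            comm y⁻¹ (iterComm x y 1)⁻¹ := by
          have hz1 := (h.commute_iterComm_last 1).zpow_right (-a)
          rw [← comm_inv, comm_mul_of_commute hz.symm.inv_right
            (commute_comm hz1.symm.inv_right hz.symm.inv_right), comm_inv]
        rw [h.iterComm_inv_one, h.iterComm_inv_last, e'', comm_inv_left (by rw [e']; exact hz), e',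
          inv_zpow']
        simp
      y_ge := by
        intro k hk
        rw [h.iterComm_inv_ge hk]
        exact (h.y_ge k hk).inv_inv
      a_eq := fun hm => by rw [h.a_eq hm, neg_zero] }
  refine hc.isStandardPair ?_ ?_ ?_
  · rw [h.iterComm_inv_last, inv_pow, h.last_cube, inv_one]
  · rw [h.iterComm_inv_last, h.x_cube, inv_zpow', neg_neg]
  · have h3 : (iterComm x y (m + 1) ^ (-a)) ^ 3 = 1 := by
      rw [← zpow_natCast, zpow_comm, zpow_natCast, h.last_cube, one_zpow]
    -- Inverting the relation for y reverses the order of its factors, so they have to commute. For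
    -- y³ and t_1 this holds because [y, t_1] = ζ^a commutes with t_1 and has trivial cube.
    have c1 : Commute (y ^ 3) (iterComm x y 1 ^ 3) := by
      refine Commute.pow_left ?_ 3
      refine commute_cube (c := iterComm x y (m + 1) ^ a) ?_
        ((h.commute_iterComm_last 1).symm.zpow_left a) ?_
      · rw [mul_eq_mul_comm, h.y_one]
      · rw [← zpow_natCast, zpow_comm, zpow_natCast, h.last_cube, one_zpow]
    have c2 : Commute (iterComm x y 2) (y ^ 3 * iterComm x y 1 ^ 3) :=
      ((h.y_ge 2 le_rfl).symm.pow_right 3).mul_right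
        ((h.commute_iterComm (by norm_num) le_rfl).pow_right 3)
    rw [h.iterComm_inv_last, h.iterComm_inv_one, h.iterComm_inv_ge le_rfl,
      ((h.commute_iterComm_last 1).inv_left.zpow_right (-a)).mul_pow, h3, mul_one, inv_zpow,
      ← h.y_cube, ← c2.eq, c1.eq]
    simp [mul_assoc]

end IsStandardPair

end CoclassOne

/-! ### The substitution x ↦ x⁻¹ and normalization of the parameters. -/

namespace CoclassOne

open Subgroup

namespace IsCommPair

variable {G : Type*} [Group G] {m : ℕ} {a z w : ℤ} {x y : G}

theorem commute_iterComm_zero (h : IsCommPair m 0 x y) (j k : ℕ) :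
    Commute (iterComm x y j) (iterComm x y k) := by
  have hy : ∀ k, Commute y (iterComm x y k) := fun k => by
    rcases Nat.lt_or_ge k 2 with hk | hk
    · interval_cases k
      · exact Commute.refl _
      · exact h.commute_y_one rfl
    · exact h.y_ge k hk
  rcases Nat.eq_zero_or_pos j with rfl | hj
  · exact hy k
  rcases Nat.eq_zero_or_pos k with rfl | hk
  · exact (hy j).symm
  · exact h.commute_iterComm hj hk

theorem commute_of_mem_tail_zero (h : IsCommPair m 0 x y) {g g' : G}
    (hg : g ∈ tail x y 0) (hg' : g' ∈ tail x y 0) : Commute g g' := by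
  have h₁ : ∀ k, iterComm x y k ∈ centralizer (tail x y 0 : Set G) := fun k => by
    have : tail x y 0 ≤ centralizer {iterComm x y k} :=
      tail_le_iff.2 fun j _ => mem_centralizer_singleton_iff.2 (h.commute_iterComm_zero j k)
    rw [mem_centralizer_iff]
    exact fun g hg => mem_centralizer_singleton_iff.1 (this hg)
  have h₂ : tail x y 0 ≤ centralizer (tail x y 0 : Set G) := tail_le_iff.2 fun k _ => h₁ k
  exact (mem_centralizer_iff.1 (h₂ hg) g' hg').symm

theorem conjBy_inv_mem_tail (h : IsCommPair m a x y) {j : ℕ} {g : G} (hg : g ∈ tail x y j) :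
    conjBy x⁻¹ g ∈ tail x y j := by
  rw [← map_conjBy_tail h.last j] at hg
  obtain ⟨g', hg', rfl⟩ := hg
  simpa [conjBy_apply, mul_assoc] using hg'

theorem conjBy_mem_tail (h : IsCommPair m a x y) {j : ℕ} {g : G} (hg : g ∈ tail x y j) :
    conjBy x g ∈ tail x y j := by
  rw [← map_conjBy_tail h.last j]
  exact mem_map_of_mem _ hg

theorem iterComm_inv_left_mem (h : IsCommPair m a x y) (k : ℕ) :
    iterComm x⁻¹ y k ∈ tail x y 0 := by
  induction k with
  | zero => exact iterComm_mem_tail (k := 0) le_rfl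
  | succ k ih =>
    have e (g : G) : comm g x⁻¹ = g⁻¹ * conjBy x⁻¹ g := by
      simp [comm, conjBy_apply, mul_assoc]
    rw [iterComm_succ, e]
    exact mul_mem (inv_mem ih) (h.conjBy_inv_mem_tail ih)

/-- In any group [g, x⁻¹] = x [g, x]⁻¹ x⁻¹, so each commutation contributes an inversion and a
conjugation by x. The case a = 0 is needed for [t_k^i, x] = t_{k+1}^i down to k = 0. -/
theorem iterComm_inv_left (h : IsCommPair m 0 x y) (k : ℕ) :
    iterComm x⁻¹ y k = x ^ k * iterComm x y k ^ ((-1 : ℤ) ^ k) * (x ^ k)⁻¹ := by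
  induction k with
  | zero => simp
  | succ k ih =>
    have e₁ (i : ℤ) : comm (iterComm x y k ^ i) x = iterComm x y (k + 1) ^ i := by
      have e (g : G) : comm g x = g⁻¹ * conjBy x g := by
        simp [comm, conjBy_apply, mul_assoc]
      rw [e, map_zpow, conjBy_iterComm, (h.commute_iterComm_zero k (k + 1)).mul_zpow,
        inv_mul_cancel_left]
    have e₂ (g : G) : comm (x ^ k * g * (x ^ k)⁻¹) x⁻¹ =
        x ^ (k + 1) * (comm g x)⁻¹ * (x ^ (k + 1))⁻¹ := by
      have c : Commute (x ^ k) x := (Commute.refl x).pow_left k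
      have c' (r : G) : x⁻¹ * (x ^ k * r) = x ^ k * (x⁻¹ * r) := by
        rw [← mul_assoc, ← c.inv_right.eq, mul_assoc]
      have c'' (r : G) : (x ^ k)⁻¹ * (x * r) = x * ((x ^ k)⁻¹ * r) := by
        rw [← mul_assoc, c.inv_left.eq, mul_assoc]
      simp only [comm, pow_succ, mul_inv_rev, inv_inv, mul_assoc, c'', inv_mul_cancel_left,
        mul_inv_cancel_left]
      congr 2
      simp only [c.inv_inv.eq]
    rw [iterComm_succ, ih, e₂, e₁, pow_succ (-1 : ℤ), mul_neg_one, zpow_neg]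

end IsCommPair

namespace IsStandardPair

variable {G : Type*} [Group G] {m : ℕ} {a z w : ℤ} {x y : G}

/-- Replacing `x` by `x⁻¹`, if `y` commutes with its conjugates. -/
theorem inv_left (h : IsStandardPair m 0 z w x y) :
    IsStandardPair m 0 ((-1) ^ (m + 1) * z) (-((-1) ^ (m + 1) * w)) x⁻¹ y := by
  have hlast : iterComm x⁻¹ y (m + 1) = iterComm x y (m + 1) ^ ((-1 : ℤ) ^ (m + 1)) := by
    have c := (h.commute_x_last.zpow_left ((-1 : ℤ) ^ (m + 1))).pow_right (m + 1)
    rw [h.iterComm_inv_left, ← c.eq, mul_inv_cancel_right]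
  have hc : IsCommPair m 0 x⁻¹ y :=
    { last := by rw [h.iterComm_inv_left, h.last]; simp
      y_one := by
        rw [zpow_zero, comm_eq_one_iff]
        exact h.commute_of_mem_tail_zero (iterComm_mem_tail (k := 0) le_rfl)
          (h.iterComm_inv_left_mem 1)
      y_ge := fun k _ => h.commute_of_mem_tail_zero (iterComm_mem_tail (k := 0) le_rfl)
          (h.iterComm_inv_left_mem k)
      a_eq := fun _ => rfl }
  have hsq : (-1 : ℤ) ^ (m + 1) * (-1) ^ (m + 1) = 1 := by
    rw [← mul_pow]; norm_num
  refine hc.isStandardPair ?_ ?_ ?_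
  · rw [hlast, ← zpow_natCast, zpow_comm, zpow_natCast, h.last_cube, one_zpow]
  · rw [hlast, inv_pow, h.x_cube, ← zpow_mul, ← zpow_neg]
    congr 1
    linear_combination w * hsq
  · have hy : y ∈ tail x y 0 := iterComm_mem_tail (k := 0) le_rfl
    have h₁ := hc.trace_y
    have h₂ := h.trace_y
    rw [mul_zero, zpow_zero, mul_one] at h₁ h₂
    have hx : Commute (x ^ 3) y := by
      rw [h.x_cube]
      exact h.commute_y_last.symm.zpow_left w
    -- Since x³ commutes with y, the conjugates of y under powers of x⁻¹ are those under powers of x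
    -- in another order; H₁ is abelian, so the two traces agree.
    have e₁ : conjBy x y = conjBy x⁻¹ (conjBy x⁻¹ y) := by
      conv_rhs => rw [← conj_of_commute hx]
      simp [conjBy_apply, pow_succ, mul_assoc]
    have e₂ : conjBy x (conjBy x y) = conjBy x⁻¹ y := by
      rw [e₁]; simp [conjBy_apply, mul_assoc]
    have c : Commute (conjBy x (conjBy x y)) (conjBy x y) :=
      h.commute_of_mem_tail_zero (h.conjBy_mem_tail (h.conjBy_mem_tail hy)) (h.conjBy_mem_tail hy)
    rw [← h₁, ← e₁, ← e₂, ← c.eq, h₂, h.y_cube, hlast, ← zpow_mul]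
    congr 1
    linear_combination (-z) * hsq

/-- The new w is recorded only for a = 0. For a = 1 the iteration serves to clear z, and any
resulting w is reduced modulo 3. -/
theorem mul_left_iterate (h : IsStandardPair m a z w x y) (hG : closure {x, y} = ⊤) (b : ℕ) :
    ∃ x' w', closure {x', y} = ⊤ ∧ IsStandardPair m a (z - b * a) w' x' y ∧
      (a = 0 → w' = w + b * z) := by
  induction b with
  | zero => exact ⟨x, w, hG, by simpa using h, by simp⟩
  | succ b ih =>
    obtain ⟨x', w', hG', h', hw⟩ := ih
    refine ⟨x' * y, _, ?_, h'.mul_left.congr_params rfl (z' := z - (b + 1 : ℕ) * a) ?_ rfl h.a_eq, ?_⟩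
    · rw [eq_top_iff, ← hG', closure_le]
      have hy : y ∈ closure {x' * y, y} := subset_closure (by simp)
      rintro g (rfl | rfl)
      · exact (Subgroup.mul_mem_cancel_right _ hy).1 (subset_closure (by simp))
      · exact hy
    · push_cast
      rw [show z - (b + 1 : ℤ) * a = z - b * a - a by ring]
    · rintro rfl
      rw [hw rfl]
      push_cast
      ring

theorem closure_inv_right (hG : closure {x, y} = ⊤) : closure {x, y⁻¹} = ⊤ := by
  rw [eq_top_iff, ← hG, closure_le]
  rintro g (rfl | rfl)
  · exact subset_closure (by simp)
  · exact inv_mem_iff.1 (subset_closure (by simp))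

theorem closure_inv_left (hG : closure {x, y} = ⊤) : closure {x⁻¹, y} = ⊤ := by
  rw [eq_top_iff, ← hG, closure_le]
  rintro g (rfl | rfl)
  · exact inv_mem_iff.1 (subset_closure (by simp))
  · exact subset_closure (by simp)

theorem exists_mod_three (i : ℤ) : ∃ j : ℤ, (j = 0 ∨ j = 1 ∨ j = -1) ∧ i ≡ j [ZMOD 3] := by
  have : i % 3 = 0 ∨ i % 3 = 1 ∨ i % 3 = 2 := by omega
  rcases this with h | h | h
  · exact ⟨0, by simp, by simp [Int.ModEq, h]⟩
  · exact ⟨1, by simp, by simp [Int.ModEq, h]⟩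
  · exact ⟨-1, by simp, by simp [Int.ModEq, h]⟩

/-- Parameters of a group of order at least `3^4` can be normalized to those of the table. -/
theorem exists_tableRow (hm : 1 ≤ m) (h : IsStandardPair m a z w x y)
    (hG : closure {x, y} = ⊤) :
    ∃ a' z' w' x' y', Subgroup.closure {x', y'} = (⊤ : Subgroup G) ∧
      IsStandardPair m a' z' w' x' y' ∧ ∃ κs κd, TableRow (m + 3) a' z' w' κs κd := by
  obtain ⟨a₁, ha₁, hmod⟩ := exists_mod_three a
  have ha₀ : m < 2 → a₁ = 0 := fun hm2 => by
    rw [h.a_eq hm2] at hmod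
    rcases ha₁ with h | h | h
    · exact h
    · subst h; exact absurd hmod (by decide)
    · subst h; exact absurd hmod (by decide)
  replace h := h.congr_params hmod rfl rfl ha₀
  -- For a = 1 each substitution x ↦ xy lowers z by one, so z can be made 0; the three residues of w
  -- are three rows of the table.
  have main_one : ∀ {z w : ℤ} {x y : G}, IsStandardPair m 1 z w x y → closure {x, y} = ⊤ →
      ∃ a' z' w' x' y', Subgroup.closure {x', y'} = (⊤ : Subgroup G) ∧
        IsStandardPair m a' z' w' x' y' ∧ ∃ κs κd, TableRow (m + 3) a' z' w' κs κd := by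
    intro z w x y h hG
    have hm2 : 2 ≤ m := by
      by_contra hlt
      exact one_ne_zero (h.a_eq (by omega))
    obtain ⟨x', w', hG', h', -⟩ := h.mul_left_iterate hG (z % 3).toNat
    obtain ⟨w₁, hw₁, hwmod⟩ := exists_mod_three w'
    refine ⟨1, 0, w₁, x', y, hG', h'.congr_params rfl ?_ hwmod h.a_eq, ?_⟩
    · rw [Int.toNat_of_nonneg (Int.emod_nonneg _ (by norm_num)), mul_one]
      exact (Int.modEq_iff_dvd.2 (by omega))
    · rcases hw₁ with rfl | rfl | rfl
      · exact ⟨_, _, .a1_zero _ (by omega)⟩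
      · exact ⟨_, _, .a1_pos _ (by omega)⟩
      · exact ⟨_, _, .a1_neg _ (by omega)⟩
  rcases ha₁ with rfl | rfl | rfl
  · obtain ⟨z₁, hz₁, hzmod⟩ := exists_mod_three z
    obtain ⟨w₁, hw₁, hwmod⟩ := exists_mod_three w
    replace h := h.congr_params rfl hzmod hwmod h.a_eq
    have hone : ∀ {x y : G}, IsStandardPair m 0 1 0 x y → closure {x, y} = ⊤ →
        ∃ a' z' w' x' y', Subgroup.closure {x', y'} = (⊤ : Subgroup G) ∧
          IsStandardPair m a' z' w' x' y' ∧ ∃ κs κd, TableRow (m + 3) a' z' w' κs κd := by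
      intro x y h hG
      refine ⟨0, 1, 0, x, y, hG, h, ?_⟩
      rcases hm.eq_or_lt with rfl | hm2
      · exact ⟨_, _, .a3_star⟩
      · exact ⟨_, _, .a3_pos _ (by omega)⟩
    rcases hz₁ with rfl | rfl | rfl
    · rcases hw₁ with rfl | rfl | rfl
      · exact ⟨0, 0, 0, x, y, hG, h, _, _, .a1_mainline _ (by omega)⟩
      · exact ⟨0, 0, 1, x, y, hG, h, _, _, .a2 _ (by omega)⟩
      · refine ⟨0, 0, 1, x, y⁻¹, closure_inv_right hG, ?_, _, _, .a2 _ (by omega)⟩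
        simpa using h.inv_right
    -- For a = 0 and z = ±1 each substitution adds z to w, which decides how often it is applied to
    -- make w vanish modulo 3.
    · obtain ⟨x', w', hG', h', hw'⟩ := h.mul_left_iterate hG (-w₁ % 3).toNat
      rw [Int.toNat_of_nonneg (Int.emod_nonneg _ (by norm_num))] at hw' h'
      refine hone (h'.congr_params rfl (by simp) ?_ h.a_eq) hG'
      rw [hw' rfl]
      exact Int.modEq_iff_dvd.2 (by omega)
    · obtain ⟨x', w', hG', h', hw'⟩ := h.mul_left_iterate hG (w₁ % 3).toNat
      rw [Int.toNat_of_nonneg (Int.emod_nonneg _ (by norm_num))] at hw' h'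
      have h'' : IsStandardPair m 0 (-1) 0 x' y := by
        refine h'.congr_params rfl (by simp) ?_ h.a_eq
        rw [hw' rfl]
        exact Int.modEq_iff_dvd.2 (by omega)
      -- The substitution x ↦ x⁻¹ multiplies z by (-1)^{m+1}. Hence z = -1 can be turned into z = 1
      -- here when n is odd, and is kept as a row of its own when n is even.
      rcases Nat.even_or_odd (m + 1) with he | ho
      · exact ⟨0, -1, 0, x', y, hG', h'', _, _, .a3_neg _ (by omega)
          (by rw [show m + 3 = m + 1 + 2 by omega]; exact he.add (by decide))⟩
      · have := h''.inv_left
        rw [ho.neg_one_pow] at this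
        exact hone (by simpa using this) (closure_inv_left hG')
  · exact main_one h hG
  · exact main_one h.inv_right (closure_inv_right hG)

end IsStandardPair

/-! ### The presented group. -/

section ParamGroup

variable {m : ℕ} {a z w : ℤ}

/-- The image of the word `s_i` in `G_a^n(z,w)`. -/
def ParamGroup.s (n : ℕ) (a z w : ℤ) (i : ℕ) : ParamGroup n a z w :=
  PresentedGroup.mk _ (S n i)

theorem ParamGroup.mk_X (n : ℕ) (a z w : ℤ) :
    PresentedGroup.mk (relators n a z w) (X n) = ParamGroup.x n a z w := rfl

theorem ParamGroup.mk_Y (n : ℕ) (a z w : ℤ) :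
    PresentedGroup.mk (relators n a z w) (Y n) = ParamGroup.y n a z w := rfl

theorem ParamGroup.mk_eq {n : ℕ} {u v : FreeGroup (Gen n)} (h : Relation n a z w u v) :
    PresentedGroup.mk (relators n a z w) u = PresentedGroup.mk (relators n a z w) v := by
  have := PresentedGroup.one_of_mem (rels := relators n a z w) (x := u * v⁻¹) ⟨u, v, h, rfl⟩
  rwa [map_mul, map_inv, mul_inv_eq_one] at this

theorem ParamGroup.s_eq_one {n i : ℕ} (h : ¬ (2 ≤ i ∧ i < n)) :
    ParamGroup.s n a z w i = 1 := by
  rw [ParamGroup.s, S, dif_neg h, map_one]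

/-- The index shifts by one because t_0 = y while s_2 = [y, x]. Beyond the range of the generators
both sides are trivial, thanks to s_n = 1 and the default value of s_i. -/
theorem ParamGroup.s_eq_iterComm {n i : ℕ} (hi : 1 ≤ i) :
    ParamGroup.s n a z w (i + 1) =
      iterComm (ParamGroup.x n a z w) (ParamGroup.y n a z w) i := by
  induction i, hi using Nat.le_induction with
  | base =>
    rw [ParamGroup.s, mk_eq Relation.s_two, map_comm, mk_Y, mk_X]
    rfl
  | succ i hi ih =>
    rw [iterComm_succ, ← ih]
    rcases Nat.lt_or_ge n (i + 1 + 1) with h | h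
    · rw [s_eq_one (by omega), s_eq_one (by omega)]
      simp [comm]
    · rw [ParamGroup.s, mk_eq (Relation.s_step (i + 1 + 1) (by omega) h), map_comm, mk_X]
      rfl

theorem ParamGroup.closure_eq_top (n : ℕ) :
    closure {ParamGroup.x n a z w, ParamGroup.y n a z w} = ⊤ := by
  rw [eq_top_iff, ← PresentedGroup.closure_range_of, closure_le]
  rintro _ ⟨g, rfl⟩
  have hx : ParamGroup.x n a z w ∈ closure {ParamGroup.x n a z w, ParamGroup.y n a z w} :=
    subset_closure (by simp)
  have hy : ParamGroup.y n a z w ∈ closure {ParamGroup.x n a z w, ParamGroup.y n a z w} :=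
    subset_closure (by simp)
  rcases g with _ | _ | ⟨i, h₁, h₂⟩
  · exact hx
  · exact hy
  · have e : PresentedGroup.of (rels := relators n a z w) (Gen.s i h₁ h₂) =
        ParamGroup.s n a z w (i - 1 + 1) := by
      rw [ParamGroup.s, Nat.sub_add_cancel (by omega), S, dif_pos ⟨h₁, h₂⟩]
      rfl
    rw [e, s_eq_iterComm (by omega)]
    generalize i - 1 = k
    induction k with
    | zero => exact hy
    | succ k ih =>
      exact mul_mem (mul_mem (mul_mem (inv_mem ih) (inv_mem hx)) ih) hx

/-- The defining generators of `G_a^{m+3}(z,w)` satisfy the relations in terms of iterated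
commutators. -/
theorem ParamGroup.isStandardPair (ha : m < 2 → a = 0) :
    IsStandardPair m a z w (ParamGroup.x (m + 3) a z w) (ParamGroup.y (m + 3) a z w) := by
  have ht (k : ℕ) (hk : 1 ≤ k) : iterComm (ParamGroup.x (m + 3) a z w)
      (ParamGroup.y (m + 3) a z w) k = PresentedGroup.mk _ (S (m + 3) (k + 1)) :=
    (s_eq_iterComm hk).symm
  have hS (i : ℕ) (hi : ¬ (2 ≤ i ∧ i < m + 3)) :
      PresentedGroup.mk (relators (m + 3) a z w) (S (m + 3) i) = 1 := s_eq_one hi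
  refine ⟨⟨?_, ?_, ?_, ha⟩, ?_, ?_, ?_⟩
  · rw [ht _ (by omega), hS _ (by omega)]
  · rw [ht _ le_rfl, ht _ (by omega), ← mk_Y, ← map_comm, ← map_zpow]
    exact mk_eq Relation.y_s_two
  · intro k hk
    rw [ht _ (by omega), ← comm_eq_one_iff]
    rcases Nat.lt_or_ge (k + 1) (m + 3) with h | h
    · rw [← mk_Y, ← map_comm, mk_eq (Relation.y_s (k + 1) (by omega) h), map_one]
    · rw [hS _ (by omega)]
      simp [comm]
  · rw [ht _ (by omega), ← mk_X, ← map_pow, ← map_zpow]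
    exact mk_eq Relation.x_cube
  · rw [ht _ (by omega), ht _ (by omega), ht _ (by omega), ← mk_Y, ← map_pow, ← map_pow,
      ← map_zpow, ← map_mul, ← map_mul]
    exact mk_eq Relation.y_cube
  · intro k hk
    rw [ht _ hk, ht _ (by omega), ht _ (by omega)]
    -- The general cubing relation of the presentation covers k < m; the cases k = m and k = m + 1
    -- come from s_{n-2}³ = s_{n-1}³ = 1.
    rcases lt_trichotomy k m with h | h | h
    · simp only [← map_pow, ← map_mul]
      rw [mk_eq (Relation.s_cube (k + 1) (by omega) (by omega)), map_one]
    · subst h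
      have e₁ := mk_eq (Relation.s_cube_penultimate (n := k + 3) (a := a) (z := z) (w := w))
      have e₂ := mk_eq (Relation.s_cube_last (n := k + 3) (a := a) (z := z) (w := w))
      simp only [show k + 3 - 2 = k + 1 by omega,
        show k + 3 - 1 = k + 2 by omega, map_pow, map_one] at e₁ e₂
      rw [e₁, e₂, hS _ (by omega), one_mul, one_mul]
    · rw [hS (k + 1 + 1) (by omega), hS (k + 2 + 1) (by omega), one_pow, mul_one, mul_one]
      rcases (Nat.succ_le_of_lt h).eq_or_lt with rfl | h
      · have e₂ := mk_eq (Relation.s_cube_last (n := m + 3) (a := a) (z := z) (w := w))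
        simpa using e₂
      · rw [hS _ (by omega), one_pow]

/-- A standard pair of generators in a group of the right order defines an isomorphism. -/
theorem IsStandardPair.nonempty_mulEquiv {G : Type*} [Group G] {x y : G}
    (h : IsStandardPair m a z w x y) (hG : closure {x, y} = ⊤)
    (hcard : Nat.card G = 3 ^ (m + 3)) :
    Nonempty (ParamGroup (m + 3) a z w ≃* G) := by
  let f : Gen (m + 3) → G := fun g => match g with
    | .x => x
    | .y => y
    | .s i _ _ => iterComm x y (i - 1)
  have fX : FreeGroup.lift f (X (m + 3)) = x := by simp [X, f]
  have fY : FreeGroup.lift f (Y (m + 3)) = y := by simp [Y, f]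
  have fS (i : ℕ) (hi : 2 ≤ i) : FreeGroup.lift f (S (m + 3) i) = iterComm x y (i - 1) := by
    by_cases hlt : i < m + 3
    · rw [S, dif_pos ⟨hi, hlt⟩]; simp [f]
    · rw [S, dif_neg (by omega), map_one, h.eq_one (by omega)]
  have hrel : ∀ r ∈ relators (m + 3) a z w, FreeGroup.lift f r = 1 := by
    rintro _ ⟨u, v, huv, rfl⟩
    rw [map_mul, map_inv, mul_inv_eq_one]
    cases huv with
    | s_two => rw [map_comm, fX, fY, fS _ le_rfl]; rfl
    | s_step i h₁ h₂ =>
      rw [map_comm, fX, fS _ (by omega), fS _ (by omega), ← iterComm_succ]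
      congr 1
      omega
    | s_last => rw [fS _ (by omega), map_one]; exact h.last
    | y_s_two =>
      rw [map_comm, fY, fS _ le_rfl, map_zpow, fS _ (by omega)]
      exact h.y_one
    | y_s i h₁ h₂ =>
      rw [map_comm, fY, fS _ (by omega), map_one, comm_eq_one_iff]
      exact h.y_ge _ (by omega)
    | x_cube =>
      rw [map_pow, fX, map_zpow, fS _ (by omega)]
      exact h.x_cube
    | y_cube =>
      rw [map_mul, map_mul, map_pow, map_pow, fY, map_zpow, fS _ (by omega), fS _ (by omega),
        fS _ (by omega)]
      exact h.y_cube
    | s_cube i h₁ h₂ =>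
      rw [map_mul, map_mul, map_pow, map_pow, map_one, fS _ (by omega), fS _ (by omega),
        fS _ (by omega)]
      have := h.t_cube (i - 1) (by omega)
      rwa [show i - 1 + 1 = i + 1 - 1 by omega, show i - 1 + 2 = i + 2 - 1 by omega] at this
    | s_cube_penultimate =>
      rw [map_pow, map_one]
      -- For m = 0 the index n - 2 is 1, outside the range of generators, so the word is empty.
      rcases Nat.eq_zero_or_pos m with rfl | hm
      · rw [S, dif_neg (by omega), map_one, one_pow]
      · rw [fS _ (by omega)]
        have := h.t_cube m hm
        rw [h.last_cube, h.last, mul_one, mul_one] at this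
        exact this
    | s_cube_last =>
      rw [map_pow, map_one, fS _ (by omega)]
      exact h.last_cube
  let F : ParamGroup (m + 3) a z w →* G := PresentedGroup.toGroup hrel
  have hsurj : Function.Surjective F := by
    rw [← MonoidHom.range_eq_top, eq_top_iff, ← hG, closure_le]
    rintro g (rfl | rfl)
    · exact ⟨ParamGroup.x _ _ _ _, PresentedGroup.toGroup.of hrel⟩
    · exact ⟨ParamGroup.y _ _ _ _, PresentedGroup.toGroup.of hrel⟩
  obtain ⟨hfin, hle⟩ := (ParamGroup.isStandardPair (z := z) (w := w) h.a_eq).finite_card_le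
    (ParamGroup.closure_eq_top _)
  -- A surjection from a group of order at most 3^{m+3} onto one of exactly that order is bijective.
  have hbij : Function.Bijective F := by
    have hfinG : Finite G := Finite.of_surjective F hsurj
    refine (Nat.bijective_iff_surjective_and_card F).2 ⟨hsurj, le_antisymm (hle.trans hcard.ge) ?_⟩
    exact Nat.card_le_card_of_surjective F hsurj
  exact ⟨MulEquiv.ofBijective F hbij⟩

end ParamGroup

end CoclassOne

namespace CoclassOne

open Subgroup

/-! ### The centre of a group of maximal class. -/

section NilpotencyClass

theorem isMulCommutative_of_isCyclic_quotient_center {G : Type*} [Group G]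
    [IsCyclic (G ⧸ center G)] (a b : G) : a * b = b * a :=
  (MonoidHom.isMulCommutative_of_isCyclic_of_ker_le_center (QuotientGroup.mk' (center G))
    (by rw [QuotientGroup.ker_mk'])).is_comm.comm a b

/-- Strong induction through G/Z(G). If the quotient has order at most p it is cyclic, so G is
abelian; otherwise passing to the quotient lowers the class by one and the exponent of the order by
at least one. -/
theorem nilpotencyClass_lt_of_card {p : ℕ} [Fact p.Prime] (k : ℕ) :
    ∀ {G : Type*} [Group G], Nat.card G = p ^ (k + 2) → Group.nilpotencyClass G < k + 2 := by
  induction k using Nat.strong_induction_on with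
  | _ k ih =>
    intro G _ hG
    have hp : p.Prime := Fact.out
    have hfin : Finite G := Nat.finite_of_card_ne_zero (by rw [hG]; exact pow_ne_zero _ hp.ne_zero)
    have hpG : IsPGroup p G := IsPGroup.of_card hG
    have hnil := hpG.isNilpotent
    have hnt : Nontrivial G := Finite.one_lt_card_iff_nontrivial.1 (by
      rw [hG]; exact Nat.one_lt_pow (by omega) hp.one_lt)
    obtain ⟨j, hj⟩ := IsPGroup.iff_card.1 (hpG.to_quotient (center G))
    obtain ⟨i, hi, hi'⟩ := (IsPGroup.nontrivial_iff_card (hpG.to_subgroup (center G))).1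
      hpG.center_nontrivial
    have hmul := card_eq_card_quotient_mul_card_subgroup (center G)
    rw [hG, hj, hi', ← pow_add] at hmul
    have hsum : k + 2 = j + i := Nat.pow_right_injective hp.two_le hmul
    rw [Group.nilpotencyClass_eq_quotient_center_plus_one]
    rcases Nat.lt_or_ge j 2 with hj2 | hj2
    · have hcyc : IsCyclic (G ⧸ center G) := by
        interval_cases j
        · have := (Nat.card_eq_one_iff_unique.1 (by simpa using hj)).1
          infer_instance
        · exact isCyclic_of_prime_card (p := p) (by simpa using hj)
      have hZ : center G = ⊤ := eq_top_iff.2 fun g _ =>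
        mem_center_iff.2 fun h => isMulCommutative_of_isCyclic_quotient_center h g
      have : Subsingleton (G ⧸ center G) := by
        rw [hZ]; exact QuotientGroup.subsingleton_quotient_top
      rw [Group.nilpotencyClass_zero_iff_subsingleton.2 this]
      omega
    · obtain ⟨l, rfl⟩ : ∃ l, j = l + 2 := ⟨j - 2, by omega⟩
      have := ih l (by omega) hj
      omega

variable {G : Type*} [Group G] {m : ℕ}

/-- The quotient by the centre has class m + 1, which by `nilpotencyClass_lt_of_card` needs order at
least 3^{m+2}; only a factor three is left for the centre. -/
theorem card_center_of_maximal_class (hG : Nat.card G = 3 ^ (m + 3))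
    (hc : Group.nilpotencyClass G = m + 2) :
    Nat.card (center G) = 3 ∧ Nat.card (G ⧸ center G) = 3 ^ (m + 2) ∧
      Group.nilpotencyClass (G ⧸ center G) = m + 1 := by
  have : Fact (Nat.Prime 3) := ⟨Nat.prime_three⟩
  have hfin : Finite G := Nat.finite_of_card_ne_zero (by rw [hG]; positivity)
  have hpG : IsPGroup 3 G := IsPGroup.of_card hG
  have hnil := hpG.isNilpotent
  have hnt : Nontrivial G := Finite.one_lt_card_iff_nontrivial.1 (by
    rw [hG]; exact Nat.one_lt_pow (by omega) (by norm_num))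
  obtain ⟨j, hj⟩ := IsPGroup.iff_card.1 (hpG.to_quotient (center G))
  obtain ⟨i, hi, hi'⟩ := (IsPGroup.nontrivial_iff_card (hpG.to_subgroup (center G))).1
    hpG.center_nontrivial
  have hmul := card_eq_card_quotient_mul_card_subgroup (center G)
  rw [hG, hj, hi', ← pow_add] at hmul
  have hsum : m + 3 = j + i := Nat.pow_right_injective (a := 3) (by norm_num) hmul
  have hq : Group.nilpotencyClass (G ⧸ center G) = m + 1 := by
    rw [Group.nilpotencyClass_eq_quotient_center_plus_one] at hc
    omega
  have hj2 : m + 2 ≤ j := by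
    rcases Nat.lt_or_ge j 2 with hj2 | hj2
    · have hcyc : IsCyclic (G ⧸ center G) := by
        interval_cases j
        · have := (Nat.card_eq_one_iff_unique.1 (by simpa using hj)).1
          infer_instance
        · exact isCyclic_of_prime_card (p := 3) (by simpa using hj)
      have hZ : center G = ⊤ := eq_top_iff.2 fun g _ =>
        mem_center_iff.2 fun h => isMulCommutative_of_isCyclic_quotient_center h g
      have : Subsingleton (G ⧸ center G) := by
        rw [hZ]; exact QuotientGroup.subsingleton_quotient_top
      rw [Group.nilpotencyClass_zero_iff_subsingleton.2 this] at hq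
      omega
    · obtain ⟨l, rfl⟩ : ∃ l, j = l + 2 := ⟨j - 2, by omega⟩
      have := nilpotencyClass_lt_of_card (p := 3) l hj
      omega
  obtain ⟨rfl, rfl⟩ : j = m + 2 ∧ i = 1 := by omega
  exact ⟨by simpa using hi', hj, hq⟩

end NilpotencyClass

/-! ### Extensions by a centre of order three, and groups of order 27. -/

section CentralExtension

variable {G : Type*} [Group G]

theorem mem_center_of_closure {x y c : G} (hG : closure {x, y} = ⊤) (hx : Commute x c)
    (hy : Commute y c) : c ∈ center G := by
  have : closure {x, y} ≤ centralizer {c} := by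
    rw [closure_le]
    rintro g (rfl | rfl)
    · exact mem_centralizer_singleton_iff.2 hx
    · exact mem_centralizer_singleton_iff.2 hy
  rw [hG] at this
  exact mem_center_iff.2 fun g => mem_centralizer_singleton_iff.1 (this (mem_top g))

theorem commute_of_mem_center {c : G} (hc : c ∈ center G) (g : G) : Commute c g :=
  (mem_center_iff.1 hc g).symm

theorem cube_eq_one_of_mem_center (hZ : Nat.card (center G) = 3) {c : G} (hc : c ∈ center G) :
    c ^ 3 = 1 := by
  have := pow_card_eq_one' (x := (⟨c, hc⟩ : center G))
  rw [hZ] at this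
  exact congrArg Subtype.val this

theorem exists_zpow_of_mem_center (hZ : Nat.card (center G) = 3) {c e : G} (hc : c ∈ center G)
    (hc1 : c ≠ 1) (he : e ∈ center G) : ∃ i : ℤ, e = c ^ i := by
  have : Fact (Nat.Prime 3) := ⟨Nat.prime_three⟩
  have := mem_zpowers_of_prime_card (p := 3) hZ (g := (⟨c, hc⟩ : center G)) (g' := ⟨e, he⟩)
    (fun h => hc1 (congrArg Subtype.val h))
  obtain ⟨i, hi⟩ := mem_zpowers_iff.1 this
  exact ⟨i, (congrArg Subtype.val hi).symm⟩

theorem exists_eq_mul_of_mk_eq {u v : G}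
    (h : QuotientGroup.mk' (center G) u = QuotientGroup.mk' (center G) v) :
    ∃ e ∈ center G, u = v * e := by
  refine ⟨v⁻¹ * u, QuotientGroup.eq.1 h.symm, by simp⟩

theorem comm_mem_center {g h : G}
    (hc : Commute (QuotientGroup.mk' (center G) g) (QuotientGroup.mk' (center G) h)) :
    comm g h ∈ center G := by
  rw [← QuotientGroup.eq_one_iff]
  change QuotientGroup.mk' (center G) (comm g h) = 1
  rw [map_comm, comm_eq_one_iff.2 hc]

theorem mem_center_of_mk_eq_one {g : G} (h : QuotientGroup.mk' (center G) g = 1) :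
    g ∈ center G := (QuotientGroup.eq_one_iff g).1 h

/-- The commutator is central with trivial cube, so cubing one of the elements kills it. This is the
mechanism by which commutation relations lift. -/
theorem commute_cube_of_mk (hZ : Nat.card (center G) = 3) {g h : G}
    (hc : Commute (QuotientGroup.mk' (center G) g) (QuotientGroup.mk' (center G) h)) :
    Commute g (h ^ 3) :=
  commute_cube (mul_eq_mul_comm g h) (commute_of_mem_center (comm_mem_center hc) h)
    (cube_eq_one_of_mem_center hZ (comm_mem_center hc))

theorem commute_of_mul_mem_center {g p q : G} (hpq : p * q ∈ center G) (hp : Commute g p) :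
    Commute g q := by
  have := hp.inv_right.mul_right (commute_of_mem_center hpq g).symm
  rwa [inv_mul_cancel_left] at this

/-- Lifts of generators of `G/Z(G)` generate `G`, if `Z(G)` has order three. -/
theorem closure_eq_top_of_mk (hfin : Finite G) (hp : IsPGroup 3 G) (hZ : Nat.card (center G) = 3)
    (hQ : Nontrivial (G ⧸ center G)) {x y : G}
    (h : closure {QuotientGroup.mk' (center G) x, QuotientGroup.mk' (center G) y} = ⊤) :
    closure {x, y} = ⊤ := by
  have : Fact (Nat.Prime 3) := ⟨Nat.prime_three⟩
  have hmap : (closure {x, y}).map (QuotientGroup.mk' (center G)) = ⊤ := by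
    rw [MonoidHom.map_closure, Set.image_pair, h]
  have hsup : closure {x, y} ⊔ center G = ⊤ := by
    have := congrArg (comap (QuotientGroup.mk' (center G))) hmap
    rwa [comap_map_eq, QuotientGroup.ker_mk', comap_top] at this
  generalize closure {x, y} = K at *
  have hnt : Nontrivial K := by
    by_contra hK
    rw [not_nontrivial_iff_subsingleton] at hK
    have : K = ⊥ := (eq_bot_iff_forall K).2 fun k hk =>
      congrArg Subtype.val (Subsingleton.elim (⟨k, hk⟩ : K) 1)
    rw [this, Subgroup.map_bot] at hmap
    exact bot_ne_top hmap
  -- As K Z(G) is everything, a central element of K is central in G; a nontrivial one generates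
  -- Z(G), so Z(G) ≤ K.
  obtain ⟨⟨⟨k, hk⟩, hkc⟩, hk1⟩ :=
    @exists_ne _ (hp.to_subgroup K).center_nontrivial 1
  have hkG : k ∈ center G := by
    have : K ⊔ center G ≤ centralizer {k} := sup_le
      (fun g hg => mem_centralizer_singleton_iff.2
        (congrArg Subtype.val (mem_center_iff.1 hkc ⟨g, hg⟩)))
      (center_le_centralizer _)
    rw [hsup] at this
    exact mem_center_iff.2 fun g => mem_centralizer_singleton_iff.1 (this (mem_top g))
  have hk1' : k ≠ 1 := fun h => hk1 (Subtype.ext (Subtype.ext h))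
  have hle : center G ≤ K := fun e he => by
    obtain ⟨i, rfl⟩ := exists_zpow_of_mem_center hZ hkG hk1' he
    exact zpow_mem hk i
  rwa [sup_eq_left.2 hle] at hsup

/-- The quotient by the centre is not cyclic, which leaves only order nine, and then it is
elementary abelian. -/
theorem cube_mem_center_of_card (hcard : Nat.card G = 27) (hnc : ∃ g h : G, ¬ Commute g h) :
    Nat.card (center G) = 3 ∧ (∀ g : G, g ^ 3 ∈ center G) ∧ ∀ g h : G, comm g h ∈ center G := by
  have : Fact (Nat.Prime 3) := ⟨Nat.prime_three⟩
  have hfin : Finite G := Nat.finite_of_card_ne_zero (by omega)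
  have hpG : IsPGroup 3 G := IsPGroup.of_card (n := 3) hcard
  have hnt : Nontrivial G := Finite.one_lt_card_iff_nontrivial.1 (by omega)
  obtain ⟨g₀, h₀, hgh⟩ := hnc
  obtain ⟨j, hj⟩ := IsPGroup.iff_card.1 (hpG.to_quotient (center G))
  obtain ⟨i, hi, hi'⟩ := (IsPGroup.nontrivial_iff_card (hpG.to_subgroup (center G))).1
    hpG.center_nontrivial
  have hmul := card_eq_card_quotient_mul_card_subgroup (center G)
  rw [hcard, hj, hi', ← pow_add] at hmul
  have hsum : 3 = j + i :=
    Nat.pow_right_injective (a := 3) (by norm_num) ((by norm_num : 3 ^ 3 = 27).trans hmul)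
  have hncyc : ¬ IsCyclic (G ⧸ center G) := fun _ =>
    hgh (isMulCommutative_of_isCyclic_quotient_center g₀ h₀)
  have hj2 : j = 2 := by
    by_contra hj2
    refine hncyc ?_
    have : j < 2 := by omega
    interval_cases j
    · have := (Nat.card_eq_one_iff_unique.1 (by simpa using hj)).1
      infer_instance
    · exact isCyclic_of_prime_card (p := 3) (by simpa using hj)
  subst hj2
  obtain rfl : i = 1 := by omega
  refine ⟨by simpa using hi', fun g => ?_, fun g h => comm_mem_center
    ((IsPGroup.isMulCommutative_of_card_eq_prime_sq hj).is_comm.comm _ _)⟩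
  refine mem_center_of_mk_eq_one ?_
  rw [map_pow]
  generalize QuotientGroup.mk' (center G) g = q
  have hd : orderOf q ∣ 3 ^ 2 := by rw [← hj]; exact orderOf_dvd_natCard q
  obtain ⟨l, hl, hl'⟩ := (Nat.dvd_prime_pow Nat.prime_three).1 hd
  have hl2 : l ≠ 2 := fun h => hncyc
    (isCyclic_of_orderOf_eq_card q (by rw [hl', hj, h]))
  rw [← orderOf_dvd_iff_pow_eq_one, hl']
  exact pow_dvd_pow 3 (by omega : l ≤ 1)

/-- In a nonabelian group of order `27`, every noncommuting pair is a standard pair of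
generators. -/
theorem isStandardPair_of_card_eq (hcard : Nat.card G = 27) {x y : G} (hxy : ¬ Commute y x) :
    closure {x, y} = ⊤ ∧ ∃ z w, IsStandardPair 0 0 z w x y := by
  have : Fact (Nat.Prime 3) := ⟨Nat.prime_three⟩
  have hfin : Finite G := Nat.finite_of_card_ne_zero (by omega)
  obtain ⟨hZ, hcube, hcomm⟩ := cube_mem_center_of_card hcard ⟨y, x, hxy⟩
  have h1 : iterComm x y 1 ∈ center G := hcomm _ _
  have h1' : iterComm x y 1 ≠ 1 := fun h => hxy (comm_eq_one_iff.1 h)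
  have h2 : iterComm x y 2 = 1 := comm_eq_one_iff.2 (commute_of_mem_center h1 x)
  refine ⟨?_, ?_⟩
  · have hd : Nat.card (closure {x, y}) ∣ 3 ^ 3 := by
      have := card_subgroup_dvd_card (closure {x, y})
      rwa [hcard] at this
    obtain ⟨l, hl, hl'⟩ := (Nat.dvd_prime_pow Nat.prime_three).1 hd
    have hxm : x ∈ closure {x, y} := subset_closure (by simp)
    have hym : y ∈ closure {x, y} := subset_closure (by simp)
    have key : ¬ ∀ a b : closure {x, y}, a * b = b * a := fun h =>
      hxy (congrArg Subtype.val (h ⟨y, hym⟩ ⟨x, hxm⟩))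
    have hl3 : l = 3 := by
      by_contra hl3
      refine key ?_
      have : l < 3 := by omega
      interval_cases l
      · have := (Nat.card_eq_one_iff_unique.1 (hl'.trans (pow_zero 3))).1
        exact fun a b => Subsingleton.elim _ _
      · have := isCyclic_of_prime_card (p := 3) (α := closure {x, y}) (by simpa using hl')
        exact fun a b => (IsCyclic.isMulCommutative (α := closure {x, y})).is_comm.comm a b
      · exact (IsPGroup.isMulCommutative_of_card_eq_prime_sq hl').is_comm.comm
    exact eq_top_of_card_eq _ (by rw [hl', hl3, hcard]; norm_num)
  · obtain ⟨w, hw⟩ := exists_zpow_of_mem_center hZ h1 h1' (hcube x)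
    obtain ⟨z, hz⟩ := exists_zpow_of_mem_center hZ h1 h1' (hcube y)
    have hc : IsCommPair 0 0 x y :=
      { last := h2
        y_one := by
          rw [zpow_zero, comm_eq_one_iff]; exact (commute_of_mem_center h1 y).symm
        y_ge := fun k hk => by
          rw [iterComm_eq_one_of_le h2 hk]; exact Commute.one_right y
        a_eq := fun _ => rfl }
    have h3 := cube_eq_one_of_mem_center hZ h1
    exact ⟨z, w, hc.isStandardPair h3 hw (by rw [h3, h2, mul_one, mul_one]; exact hz)⟩

end CentralExtension

end CoclassOne

namespace CoclassOne

open Subgroup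

/-! ### Lifting standard pairs through the centre. -/

section Lift

variable {G : Type*} [Group G] {m : ℕ} {a z w : ℤ} {x y : G}

local notation "π" => QuotientGroup.mk' (center G)

theorem mk_iterComm (k : ℕ) : π (iterComm x y k) = iterComm (π x) (π y) k :=
  map_iterComm _ x y k

/-- If `gˢ = gd`, `dˢ = df` and `fˢ = f` with commuting `d, f` of exponent three, then `s^3`
commutes with `g`. -/
theorem commute_cube_of_conjBy {s g d f : G} (h₁ : conjBy s g = g * d) (h₂ : conjBy s d = d * f)
    (h₃ : f ∈ center G) (hd : d ^ 3 = 1) (hf : f ^ 3 = 1) : Commute (s ^ 3) g := by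
  have e : conjBy (s ^ 3) g = conjBy s (conjBy s (conjBy s g)) := by
    simp [conjBy_apply, pow_succ, mul_assoc]
  have c := commute_of_mem_center h₃ d
  have hfs : conjBy s f = f := conjBy_eq_self.2 (commute_of_mem_center h₃ s).symm
  rw [← conjBy_eq_self, e, h₁, map_mul, h₁, h₂, map_mul, map_mul, map_mul, h₁, h₂, hfs]
  have : g * d * (d * f) * (d * f * f) = g * (d ^ 3 * f ^ 3) := by
    have c' (r : G) : f * (d * r) = d * (f * r) := by rw [← mul_assoc, c.eq, mul_assoc]
    simp only [pow_succ, pow_zero, one_mul, mul_assoc, c']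
  rw [this, hd, hf, mul_one, mul_one]

/-- The commutator relations that make a lift of a standard pair a standard pair. -/
structure IsLiftPair (m : ℕ) (x y : G) : Prop where
  y_ge : ∀ k, 2 ≤ k → Commute y (iterComm x y k)
  y_one : comm y (iterComm x y 1) ∈ center G
  -- The lift has index m + 1; for m = 0 that is 1, where a standard pair must have a = 0.
  y_one' : m = 0 → Commute y (iterComm x y 1)

theorem isLiftPair_zero (h : IsStandardPair 0 a z w (π x) (π y))
    (hy : Commute y (iterComm x y 1)) : IsLiftPair 0 x y where
  y_ge k hk := by
    have : π (iterComm x y k) = 1 := by rw [mk_iterComm, h.eq_one (by omega)]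
    exact (commute_of_mem_center (mem_center_of_mk_eq_one this) y).symm
  y_one := by rw [comm_eq_one_iff.2 hy]; exact one_mem _
  y_one' _ := hy

theorem comm_mul_center {g h c d : G} (hc : c ∈ center G) (hd : d ∈ center G) :
    comm (g * c) (h * d) = comm g h := by
  rw [comm_mul_of_commute (commute_of_mem_center hc _) (commute_of_mem_center hc _), ← comm_inv,
    comm_mul_of_commute (commute_of_mem_center hd _) (commute_of_mem_center hd _), comm_inv]

/-- Modulo the centre t_2 is central, so conjugation by t_2 changes x and y by central factors and
fixes [y, x] = t_1. As [y, t_1] is central, conjugating y t_1 = t_1 y [y, t_1] by x then shows that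
y commutes with t_2. -/
theorem isLiftPair_one (h : IsStandardPair 1 a z w (π x) (π y)) : IsLiftPair 1 x y := by
  have ha := h.a_eq (by norm_num)
  have h3 : iterComm x y 3 ∈ center G := mem_center_of_mk_eq_one (by
    rw [mk_iterComm, h.eq_one (by omega)])
  have hc : comm y (iterComm x y 1) ∈ center G := comm_mem_center (by
    rw [mk_iterComm]; exact h.commute_y_one ha)
  have h21 : Commute (iterComm x y 2) (iterComm x y 1) := by
    have hx : comm x (iterComm x y 2) ∈ center G := comm_mem_center (by
      rw [mk_iterComm]; exact h.commute_x_last.symm)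
    have hy : comm y (iterComm x y 2) ∈ center G := comm_mem_center (by
      rw [mk_iterComm]; exact h.commute_y_last)
    have e : conjBy (iterComm x y 2) (comm y x) = comm y x := by
      have := map_comm (conjBy (iterComm x y 2) : G →* G) y x
      simp only [MonoidHom.coe_coe] at this
      rw [this, conjBy_eq_mul_comm, conjBy_eq_mul_comm, comm_mul_center hy hx]
    exact conjBy_eq_self.1 e
  have h2 : Commute y (iterComm x y 2) := by
    have e := congrArg (conjBy x) (mul_eq_mul_comm y (iterComm x y 1))
    have e₀ : conjBy x y = y * iterComm x y 1 := conjBy_iterComm x y 0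
    rw [map_mul, map_mul, map_mul, conjBy_eq_self.2 (commute_of_mem_center hc x).symm,
      conjBy_iterComm, e₀] at e
    have c := commute_of_mem_center hc (iterComm x y 2)
    have c' := commute_of_mem_center hc (iterComm x y 1)
    have e' : y * iterComm x y 1 * (iterComm x y 1 * iterComm x y 2) =
        iterComm x y 1 * (y * iterComm x y 2) *
          (iterComm x y 1 * comm y (iterComm x y 1)) := by
      rw [mul_eq_mul_comm y (iterComm x y 1), ← h21.eq]
      simp only [mul_assoc]
      rw [← mul_assoc (comm y (iterComm x y 1)) (iterComm x y 2), c.eq, mul_assoc, c'.eq]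
    rw [e'] at e
    have e'' := mul_left_cancel (by
      simpa only [mul_assoc] using e :
        iterComm x y 1 * (y * (iterComm x y 2 * (iterComm x y 1 * comm y (iterComm x y 1)))) =
        iterComm x y 1 * (iterComm x y 2 * (y * (iterComm x y 1 * comm y (iterComm x y 1)))))
    simp only [← mul_assoc] at e''
    exact mul_right_cancel (mul_right_cancel e'')
  refine ⟨fun k hk => ?_, hc, by simp⟩
  rcases hk.eq_or_lt with rfl | hk
  · exact h2
  · have : π (iterComm x y k) = 1 := by rw [mk_iterComm, h.eq_one (by omega)]
    exact (commute_of_mem_center (mem_center_of_mk_eq_one this) y).symm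

/-- A cubing relation modulo the centre writes t_{k+2} through t_k³ and t_{k+1}³ up to a central
factor, so t_{k+2} commutes with whatever commutes with t_k and t_{k+1} modulo the centre. This
settles all pairs except the low ones [t_1, t_2], [y, t_3], [y, t_2], which are obtained in this
order from the relation for y³ and from conjugation by x. -/
theorem isLiftPair_of_two_le (hm : 2 ≤ m) (hZ : Nat.card (center G) = 3)
    (hG : closure {x, y} = ⊤) (h : IsStandardPair m a z w (π x) (π y)) : IsLiftPair m x y := by
  have hQ (j k : ℕ) (hj : 1 ≤ j) (hk : 1 ≤ k) :
      Commute (π (iterComm x y j)) (π (iterComm x y k)) := by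
    rw [mk_iterComm, mk_iterComm]; exact h.commute_iterComm hj hk
  have hQy (k : ℕ) (hk : 2 ≤ k) : Commute (π y) (π (iterComm x y k)) := by
    rw [mk_iterComm]; exact h.y_ge k hk
  have hcube (k : ℕ) (hk : 1 ≤ k) : (iterComm x y k ^ 3 * iterComm x y (k + 1) ^ 3) *
      iterComm x y (k + 2) ∈ center G := mem_center_of_mk_eq_one (by
    simp only [map_mul, map_pow, mk_iterComm]; exact h.t_cube k hk)
  have t3 (j k : ℕ) (hj : 1 ≤ j) (hk : 3 ≤ k) : Commute (iterComm x y j) (iterComm x y k) := by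
    obtain ⟨k, rfl⟩ := Nat.exists_eq_add_of_le' (Nat.le_of_lt (Nat.lt_of_succ_le hk) : 2 ≤ k)
    exact commute_of_mul_mem_center (hcube k (by omega))
      ((commute_cube_of_mk hZ (hQ j k hj (by omega))).mul_right
        (commute_cube_of_mk hZ (hQ j (k + 1) hj (by omega))))
  have y4 (k : ℕ) (hk : 4 ≤ k) : Commute y (iterComm x y k) := by
    obtain ⟨k, rfl⟩ := Nat.exists_eq_add_of_le' (by omega : 2 ≤ k)
    exact commute_of_mul_mem_center (hcube k (by omega))
      ((commute_cube_of_mk hZ (hQy k (by omega))).mul_right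
        (commute_cube_of_mk hZ (hQy (k + 1) (by omega))))
  obtain ⟨e, he, hu⟩ := exists_eq_mul_of_mk_eq
    (u := y ^ 3 * iterComm x y 1 ^ 3 * iterComm x y 2) (v := iterComm x y (m + 1) ^ z) (by
      simp only [map_mul, map_pow, map_zpow, mk_iterComm]; exact h.y_cube)
  obtain ⟨f, hf, hd⟩ := exists_eq_mul_of_mk_eq
    (u := comm y (iterComm x y 1)) (v := iterComm x y (m + 1) ^ a) (by
      simp only [map_comm, map_zpow, mk_iterComm]; exact h.y_one)
  -- The cube of t_m is central, hence fixed by x, which sends it to t_m³ t_{m+1}³.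
  have hL3 : iterComm x y (m + 1) ^ 3 = 1 := by
    have hc : iterComm x y m ^ 3 ∈ center G := mem_center_of_mk_eq_one (by
      have := h.t_cube m (by omega)
      rw [h.last_cube, h.last, mul_one, mul_one] at this
      rw [map_pow, mk_iterComm, this])
    have := conjBy_eq_self.2 (commute_of_mem_center hc x).symm
    rwa [map_pow, conjBy_iterComm, (t3 m (m + 1) (by omega) (by omega)).mul_pow,
      mul_eq_left] at this
  have hLz (i : ℤ) {e : G} (he : e ∈ center G) : (iterComm x y (m + 1) ^ i * e) ^ 3 = 1 := by
    rw [(commute_of_mem_center he _).symm.mul_pow, cube_eq_one_of_mem_center hZ he, mul_one,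
      ← zpow_natCast, zpow_comm, zpow_natCast, hL3, one_zpow]
  have tL (j : ℕ) (hj : 1 ≤ j) (i : ℤ) {e : G} (he : e ∈ center G) :
      Commute (iterComm x y j) (iterComm x y (m + 1) ^ i * e) :=
    ((t3 j (m + 1) hj (by omega)).zpow_right i).mul_right (commute_of_mem_center he _).symm
  -- The relation for y expresses t_2 through y³, t_1³ and elements already known to commute with
  -- t_1; it remains that t_1 commutes with y³.
  have t12 : Commute (iterComm x y 1) (iterComm x y 2) := by
    have c : Commute (y ^ 3) (iterComm x y 1) := by
      have hyL : comm (comm (iterComm x y 1) y) y ∈ center G := comm_mem_center (by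
        have hf1 : π f = 1 := (QuotientGroup.eq_one_iff f).2 hf
        rw [← comm_inv, map_inv, hd, map_mul, hf1, map_zpow]
        simpa using ((hQy (m + 1) (by omega)).symm.zpow_left a).inv_left)
      refine commute_cube_of_conjBy (conjBy_eq_mul_comm _ _) (conjBy_eq_mul_comm _ _) hyL ?_
        (cube_eq_one_of_mem_center hZ hyL)
      rw [← comm_inv, hd, inv_pow, hLz a hf, inv_one]
    have c' : Commute (iterComm x y 1) (y ^ 3 * iterComm x y 1 ^ 3) :=
      c.symm.mul_right ((Commute.refl _).pow_right 3)
    have := c'.inv_right.mul_right (hu ▸ tL 1 le_rfl z he)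
    rwa [inv_mul_cancel_left] at this
  -- Conjugating y t_2 = t_2 y [y, t_2], with [y, t_2] central, by x turns y into y t_1 and t_2 into
  -- t_2 t_3; what remains after cancellation is the commutation of y with t_3.
  have y3 : Commute y (iterComm x y 3) := by
    have hc : comm y (iterComm x y 2) ∈ center G := comm_mem_center (hQy 2 le_rfl)
    have e := congrArg (conjBy x) (mul_eq_mul_comm y (iterComm x y 2))
    have e₀ : conjBy x y = y * iterComm x y 1 := conjBy_iterComm x y 0
    rw [map_mul, map_mul, map_mul, conjBy_eq_self.2 (commute_of_mem_center hc x).symm,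
      conjBy_iterComm, e₀] at e
    have c3 := commute_of_mem_center hc (iterComm x y 3)
    have c1 := commute_of_mem_center hc (iterComm x y 1)
    have t13 := t3 1 3 le_rfl le_rfl
    have e' : y * iterComm x y 1 * (iterComm x y 2 * iterComm x y 3) =
        iterComm x y 2 * (y * iterComm x y 3 * (iterComm x y 1 * comm y (iterComm x y 2))) := by
      rw [mul_assoc, ← mul_assoc (iterComm x y 1), t12.eq, mul_assoc, ← mul_assoc y,
        mul_eq_mul_comm y (iterComm x y 2), t13.eq]
      simp only [mul_assoc]
      rw [← mul_assoc (comm y _), c3.eq, mul_assoc, c1.eq]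
    have e'' : iterComm x y 2 * iterComm x y 3 * (y * iterComm x y 1) * comm y (iterComm x y 2) =
        iterComm x y 2 * (iterComm x y 3 * y * (iterComm x y 1 * comm y (iterComm x y 2))) := by
      simp only [mul_assoc]
    have e3 := (e'.symm.trans e).trans e''
    exact mul_right_cancel (mul_left_cancel e3)
  have y3' (k : ℕ) (hk : 3 ≤ k) : Commute y (iterComm x y k) := by
    rcases hk.eq_or_lt with rfl | hk
    · exact y3
    · exact y4 k hk
  have yL (i : ℤ) {e : G} (he : e ∈ center G) : Commute y (iterComm x y (m + 1) ^ i * e) :=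
    ((y3' (m + 1) (by omega)).zpow_right i).mul_right (commute_of_mem_center he _).symm
  have y2 : Commute y (iterComm x y 2) := by
    have c : Commute y (iterComm x y 1 ^ 3) :=
      commute_cube (mul_eq_mul_comm y _) (hd ▸ (tL 1 le_rfl a hf).symm) (hd ▸ hLz a hf)
    have := (((Commute.refl y).pow_right 3).mul_right c).inv_right.mul_right (hu ▸ yL z he)
    rwa [inv_mul_cancel_left] at this
  refine ⟨fun k hk => ?_, ?_, by omega⟩
  · rcases hk.eq_or_lt with rfl | hk
    · exact y2
    · exact y3' k hk
  -- Conjugation by x sends [y, t_1] to [y t_1, t_1 t_2], which equals [y, t_1] by the commutations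
  -- just found.
  · refine mem_center_of_closure hG ?_ (hd ▸ yL a hf)
    have e := map_comm (conjBy x : G →* G) y (iterComm x y 1)
    have e₀ : conjBy x y = y * iterComm x y 1 := conjBy_iterComm x y 0
    simp only [MonoidHom.coe_coe, conjBy_iterComm, e₀] at e
    rw [← conjBy_eq_self, e]
    have cd : Commute (iterComm x y 1) (comm y (iterComm x y 1)) := hd ▸ tL 1 le_rfl a hf
    have e₁ : comm (iterComm x y 1 * iterComm x y 2) (y * iterComm x y 1) =
        comm (iterComm x y 1) (y * iterComm x y 1) := by
      have c2 : Commute (iterComm x y 2) (y * iterComm x y 1) := y2.symm.mul_right t12.symm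
      exact comm_mul_of_commute c2 (commute_comm t12.symm c2)
    have e₂ : comm (y * iterComm x y 1) (iterComm x y 1) = comm y (iterComm x y 1) :=
      comm_mul_of_commute (Commute.refl _) cd
    rw [← comm_inv, e₁, comm_inv, e₂]

/-- A lift of a standard pair to a central extension is a standard pair, provided the commutator
relations hold. -/
theorem IsLiftPair.isStandardPair (hl : IsLiftPair m x y) (hZ : Nat.card (center G) = 3)
    (hG : closure {x, y} = ⊤) (h : IsStandardPair m a z w (π x) (π y))
    (hcard : Nat.card (G ⧸ center G) = 3 ^ (m + 3)) :
    ∃ a' z' w', IsStandardPair (m + 1) a' z' w' x y := by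
  have hQ : closure {π x, π y} = ⊤ := by
    have := congrArg (Subgroup.map π) hG
    rwa [MonoidHom.map_closure, Set.image_pair, ← MonoidHom.range_eq_map,
      MonoidHom.range_eq_top.2 (QuotientGroup.mk'_surjective _)] at this
  have yL : Commute y (iterComm x y (m + 1)) := by
    rcases Nat.eq_zero_or_pos m with rfl | hm
    · exact hl.y_one' rfl
    · exact hl.y_ge _ (by omega)
  have hζ : iterComm x y (m + 2) ∈ center G := mem_center_of_mk_eq_one (by
    rw [mk_iterComm, h.last])
  -- Otherwise t_{m+1} would be central and so trivial in the quotient, making the chain there too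
  -- short for its order.
  have hζ1 : iterComm x y (m + 2) ≠ 1 := fun h1 => by
    have hc : iterComm x y (m + 1) ∈ center G :=
      mem_center_of_closure hG (comm_eq_one_iff.1 h1).symm yL
    have h2 : iterComm (π x) (π y) (m + 1) = 1 := by
      rw [← mk_iterComm]; exact (QuotientGroup.eq_one_iff _).2 hc
    have := h.card_tail hQ hcard (i := 1) (j := m + 1) (by omega)
    rw [tail_eq_bot h2] at this
    simp at this
  obtain ⟨a', ha'⟩ := exists_zpow_of_mem_center hZ hζ hζ1 hl.y_one
  have hpair : ∃ a', IsCommPair (m + 1) a' x y := by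
    have hlast : iterComm x y (m + 1 + 2) = 1 :=
      comm_eq_one_iff.2 (commute_of_mem_center hζ x)
    rcases Nat.eq_zero_or_pos m with rfl | hm
    · exact ⟨0, hlast, by rw [zpow_zero, comm_eq_one_iff]; exact hl.y_one' rfl, hl.y_ge,
        fun _ => rfl⟩
    · exact ⟨a', hlast, ha', hl.y_ge, by omega⟩
  clear ha' a'
  obtain ⟨a', hp⟩ := hpair
  have yLz (i : ℤ) {e : G} (he : e ∈ center G) : Commute y (iterComm x y (m + 1) ^ i * e) :=
    (yL.zpow_right i).mul_right (commute_of_mem_center he _).symm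
  have hx : x ^ 3 ∈ center G := by
    obtain ⟨e, he, hu⟩ := exists_eq_mul_of_mk_eq (u := x ^ 3) (v := iterComm x y (m + 1) ^ w) (by
      simp only [map_pow, map_zpow, mk_iterComm]; exact h.x_cube)
    exact mem_center_of_closure hG ((Commute.refl x).pow_right 3) (hu ▸ yLz w he)
  -- This cube is a power of t_{m+1} up to the centre, so it commutes with y; it commutes with xy,
  -- hence with x. Through the trace it yields the relation for y³.
  have hxy : (x * y) ^ 3 ∈ center G := by
    obtain ⟨e, he, hu⟩ := exists_eq_mul_of_mk_eq (u := (x * y) ^ 3)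
      (v := iterComm x y (m + 1) ^ (w + z - 5 * a)) (by
      simp only [map_pow, map_zpow, map_mul, mk_iterComm]; exact h.mul_cube_eq)
    have hy : Commute y ((x * y) ^ 3) := hu ▸ yLz _ he
    refine mem_center_of_closure hG ?_ hy
    have := ((Commute.refl (x * y)).pow_right 3).mul_left hy.inv_left
    rwa [mul_inv_cancel_right] at this
  have hy : y ^ 3 * iterComm x y 1 ^ 3 * iterComm x y 2 ∈ center G := by
    have ht := hp.trace_y
    simp only [conjBy_apply] at ht
    rw [conj_cube, ht] at hxy
    rw [Subgroup.mul_mem_cancel_left _ hx] at hxy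
    exact (Subgroup.mul_mem_cancel_right _ (zpow_mem hζ _)).1 hxy
  obtain ⟨w', hw'⟩ := exists_zpow_of_mem_center hZ hζ hζ1 hx
  obtain ⟨z', hz'⟩ := exists_zpow_of_mem_center hZ hζ hζ1 hy
  exact ⟨a', z', w', hp.isStandardPair (cube_eq_one_of_mem_center hZ hζ) hw' hz'⟩

/-- In an extension of a nonabelian group of order `27` by a centre of order three one can choose
generators with `[y,[y,x]] = 1`. -/
theorem exists_commute_comm (hZ : Nat.card (center G) = 3)
    (hcard : Nat.card (G ⧸ center G) = 27) (hnc : ∃ g h : G ⧸ center G, ¬ Commute g h) :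
    ∃ x y : G, ¬ Commute (π y) (π x) ∧ Commute y (comm y x) := by
  obtain ⟨g, h, hgh⟩ := hnc
  obtain ⟨p, rfl⟩ := QuotientGroup.mk'_surjective _ g
  obtain ⟨q, rfl⟩ := QuotientGroup.mk'_surjective _ h
  obtain ⟨hZQ, -, hcomm⟩ := cube_mem_center_of_card hcard ⟨_, _, hgh⟩
  have hs : π (comm p q) ∈ center (G ⧸ center G) := by rw [map_comm]; exact hcomm _ _
  have hs1 : π (comm p q) ≠ 1 := by
    rw [map_comm]
    exact fun h => hgh (comm_eq_one_iff.1 h)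
  have key : ∀ {x y : G}, Commute y (comm p q) → Commute y (comm y x) := by
    intro x y hy
    obtain ⟨i, hi⟩ := exists_zpow_of_mem_center hZQ hs hs1 (hcomm (π y) (π x))
    rw [← map_comm, ← map_zpow] at hi
    obtain ⟨e, he, hu⟩ := exists_eq_mul_of_mk_eq hi
    rw [hu]
    exact (hy.zpow_right i).mul_right (commute_of_mem_center he y).symm
  by_cases hq : Commute q (comm p q)
  · exact ⟨p, q, fun h => hgh h.symm, key hq⟩
  · have hc (g : G) : comm g (comm p q) ∈ center G :=
      comm_mem_center (commute_of_mem_center hs _).symm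
    -- With c = [p, q], both [p, c] and [q, c] lie in the centre of order three. If [p, c] = [q,
    -- c]^i, then p q^(-i) commutes with c, and hence with every commutator, since these are powers
    -- of c up to the centre.
    obtain ⟨i, hi⟩ := exists_zpow_of_mem_center hZ (hc q)
      (fun h => hq (comm_eq_one_iff.1 h)) (hc p)
    refine ⟨q, p * q ^ (-i), fun h => hgh ?_, key (Commute.symm (conjBy_eq_self.1 ?_))⟩
    · rw [map_mul, map_zpow] at h
      have := h.mul_left ((Commute.refl (π q)).zpow_left i)
      rwa [mul_assoc, ← zpow_add, neg_add_cancel, zpow_zero, mul_one] at this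
    · have c := commute_of_mem_center (zpow_mem (hc q) i) (q ^ (-i))
      rw [map_mul, map_zpow, conjBy_eq_mul_comm, conjBy_eq_mul_comm, hi,
        (commute_of_mem_center (hc q) q).symm.mul_zpow, mul_assoc, ← mul_assoc (comm _ _ ^ i),
        c.eq, mul_assoc, ← zpow_add, add_neg_cancel, zpow_zero, mul_one]

end Lift

/-- A `3`-group of coclass one has a standard pair of generators. -/
theorem exists_isStandardPair (m : ℕ) : ∀ {G : Type*} [Group G], Nat.card G = 3 ^ (m + 3) →
    Group.nilpotencyClass G = m + 2 →
    ∃ (x y : G) (a z w : ℤ), closure {x, y} = (⊤ : Subgroup G) ∧ IsStandardPair m a z w x y := by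
  have nonab : ∀ {k : ℕ} {G : Type _} [Group G], Nat.card G = 3 ^ (k + 3) →
      Group.nilpotencyClass G = k + 2 → ∃ g h : G, ¬ Commute g h := by
    intro k G _ hG hc
    by_contra! hab
    have : Fact (Nat.Prime 3) := ⟨Nat.prime_three⟩
    have hfin : Finite G := Nat.finite_of_card_ne_zero (by rw [hG]; positivity)
    have hnil := (IsPGroup.of_card hG).isNilpotent
    have : IsMulCommutative G := ⟨⟨hab⟩⟩
    have := Group.IsNilpotent.nilpotencyClass_le_one_iff.2 this
    omega
  induction m with
  | zero =>
    intro G _ hG hc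
    obtain ⟨y, x, hxy⟩ := nonab (k := 0) hG hc
    obtain ⟨h, z, w, hs⟩ := isStandardPair_of_card_eq (by simpa using hG) hxy
    exact ⟨x, y, 0, z, w, h, hs⟩
  | succ m ih =>
    intro G _ hG hc
    have : Fact (Nat.Prime 3) := ⟨Nat.prime_three⟩
    have hfin : Finite G := Nat.finite_of_card_ne_zero (by rw [hG]; positivity)
    obtain ⟨hZ, hQ, hQc⟩ := card_center_of_maximal_class (m := m + 1) hG hc
    have hQnt : Nontrivial (G ⧸ center G) := Finite.one_lt_card_iff_nontrivial.1 (by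
      rw [hQ]; exact Nat.one_lt_pow (by omega) (by norm_num))
    -- It is enough to have a standard pair in the quotient with arbitrary lifts; only for m = 0 do
    -- the lifts have to satisfy [y, t_1] = 1.
    suffices ∃ (x y : G) (a z w : ℤ),
        closure {QuotientGroup.mk' (center G) x, QuotientGroup.mk' (center G) y} = ⊤ ∧
        IsStandardPair m a z w (QuotientGroup.mk' (center G) x) (QuotientGroup.mk' (center G) y) ∧
        (m = 0 → Commute y (iterComm x y 1)) by
      obtain ⟨x, y, a, z, w, hcl, hs, h0⟩ := this
      have htop := closure_eq_top_of_mk hfin (IsPGroup.of_card hG) hZ hQnt hcl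
      have hl : IsLiftPair m x y := by
        rcases Nat.lt_or_ge m 2 with hm | hm
        · interval_cases m
          · exact isLiftPair_zero hs (h0 rfl)
          · exact isLiftPair_one hs
        · exact isLiftPair_of_two_le hm hZ htop hs
      obtain ⟨a', z', w', h'⟩ := hl.isStandardPair hZ htop hs hQ
      exact ⟨x, y, a', z', w', htop, h'⟩
    rcases Nat.eq_zero_or_pos m with rfl | hm
    · have hQ27 : Nat.card (G ⧸ center G) = 27 := by simpa using hQ
      obtain ⟨x, y, hxy, hy⟩ := exists_commute_comm hZ hQ27 (nonab (k := 0) hQ hQc)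
      obtain ⟨hcl, z, w, hs⟩ := isStandardPair_of_card_eq hQ27 hxy
      exact ⟨x, y, 0, z, w, hcl, hs, fun _ => hy⟩
    · obtain ⟨x', y', a, z, w, hcl, hs⟩ := ih hQ hQc
      obtain ⟨x, rfl⟩ := QuotientGroup.mk'_surjective _ x'
      obtain ⟨y, rfl⟩ := QuotientGroup.mk'_surjective _ y'
      exact ⟨x, y, a, z, w, hcl, hs, fun h => absurd h hm.ne'⟩

end CoclassOne

namespace CoclassOne

open Subgroup

/-! ### The transfer to a normal subgroup of prime index. -/

section Transfer

variable {G : Type*} [Group G]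

/-- The transfer to a normal subgroup of prime index `p` is the `p`th power outside of it. -/
theorem transfer_eq_of_notMem {A : Type*} [CommGroup A] {H : Subgroup G} [H.Normal]
    [H.FiniteIndex] {p : ℕ} (hp : p.Prime) (hH : H.index = p) (φ : H →* A) {g : G} (hg : g ∉ H)
    (hgp : g ^ p ∈ H) : MonoidHom.transfer φ g = φ ⟨g ^ p, hgp⟩ := by
  classical
  have : Fact p.Prime := ⟨hp⟩
  let := H.fintypeQuotientOfFiniteIndex
  -- Without fixed points every orbit of ⟨g⟩ on the p cosets has length p, so there is one orbit and
  -- the product formula for the transfer has a single factor, a conjugate of g^p.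
  have hfix : ∀ q : G ⧸ H, g • q ≠ q := fun q h => by
    induction q using QuotientGroup.induction_on with
    | H k =>
      rw [MulAction.Quotient.smul_coe, smul_eq_mul, eq_comm, QuotientGroup.eq, ← mul_assoc] at h
      have := ‹H.Normal›.conj_mem _ h k
      simp [mul_assoc] at this
      exact hg this
  have hper : ∀ q : G ⧸ H, Function.minimalPeriod (g • ·) q = p := fun q => by
    have hdvd : Function.minimalPeriod (g • ·) q ∣ p := by
      refine MulAction.pow_smul_eq_iff_minimalPeriod_dvd.1 ?_
      induction q using QuotientGroup.induction_on with
      | H k =>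
        rw [MulAction.Quotient.smul_coe, smul_eq_mul, eq_comm, QuotientGroup.eq]
        have := ‹H.Normal›.conj_mem _ hgp k⁻¹
        simpa [mul_assoc] using this
    rcases (Nat.dvd_prime hp).1 hdvd with h | h
    · exact absurd (Function.minimalPeriod_eq_one_iff_isFixedPt.1 h) (hfix q)
    · exact h
  have hsum := index_eq_sum_minimalPeriod H g
  simp only [hper, Finset.sum_const, smul_eq_mul, hH] at hsum
  have hone : Fintype.card (Quotient (MulAction.orbitRel (zpowers g) (G ⧸ H))) = 1 := by
    have := hp.pos
    rw [Finset.card_univ] at hsum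
    exact Nat.eq_of_mul_eq_mul_right this (by rw [one_mul]; exact hsum.symm)
  have := Fintype.card_le_one_iff_subsingleton.1 hone.le
  obtain ⟨q₀⟩ := Fintype.card_pos_iff.1 (by rw [hone]; norm_num)
  rw [MonoidHom.transfer_eq_prod_quotient_orbitRel_zpowers_quot, Fintype.prod_subsingleton _ q₀]
  -- The coset representative is g^i k with k ∈ H. Since g^i commutes with g^p, the conjugation is
  -- by k alone and disappears in the commutative target.
  obtain ⟨i, hi⟩ := mem_zpowers_iff.1 (mem_zpowers_of_prime_card (p := p)
    (g := (g : G ⧸ H)) (g' := (q₀.out.out : G ⧸ H)) (by rw [← index_eq_card, hH])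
    (fun h => hg ((QuotientGroup.eq_one_iff g).1 h)))
  obtain ⟨k, hk, hk'⟩ : ∃ k ∈ H, q₀.out.out = g ^ i * k :=
    ⟨(g ^ i)⁻¹ * q₀.out.out, QuotientGroup.eq.1 (by rw [← hi]; rfl), by simp⟩
  have e : (⟨_, QuotientGroup.out_conj_pow_minimalPeriod_mem H g q₀.out⟩ : H) =
      (⟨k, hk⟩⁻¹ * ⟨g ^ p, hgp⟩ * ⟨k, hk⟩ : H) := by
    apply Subtype.ext
    simp only [hper, hk', Subgroup.coe_mul, Subgroup.coe_inv]
    have c : Commute (g ^ i) (g ^ p) := ((Commute.refl g).pow_right p).zpow_left i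
    rw [mul_inv_rev, mul_assoc k⁻¹, ← mul_assoc, mul_assoc k⁻¹, mul_assoc _ (g ^ p), ← c.eq,
      inv_mul_cancel_left]
  rw [e, map_mul, map_mul, map_inv, mul_comm _ (φ ⟨g ^ p, hgp⟩), inv_mul_cancel_right]

theorem pow_index_mem {H : Subgroup G} [H.Normal] {p : ℕ} (hH : H.index = p) (g : G) :
    g ^ p ∈ H := hH ▸ H.pow_index_mem g

theorem of_eq_one_iff {H : Subgroup G} {h : H} :
    Abelianization.of h = 1 ↔ (h : G) ∈ ⁅H, H⁆ := by
  rw [← map_subtype_commutator, ← MonoidHom.mem_ker, Abelianization.ker_of]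
  constructor
  · exact fun h' => ⟨h, h', rfl⟩
  · rintro ⟨k, hk, hk'⟩
    rwa [← Subtype.ext hk']

theorem of_surjective : Function.Surjective (Abelianization.of : G →* Abelianization G) :=
  QuotientGroup.mk'_surjective _

theorem artinTransfer_of (H : Subgroup G) [H.FiniteIndex] (g : G) :
    artinTransfer H (Abelianization.of g) = MonoidHom.transfer Abelianization.of g :=
  Abelianization.lift_apply_of _ _

/-- The Artin transfer to a subgroup of index three vanishes on an element outside of it if and
only if the cube of the element is in the commutator subgroup. -/
theorem artinTransfer_eq_one_iff {H : Subgroup G} [H.Normal] [H.FiniteIndex] (hH : H.index = 3)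
    {g : G} (hg : g ∉ H) :
    artinTransfer H (Abelianization.of g) = 1 ↔ g ^ 3 ∈ ⁅H, H⁆ := by
  rw [artinTransfer_of, transfer_eq_of_notMem Nat.prime_three hH _ hg (pow_index_mem hH g),
    of_eq_one_iff]

/-- The complement of a proper subgroup generates: g = (g t) t⁻¹ for g ∈ H, t ∉ H. A transfer to H
thus never has to be evaluated on H itself. -/
theorem eq_top_of_forall_notMem {H K : Subgroup G} (hH : H ≠ ⊤) (h : ∀ g ∉ H, g ∈ K) : K = ⊤ := by
  obtain ⟨t, -, ht⟩ := SetLike.exists_of_lt hH.lt_top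
  refine eq_top_iff.2 fun g _ => ?_
  by_cases hg : g ∈ H
  · have h₁ := h (g * t) (fun h' => ht ((H.mul_mem_cancel_left hg).1 h'))
    exact (K.mul_mem_cancel_right (h t ht)).1 h₁
  · exact h g hg

theorem ne_top_of_index {H : Subgroup G} (hH : H.index = 3) : H ≠ ⊤ := by
  rintro rfl
  simp at hH

theorem isCoatom_of_index {H : Subgroup G} (hH : H.index = 3) : IsCoatom H := by
  refine ⟨ne_top_of_index hH, fun K hK => ?_⟩
  have h₁ := relIndex_mul_index hK.le
  rw [hH] at h₁
  rcases (Nat.dvd_prime Nat.prime_three).1 ⟨_, h₁.symm⟩ with h | h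
  · exact absurd (relIndex_eq_one.1 h) hK.not_ge
  · rw [h] at h₁
    exact index_eq_one.1 (by omega)

theorem ker_artinTransfer_eq_top {H : Subgroup G} [H.Normal] [H.FiniteIndex] (hH : H.index = 3)
    (h : ∀ g ∉ H, g ^ 3 ∈ ⁅H, H⁆) : (artinTransfer H).ker = ⊤ := by
  have : (artinTransfer H).ker.comap Abelianization.of = ⊤ :=
    eq_top_of_forall_notMem (ne_top_of_index hH) fun g hg =>
      (artinTransfer_eq_one_iff hH hg).2 (h g hg)
  refine eq_top_iff.2 fun q _ => ?_
  obtain ⟨g, rfl⟩ := of_surjective q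
  exact mem_comap.1 (this.ge (mem_top g))

theorem ker_artinTransfer_eq_map {H L : Subgroup G} [H.FiniteIndex]
    (hL : IsCoatom L)
    (h₁ : ∀ l ∈ L, artinTransfer H (Abelianization.of l) = 1)
    (h₂ : ∃ g, artinTransfer H (Abelianization.of g) ≠ 1) :
    (artinTransfer H).ker = L.map Abelianization.of := by
  have hK : (artinTransfer H).ker.comap Abelianization.of = L := by
    rcases hL.le_iff.1 (show L ≤ (artinTransfer H).ker.comap Abelianization.of from h₁) with h | h
    · obtain ⟨g, hg⟩ := h₂
      exact absurd (mem_comap.1 (h.ge (mem_top g))) hg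
    · exact h
  rw [← hK, map_comap_eq_self_of_surjective of_surjective]

/-- The kernel of f is the full preimage of the kernel of the induced map, with fibres of size |G'|.
-/
theorem card_ker_lift {A : Type*} [CommGroup A] [Finite G] (f : G →* A) :
    Nat.card (Abelianization.lift f).ker * Nat.card (commutator G) = Nat.card f.ker := by
  have hc : (Abelianization.lift f).ker.comap Abelianization.of = f.ker := by
    ext g; simp [MonoidHom.mem_ker]
  have hi := index_comap_of_surjective (Abelianization.lift f).ker
    (of_surjective (G := G))
  rw [hc] at hi
  have h₁ := card_mul_index (Abelianization.lift f).ker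
  have h₂ := card_mul_index f.ker
  have h₃ : Nat.card (Abelianization G) * Nat.card (commutator G) = Nat.card G :=
    (card_eq_card_quotient_mul_card_subgroup (commutator G)).symm
  rw [← h₁, ← h₂, hi] at h₃
  have : 0 < (Abelianization.lift f).ker.index := Nat.pos_of_ne_zero index_ne_zero_of_finite
  exact Nat.eq_of_mul_eq_mul_right this (by rw [← h₃]; ring)

theorem card_commutator_subgroup (H : Subgroup G) :
    Nat.card (commutator H) = Nat.card (⁅H, H⁆ : Subgroup G) := by
  rw [← map_subtype_commutator]
  exact (card_map_of_injective H.subtype_injective).symm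

end Transfer

/-! ### The four maximal subgroups. -/

section MaximalSubgroups

variable {G : Type*} [Group G] {x y : G}

theorem commutator_closure_le {A B : Set G} {N : Subgroup G} [N.Normal]
    (h : ∀ a ∈ A, ∀ b ∈ B, comm a b ∈ N) : ⁅closure A, closure B⁆ ≤ N := by
  have hmk : ∀ g k : G, Commute (QuotientGroup.mk' N g) (QuotientGroup.mk' N k) ↔
      comm g k ∈ N := fun g k => by
    rw [← comm_eq_one_iff, ← map_comm]
    exact QuotientGroup.eq_one_iff _
  have h₁ : ∀ a ∈ A, ∀ k ∈ closure B,
      Commute (QuotientGroup.mk' N a) (QuotientGroup.mk' N k) := by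
    intro a ha
    have : closure B ≤ (centralizer {QuotientGroup.mk' N a}).comap (QuotientGroup.mk' N) := by
      rw [closure_le]
      exact fun b hb => mem_centralizer_singleton_iff.2 ((hmk a b).2 (h a ha b hb)).symm
    exact fun k hk => (mem_centralizer_singleton_iff.1 (this hk)).symm
  rw [commutator_le]
  intro g hg k hk
  have h₂ : closure A ≤ (centralizer {QuotientGroup.mk' N k}).comap (QuotientGroup.mk' N) := by
    rw [closure_le]
    exact fun a ha => mem_centralizer_singleton_iff.2 (h₁ a ha k hk)
  have h₃ : Commute (QuotientGroup.mk' N g) (QuotientGroup.mk' N k) :=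
    mem_centralizer_singleton_iff.1 (h₂ hg)
  have := (hmk g⁻¹ k⁻¹).1 (by simpa using h₃.inv_inv)
  rwa [comm_eq_commutatorElement, inv_inv, inv_inv] at this

theorem commutator_le_maxSubgroup (i : Fin 4) : commutator G ≤ maxSubgroup x y i := le_sup_right

theorem maxSubgroup_normal (i : Fin 4) : (maxSubgroup x y i).Normal :=
  Normal.of_commutator_le _ (commutator_le_maxSubgroup i)

theorem mem_maxSubgroup (i : Fin 4) :
    (![y, x, x * y, x * y ^ 2] : Fin 4 → G) i ∈ maxSubgroup x y i :=
  mem_sup_left (subset_closure rfl)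

theorem maxSubgroup_zero : maxSubgroup x y 0 = commutator G ⊔ zpowers y := by
  rw [maxSubgroup, sup_comm, zpowers_eq_closure]; rfl

theorem maxSubgroup_one : maxSubgroup x y 1 = commutator G ⊔ zpowers x := by
  rw [maxSubgroup, sup_comm, zpowers_eq_closure]; rfl

/-- Since xy² = (xy)y, H₄ is the H₂ of the pair (xy², y); likewise H₃ is, by definition, the H₂ of
(xy, y). Results on H₂ are carried over by `mul_left`. -/
theorem maxSubgroup_three : maxSubgroup x y 3 = maxSubgroup (x * y * y) y 1 := by
  rw [mul_assoc, ← pow_two]; rfl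

theorem eq_top_of_mem_of_mem {i j : Fin 4} (hij : i ≠ j) (hG : closure {x, y} = ⊤)
    (hy : y ^ 3 ∈ commutator G) {K : Subgroup G} (hK : commutator G ≤ K)
    (hi : (![y, x, x * y, x * y ^ 2] : Fin 4 → G) i ∈ K)
    (hj : (![y, x, x * y, x * y ^ 2] : Fin 4 → G) j ∈ K) : K = ⊤ := by
  have key : x ∈ K → y ∈ K → K = ⊤ := fun hx hy => by
    rw [eq_top_iff, ← hG, closure_le]
    rintro g (rfl | rfl)
    · exact hx
    · exact hy
  have h3 := hK hy
  have hsq : y ^ 2 ∈ K → y ∈ K := fun h2 => by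
    rw [pow_succ] at h3
    exact (K.mul_mem_cancel_left h2).1 h3
  have c₁ : y ∈ K → x * y ∈ K → K = ⊤ := fun h₁ h₂ => key ((K.mul_mem_cancel_right h₁).1 h₂) h₁
  have c₂ : y ∈ K → x * y ^ 2 ∈ K → K = ⊤ := fun h₁ h₂ =>
    key ((K.mul_mem_cancel_right (pow_mem h₁ 2)).1 h₂) h₁
  have c₃ : x ∈ K → x * y ∈ K → K = ⊤ := fun h₁ h₂ => key h₁ ((K.mul_mem_cancel_left h₁).1 h₂)
  have c₄ : x ∈ K → x * y ^ 2 ∈ K → K = ⊤ := fun h₁ h₂ =>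
    key h₁ (hsq ((K.mul_mem_cancel_left h₁).1 h₂))
  have c₅ : x * y ∈ K → x * y ^ 2 ∈ K → K = ⊤ := fun h₁ h₂ =>
    c₁ ((K.mul_mem_cancel_left h₁).1 (by rwa [mul_assoc, ← pow_two])) h₁
  fin_cases i <;> fin_cases j <;> first
    | exact absurd rfl hij
    | exact key hi hj
    | exact key hj hi
    | exact c₁ hi hj
    | exact c₁ hj hi
    | exact c₂ hi hj
    | exact c₂ hj hi
    | exact c₃ hi hj
    | exact c₃ hj hi
    | exact c₄ hi hj
    | exact c₄ hj hi
    | exact c₅ hi hj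
    | exact c₅ hj hi

theorem cube_mem_commutator (hG : closure {x, y} = ⊤) (hx : x ^ 3 ∈ commutator G)
    (hy : y ^ 3 ∈ commutator G) (g : G) : g ^ 3 ∈ commutator G := by
  have : (powMonoidHom 3 : Abelianization G →* Abelianization G).ker.comap Abelianization.of
      = ⊤ := by
    rw [eq_top_iff, ← hG, closure_le]
    rintro g (rfl | rfl)
    · simpa [MonoidHom.mem_ker, ← map_pow, ← Abelianization.ker_of] using hx
    · simpa [MonoidHom.mem_ker, ← map_pow, ← Abelianization.ker_of] using hy
  have hg := this.ge (mem_top g)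
  simpa [MonoidHom.mem_ker, ← map_pow, ← Abelianization.ker_of] using hg

/-- Modulo G' every element is x^i y^j with exponents modulo 3, and the four subgroups are the four
lines of this plane over the field with three elements. -/
theorem exists_mem_maxSubgroup (hG : closure {x, y} = ⊤) (hx : x ^ 3 ∈ commutator G)
    (hy : y ^ 3 ∈ commutator G) (g : G) : ∃ i, g ∈ maxSubgroup x y i := by
  have hofx : Abelianization.of x ^ 3 = 1 := by
    rwa [← map_pow, ← MonoidHom.mem_ker, Abelianization.ker_of]
  have hofy : Abelianization.of y ^ 3 = 1 := by
    rwa [← map_pow, ← MonoidHom.mem_ker, Abelianization.ker_of]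
  obtain ⟨i, j, hg⟩ : ∃ i j : ℤ, Abelianization.of g =
      Abelianization.of x ^ i * Abelianization.of y ^ j := by
    have := congrArg (Subgroup.map Abelianization.of) hG
    rw [MonoidHom.map_closure, Set.image_pair, ← MonoidHom.range_eq_map,
      MonoidHom.range_eq_top.2 of_surjective] at this
    obtain ⟨i, j, h⟩ := mem_closure_pair.1 (this.ge (mem_top (Abelianization.of g)))
    exact ⟨i, j, h.symm⟩
  have hmem : ∀ (k : Fin 4) (l : ℤ), Abelianization.of g =
      Abelianization.of ((![y, x, x * y, x * y ^ 2] : Fin 4 → G) k) ^ l →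
      g ∈ maxSubgroup x y k := by
    intro k l hk
    rw [← map_zpow, ← mul_inv_eq_one, ← map_inv, ← map_mul, ← MonoidHom.mem_ker,
      Abelianization.ker_of] at hk
    have := commutator_le_maxSubgroup (x := x) (y := y) k hk
    exact ((maxSubgroup x y k).mul_mem_cancel_right
      (inv_mem (zpow_mem (mem_maxSubgroup k) l))).1 this
  have red : ∀ {q : Abelianization G}, q ^ 3 = 1 → ∀ {a b : ℤ}, (3 : ℤ) ∣ a - b →
      q ^ a = q ^ b := by
    rintro q hq a b ⟨c, hc⟩
    rw [show a = 3 * c + b by omega, zpow_add, zpow_mul, zpow_ofNat, hq, one_zpow, one_mul]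
  by_cases hi : (3 : ℤ) ∣ i
  · refine ⟨0, hmem 0 j ?_⟩
    rw [hg, red hofx (b := 0) (by simpa using hi), zpow_zero, one_mul]
    rfl
  by_cases hj : (3 : ℤ) ∣ j
  · refine ⟨1, hmem 1 i ?_⟩
    rw [hg, red hofy (b := 0) (by simpa using hj), zpow_zero, mul_one]
    rfl
  by_cases hd : (3 : ℤ) ∣ j - i
  · refine ⟨2, hmem 2 i ?_⟩
    rw [hg, red hofy hd, ← mul_zpow, ← map_mul]
    rfl
  · refine ⟨3, hmem 3 i ?_⟩
    have h2 : (3 : ℤ) ∣ j - 2 * i := by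
      have : i % 3 = 1 ∨ i % 3 = 2 := by omega
      have : j % 3 = 1 ∨ j % 3 = 2 := by omega
      omega
    rw [hg, red hofy h2, zpow_mul, ← mul_zpow, zpow_ofNat, ← map_pow,
      ← map_mul]
    rfl

variable [Finite G]

/-- The bounds |H_i| ≤ 3|G'| and |G| ≤ 3|H_i| are both sharp because |G| = 9|G'|. -/
theorem index_maxSubgroup (hG : closure {x, y} = ⊤) (hx : x ^ 3 ∈ commutator G)
    (hy : y ^ 3 ∈ commutator G) (hcard : Nat.card G = 9 * Nat.card (commutator G)) (i : Fin 4) :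
    (maxSubgroup x y i).index = 3 ∧
      Nat.card (maxSubgroup x y i) = 3 * Nat.card (commutator G) := by
  have hcube := cube_mem_commutator hG hx hy
  have hle : Nat.card (maxSubgroup x y i) ≤ 3 * Nat.card (commutator G) := by
    have := (finite_card_sup_zpowers (commutator G)
      (hcube ((![y, x, x * y, x * y ^ 2] : Fin 4 → G) i))).2
    rwa [zpowers_eq_closure, sup_comm] at this
  have := maxSubgroup_normal (x := x) (y := y) i
  obtain ⟨j, hj⟩ : ∃ j, j ≠ i := exists_ne i
  have htop : maxSubgroup x y i ⊔ zpowers ((![y, x, x * y, x * y ^ 2] : Fin 4 → G) j) = ⊤ :=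
    eq_top_of_mem_of_mem hj hG hy ((commutator_le_maxSubgroup i).trans le_sup_left)
      (mem_sup_right (mem_zpowers _)) (mem_sup_left (mem_maxSubgroup i))
  have hge := (finite_card_sup_zpowers (maxSubgroup x y i)
      (g := (![y, x, x * y, x * y ^ 2] : Fin 4 → G) j)
      (commutator_le_maxSubgroup i (hcube _))).2
  rw [htop, card_top] at hge
  have h₁ : Nat.card (maxSubgroup x y i) = 3 * Nat.card (commutator G) := by omega
  refine ⟨?_, h₁⟩
  have h₂ := card_mul_index (maxSubgroup x y i)
  rw [h₁, hcard] at h₂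
  have : 0 < Nat.card (commutator G) := Nat.card_pos
  exact Nat.eq_of_mul_eq_mul_left (by omega : 0 < 3 * Nat.card (commutator G)) (by omega)

theorem maxSubgroup_injective (hG : closure {x, y} = ⊤) (hx : x ^ 3 ∈ commutator G)
    (hy : y ^ 3 ∈ commutator G) (hcard : Nat.card G = 9 * Nat.card (commutator G)) :
    Function.Injective (maxSubgroup x y) := by
  intro i j h
  by_contra hij
  exact ne_top_of_index (index_maxSubgroup hG hx hy hcard i).1
    (eq_top_of_mem_of_mem hij hG hy (commutator_le_maxSubgroup i) (mem_maxSubgroup i)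
      (h ▸ mem_maxSubgroup j))

/-- In a nilpotent group a maximal subgroup M is normal, and G/M has nontrivial centre, so M ≥ G'.
An element of M outside G' lies in some H_i; then M ∩ H_i properly contains G', which has index
three in H_i, and M = H_i. -/
theorem range_maxSubgroup (hp : IsPGroup 3 G) (hG : closure {x, y} = ⊤)
    (hx : x ^ 3 ∈ commutator G) (hy : y ^ 3 ∈ commutator G)
    (hcard : Nat.card G = 9 * Nat.card (commutator G)) :
    Set.range (maxSubgroup x y) = {H : Subgroup G | IsCoatom H} := by
  have : Fact (Nat.Prime 3) := ⟨Nat.prime_three⟩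
  have hidx := index_maxSubgroup hG hx hy hcard
  have hpos : 0 < Nat.card (commutator G) := Nat.card_pos
  ext M
  constructor
  · rintro ⟨i, rfl⟩
    exact isCoatom_of_index (hidx i).1
  · intro hM
    have hnil := hp.isNilpotent
    have hMn : M.Normal := NormalizerCondition.normal_of_coatom M
      Group.normalizerCondition_of_isNilpotent hM
    have hGM : commutator G ≤ M := by
      have hnt : Nontrivial (G ⧸ M) := QuotientGroup.nontrivial_iff.2 hM.1
      have hc : (center (G ⧸ M)).comap (QuotientGroup.mk' M) = ⊤ := by
        refine hM.2 _ (lt_of_le_of_ne (fun g hg => ?_) fun h => ?_)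
        · have h1 : QuotientGroup.mk' M g = 1 := (QuotientGroup.eq_one_iff g).2 hg
          rw [mem_comap, h1]
          exact one_mem _
        · have h₁ := congrArg (Subgroup.map (QuotientGroup.mk' M)) h
          rw [map_comap_eq_self_of_surjective (QuotientGroup.mk'_surjective M)] at h₁
          have : M.map (QuotientGroup.mk' M) = ⊥ := by
            rw [Subgroup.map_eq_bot_iff, QuotientGroup.ker_mk']
          rw [this] at h₁
          exact Group.IsNilpotent.center_ne_bot (G ⧸ M) h₁.symm
      rw [_root_.commutator_def, commutator_le]
      intro g _ k _
      rw [← QuotientGroup.eq_one_iff]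
      change QuotientGroup.mk' M _ = 1
      rw [map_commutatorElement, commutatorElement_eq_one_iff_mul_comm]
      exact (mem_center_iff.1 (mem_comap.1 (hc.ge (mem_top g))) _).symm
    have hnle : ¬ M ≤ commutator G := fun hle => by
      have h₀ := isCoatom_of_index (hidx 0).1
      have h₁ : M = maxSubgroup x y 0 := by
        rcases hM.le_iff.1 (hle.trans (commutator_le_maxSubgroup 0)) with h | h
        · exact absurd h h₀.1
        · exact h.symm
      have := card_le_of_le hle
      rw [h₁, (hidx 0).2] at this
      omega
    obtain ⟨g, hgM, hg⟩ := SetLike.not_le_iff_exists.1 hnle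
    obtain ⟨i, hi⟩ := exists_mem_maxSubgroup hG hx hy g
    have hle₁ : commutator G ≤ maxSubgroup x y i ⊓ M := le_inf (commutator_le_maxSubgroup i) hGM
    obtain ⟨c, hc⟩ := card_dvd_of_le hle₁
    obtain ⟨d, hd⟩ := card_dvd_of_le (inf_le_left : maxSubgroup x y i ⊓ M ≤ _)
    rw [(hidx i).2, hc, mul_comm 3, mul_assoc] at hd
    have hcd := Nat.eq_of_mul_eq_mul_left hpos hd
    rcases (Nat.dvd_prime Nat.prime_three).1 ⟨d, hcd⟩ with rfl | rfl
    · rw [mul_one] at hc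
      have := eq_of_le_of_card_ge hle₁ hc.le
      exact absurd (this.ge ⟨hi, hgM⟩) hg
    · have := eq_of_le_of_card_ge (inf_le_left : maxSubgroup x y i ⊓ M ≤ _)
        (by rw [(hidx i).2, hc, mul_comm])
      refine ⟨i, ?_⟩
      rcases (isCoatom_of_index (hidx i).1).le_iff.1 (inf_eq_left.1 this) with h | h
      · exact absurd h hM.1
      · exact h.symm

end MaximalSubgroups

end CoclassOne

namespace CoclassOne

open Subgroup

/-! ### Commutator subgroups and cubes in H₁ and H₂. -/

namespace IsStandardPair

variable {G : Type*} [Group G] {m : ℕ} {a z w : ℤ} {x y : G}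

theorem closure_mul_left (hG : closure {x, y} = ⊤) : closure {x * y, y} = ⊤ := by
  rw [eq_top_iff, ← hG, closure_le]
  have hy : y ∈ closure {x * y, y} := subset_closure (by simp)
  rintro g (rfl | rfl)
  · exact (Subgroup.mul_mem_cancel_right _ hy).1 (subset_closure (by simp))
  · exact hy

theorem last_zpow_mem_tail (h : IsStandardPair m a z w x y) {j : ℕ} (hj : j ≤ 3) :
    iterComm x y (m + 1) ^ a ∈ tail x y j := by
  rcases Nat.lt_or_ge m 2 with hm | hm
  · rw [h.a_eq hm, zpow_zero]; exact one_mem _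
  · exact zpow_mem (iterComm_mem_tail (by omega)) _

theorem commutator_eq_tail (h : IsStandardPair m a z w x y) (hG : closure {x, y} = ⊤) :
    commutator G = tail x y 1 := by
  have := h.normal_tail hG 1
  refine le_antisymm ?_ ?_
  · rw [_root_.commutator_def, ← hG]
    have h1 : comm y x ∈ tail x y 1 := iterComm_mem_tail (k := 1) le_rfl
    refine commutator_closure_le ?_
    rintro g (rfl | rfl) k (rfl | rfl)
    · rw [comm_eq_one_iff.2 (Commute.refl _)]; exact one_mem _
    · rw [← comm_inv]; exact inv_mem h1
    · exact h1
    · rw [comm_eq_one_iff.2 (Commute.refl _)]; exact one_mem _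
  · rw [tail_le_iff]
    intro k hk
    obtain ⟨k, rfl⟩ := Nat.exists_eq_add_of_le' hk
    rw [iterComm_succ, comm_eq_commutatorElement, _root_.commutator_def]
    exact commutator_mem_commutator (mem_top _) (mem_top _)

/-- Together with `commutator_eq_tail` this identifies `tail x y j` with γ_{j+1}(G) for j ≥ 1. -/
theorem commutator_tail_top (h : IsStandardPair m a z w x y) (hG : closure {x, y} = ⊤) {j : ℕ}
    (hj : 1 ≤ j) : ⁅tail x y j, (⊤ : Subgroup G)⁆ = tail x y (j + 1) := by
  have := h.normal_tail hG (j + 1)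
  refine le_antisymm ?_ ?_
  · rw [← hG, tail]
    refine commutator_closure_le ?_
    rintro _ ⟨k, hk, rfl⟩ b (rfl | rfl)
    · exact iterComm_mem_tail (k := k + 1) (by omega)
    · rcases (hj.trans hk).eq_or_lt with rfl | hk'
      · obtain rfl : j = 1 := by omega
        rw [← comm_inv, h.y_one]
        exact inv_mem (h.last_zpow_mem_tail (by norm_num))
      · rw [comm_eq_one_iff.2 (h.y_ge k hk').symm]
        exact one_mem _
  · rw [tail_le_iff]
    intro k hk
    obtain ⟨k, rfl⟩ := Nat.exists_eq_add_of_le' (by omega : 1 ≤ k)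
    rw [iterComm_succ, comm_eq_commutatorElement]
    exact commutator_mem_commutator (inv_mem (iterComm_mem_tail (by omega))) (mem_top _)

theorem lowerCentralSeries_three (h : IsStandardPair m a z w x y) (hG : closure {x, y} = ⊤) :
    (⊤ : Subgroup G).lowerCentralSeries 3 = tail x y 3 := by
  rw [Subgroup.lowerCentralSeries_succ, Subgroup.lowerCentralSeries_succ, top_lowerCentralSeries_one,
    h.commutator_eq_tail hG, h.commutator_tail_top hG le_rfl,
    h.commutator_tail_top hG (by norm_num)]

theorem maxSubgroup_zero_eq (h : IsStandardPair m a z w x y) (hG : closure {x, y} = ⊤) :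
    maxSubgroup x y 0 = tail x y 0 := by
  rw [maxSubgroup_zero, h.commutator_eq_tail hG, tail_eq_sup x y 0]
  rfl

theorem maxSubgroup_one_eq (h : IsStandardPair m a z w x y) (hG : closure {x, y} = ⊤) :
    maxSubgroup x y 1 = tail x y 1 ⊔ zpowers x := by
  rw [maxSubgroup_one, h.commutator_eq_tail hG]

/-- The commutator subgroup of `H₁`. -/
theorem commutator_tail_zero (h : IsStandardPair m a z w x y) (hG : closure {x, y} = ⊤) :
    ⁅tail x y 0, tail x y 0⁆ = zpowers (iterComm x y (m + 1) ^ a) := by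
  have : (zpowers (iterComm x y (m + 1) ^ a)).Normal := by
    refine ⟨fun n hn g => ?_⟩
    have hle : zpowers (iterComm x y (m + 1) ^ a) ≤ center G :=
      zpowers_le.2 (zpow_mem (h.last_mem_center hG) _)
    rwa [mem_center_iff.1 (hle hn) g, mul_inv_cancel_right]
  have h01 : comm y (iterComm x y 1) ∈ zpowers (iterComm x y (m + 1) ^ a) := by
    rw [h.y_one]; exact mem_zpowers _
  have h0 : ∀ k, comm y (iterComm x y k) ∈ zpowers (iterComm x y (m + 1) ^ a) := fun k => by
    rcases Nat.lt_or_ge k 2 with hk | hk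
    · interval_cases k
      · rw [iterComm_zero, comm_eq_one_iff.2 (Commute.refl _)]; exact one_mem _
      · exact h01
    · rw [comm_eq_one_iff.2 (h.y_ge k hk)]; exact one_mem _
  refine le_antisymm ?_ (zpowers_le.2 ?_)
  · refine commutator_closure_le ?_
    rintro _ ⟨j, -, rfl⟩ _ ⟨k, -, rfl⟩
    rcases Nat.eq_zero_or_pos j with rfl | hj
    · exact h0 k
    rcases Nat.eq_zero_or_pos k with rfl | hk
    · rw [← comm_inv]; exact inv_mem (h0 j)
    · rw [comm_eq_one_iff.2 (h.commute_iterComm hj hk)]; exact one_mem _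
  · rw [← h.y_one, comm_eq_commutatorElement]
    exact commutator_mem_commutator (inv_mem (iterComm_mem_tail (k := 0) le_rfl))
      (inv_mem (iterComm_mem_tail (by norm_num)))

/-- The commutator subgroup of `H₂`. -/
theorem commutator_maxSubgroup_one (h : IsStandardPair m a z w x y) (hG : closure {x, y} = ⊤) :
    ⁅maxSubgroup x y 1, maxSubgroup x y 1⁆ = tail x y 2 := by
  have := h.normal_tail hG 2
  rw [h.maxSubgroup_one_eq hG]
  refine le_antisymm ?_ ?_
  · rw [tail, zpowers_eq_closure, ← Subgroup.closure_union]
    refine commutator_closure_le ?_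
    have hx : ∀ k, 1 ≤ k → comm (iterComm x y k) x ∈ tail x y 2 := fun k hk =>
      iterComm_mem_tail (k := k + 1) (by omega)
    rintro _ (⟨j, hj, rfl⟩ | rfl) _ (⟨k, hk, rfl⟩ | rfl)
    · rw [comm_eq_one_iff.2 (h.commute_iterComm hj hk)]; exact one_mem _
    · exact hx j hj
    · rw [← comm_inv]; exact inv_mem (hx k hk)
    · rw [comm_eq_one_iff.2 (Commute.refl _)]; exact one_mem _
  · rw [tail_le_iff]
    intro k hk
    obtain ⟨k, rfl⟩ := Nat.exists_eq_add_of_le' (by omega : 1 ≤ k)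
    rw [iterComm_succ, comm_eq_commutatorElement]
    exact commutator_mem_commutator
      (inv_mem (mem_sup_left (iterComm_mem_tail (by omega))))
      (inv_mem (mem_sup_right (mem_zpowers x)))

theorem commute_of_mem_tail_one (h : IsStandardPair m a z w x y) {g g' : G}
    (hg : g ∈ tail x y 1) (hg' : g' ∈ tail x y 1) : Commute g g' := by
  have h₁ : ∀ k, 1 ≤ k → iterComm x y k ∈ centralizer (tail x y 1 : Set G) := fun k hk => by
    have : tail x y 1 ≤ centralizer {iterComm x y k} :=
      tail_le_iff.2 fun j hj => mem_centralizer_singleton_iff.2 (h.commute_iterComm hj hk)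
    rw [mem_centralizer_iff]
    exact fun g hg => mem_centralizer_singleton_iff.1 (this hg)
  have h₂ : tail x y 1 ≤ centralizer (tail x y 1 : Set G) := tail_le_iff.2 h₁
  exact (mem_centralizer_iff.1 (h₂ hg) g' hg').symm

/-- The trace under x is multiplicative on the abelian group `tail x y 1`, and on t_k it equals t_k³
t_{k+1}³ t_{k+2}, which a cubing relation makes trivial. -/
theorem trace_eq_one (h : IsStandardPair m a z w x y) {g : G} (hg : g ∈ tail x y 1) :
    conjBy x (conjBy x g) * conjBy x g * g = 1 := by
  have mem : ∀ {g}, g ∈ tail x y 1 → conjBy x g ∈ tail x y 1 := fun hg => h.conjBy_mem_tail hg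
  rw [tail] at hg
  induction hg using closure_induction with
  | mem g hg =>
    obtain ⟨k, hk, rfl⟩ := hg
    rw [conjBy_iterComm, map_mul, conjBy_iterComm, conjBy_iterComm, ← h.t_cube k hk]
    have c₁ := h.commute_iterComm hk (by omega : 1 ≤ k + 1)
    have c₂ := h.commute_iterComm hk (by omega : 1 ≤ k + 2)
    have c₃ := h.commute_iterComm (by omega : 1 ≤ k + 1) (by omega : 1 ≤ k + 2)
    change _ * (iterComm x y (k + 1) * iterComm x y (k + 2)) * _ * _ = _
    generalize iterComm x y k = p at *
    generalize iterComm x y (k + 1) = q at *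
    generalize iterComm x y (k + 2) = r at *
    have c₁' (s : G) : q * (p * s) = p * (q * s) := by rw [← mul_assoc, ← c₁.eq, mul_assoc]
    have c₂' (s : G) : r * (p * s) = p * (r * s) := by rw [← mul_assoc, ← c₂.eq, mul_assoc]
    simp only [pow_succ, pow_zero, one_mul, mul_assoc, c₁', c₂', ← c₂.eq, ← c₃.eq]
  | one => simp
  | mul g k hg hk ihg ihk =>
    have hg' : g ∈ tail x y 1 := hg
    have hk' : k ∈ tail x y 1 := hk
    have c₁ := h.commute_of_mem_tail_one (mem (mem hk')) (mem hg')
    have c₂ := h.commute_of_mem_tail_one (mem (mem hk')) hg'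
    have c₃ := h.commute_of_mem_tail_one (mem hk') hg'
    have : conjBy x (conjBy x (g * k)) * conjBy x (g * k) * (g * k) =
        (conjBy x (conjBy x g) * conjBy x g * g) * (conjBy x (conjBy x k) * conjBy x k * k) := by
      simp only [map_mul]
      generalize conjBy x (conjBy x g) = g₂ at *
      generalize conjBy x (conjBy x k) = k₂ at *
      generalize conjBy x g = g₁ at *
      generalize conjBy x k = k₁ at *
      have c₁' (s : G) : k₂ * (g₁ * s) = g₁ * (k₂ * s) := by rw [← mul_assoc, c₁.eq, mul_assoc]
      have c₂' (s : G) : k₂ * (g * s) = g * (k₂ * s) := by rw [← mul_assoc, c₂.eq, mul_assoc]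
      have c₃' (s : G) : k₁ * (g * s) = g * (k₁ * s) := by rw [← mul_assoc, c₃.eq, mul_assoc]
      simp only [mul_assoc, c₁', c₂', c₃']
    rw [this, ihg, ihk, one_mul]
  | inv g hg ih =>
    have hg' : g ∈ tail x y 1 := hg
    have c₁ := h.commute_of_mem_tail_one (mem (mem hg')) (mem hg')
    have c₂ := h.commute_of_mem_tail_one (mem (mem hg')) hg'
    have c₃ := h.commute_of_mem_tail_one (mem hg') hg'
    rw [← inv_inj, inv_one, ← ih]
    simp only [map_inv, mul_inv_rev, inv_inv]
    rw [← mul_assoc, ← c₃.eq, mul_assoc, ← c₂.eq, ← mul_assoc, ← c₁.eq]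

theorem mul_cube_of_mem (h : IsStandardPair m a z w x y) {g : G} (hg : g ∈ tail x y 1) :
    (x * g) ^ 3 = x ^ 3 := by
  have := h.trace_eq_one hg
  simp only [conjBy_apply] at this
  rw [conj_cube, this, mul_one]

/-- Cubes of the elements of `H₂` outside of `G'`. -/
theorem cube_eq_or (h : IsStandardPair m a z w x y) (hG : closure {x, y} = ⊤) {g : G}
    (hg : g ∈ maxSubgroup x y 1) (hg' : g ∉ tail x y 1) : g ^ 3 = x ^ 3 ∨ g ^ 3 = (x ^ 3)⁻¹ := by
  have hN := h.normal_tail hG 1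
  have hx3 : x ^ 3 ∈ tail x y 1 := h.x_cube_mem (by omega)
  rw [h.maxSubgroup_one_eq hG] at hg
  obtain ⟨k, hk, _, hi, rfl⟩ := mem_sup_of_normal_left.1 hg
  obtain ⟨i, rfl⟩ := mem_zpowers_iff.1 hi
  have hx (j : ℤ) : x ^ (3 * j) ∈ tail x y 1 := by
    rw [zpow_mul, zpow_ofNat]; exact zpow_mem hx3 j
  obtain ⟨j, hj⟩ : ∃ j, i = 3 * j ∨ i = 3 * j + 1 ∨ i = 3 * j - 1 := by
    have : i % 3 = 0 ∨ i % 3 = 1 ∨ i % 3 = 2 := by omega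
    rcases this with h | h | h
    · exact ⟨i / 3, by omega⟩
    · exact ⟨i / 3, by omega⟩
    · exact ⟨i / 3 + 1, by omega⟩
  rcases hj with rfl | rfl | rfl
  · exact absurd (mul_mem hk (hx j)) hg'
  · left
    have e : k * x ^ (3 * j + 1) = x * (x⁻¹ * (k * x ^ (3 * j)) * x⁻¹⁻¹) := by
      rw [zpow_add_one]; simp [mul_assoc]
    rw [e, h.mul_cube_of_mem (hN.conj_mem _ (mul_mem hk (hx j)) x⁻¹)]
  · right
    have e : (k * x ^ (3 * j - 1))⁻¹ = x * ((x ^ (3 * j))⁻¹ * k⁻¹) := by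
      have c : Commute x ((x ^ (3 * j))⁻¹) := ((Commute.refl x).zpow_right _).inv_right
      rw [zpow_sub_one, mul_inv_rev, mul_inv_rev, inv_inv, mul_assoc]
    rw [← inv_inj, inv_inv, ← inv_pow, e,
      h.mul_cube_of_mem (mul_mem (inv_mem (hx j)) (inv_mem hk))]

/-- Cubing is a homomorphism on `H₁`. -/
theorem mul_cube_of_mem_zero (h : IsStandardPair m a z w x y) (hG : closure {x, y} = ⊤) {g k : G}
    (hg : g ∈ tail x y 0) (hk : k ∈ tail x y 0) : (g * k) ^ 3 = g ^ 3 * k ^ 3 := by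
  have hc : comm k g ∈ zpowers (iterComm x y (m + 1) ^ a) := by
    rw [← h.commutator_tail_zero hG, comm_eq_commutatorElement]
    exact commutator_mem_commutator (inv_mem hk) (inv_mem hg)
  obtain ⟨i, hi⟩ := mem_zpowers_iff.1 hc
  rw [← zpow_mul] at hi
  have hz : comm k g ∈ center G := hi ▸ zpow_mem (h.last_mem_center hG) _
  have h3 : comm k g ^ 3 = 1 := by
    rw [← hi, ← zpow_natCast, zpow_comm, zpow_natCast, h.last_cube, one_zpow]
  rw [mul_cube (mul_eq_mul_comm k g) (commute_of_mem_center hz g) (commute_of_mem_center hz k),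
    h3, mul_one]

/-- All cubes lie in the third term of the lower central series, if `m ≥ 1`. -/
theorem cube_mem_tail_two (h : IsStandardPair m a z w x y) (hG : closure {x, y} = ⊤)
    (hm : 1 ≤ m) (g : G) : g ^ 3 ∈ tail x y 2 := by
  have hN := h.normal_tail hG 2
  have hmk (g : G) : g ^ 3 ∈ tail x y 2 ↔ QuotientGroup.mk' (tail x y 2) g ^ 3 = 1 := by
    rw [← map_pow]; exact (QuotientGroup.eq_one_iff _).symm
  have h1 : ∀ c ∈ tail x y 1, c ^ 3 ∈ tail x y 2 := by
    intro c hc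
    rw [tail_eq_sup] at hc
    obtain ⟨p, hp, _, hi, rfl⟩ := mem_sup_of_normal_left.1 hc
    obtain ⟨i, rfl⟩ := mem_zpowers_iff.1 hi
    have hcomm := h.commute_of_mem_tail_one (tail_anti (by norm_num) hp)
      (zpow_mem (iterComm_mem_tail (x := x) (y := y) (j := 1) le_rfl) i)
    rw [hcomm.mul_pow, ← zpow_natCast _ 3, ← zpow_natCast _ 3, zpow_comm, zpow_natCast,
      zpow_natCast]
    exact mul_mem (pow_mem hp 3) (zpow_mem (h.cube_mem_tail 1) i)
  have hyx : y ^ 3 ∈ tail x y 2 := by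
    have h₁ : y ^ 3 * iterComm x y 1 ^ 3 * iterComm x y 2 ∈ tail x y 2 := by
      rw [h.y_cube]
      exact zpow_mem (iterComm_mem_tail (by omega)) _
    rw [Subgroup.mul_mem_cancel_right _ (iterComm_mem_tail le_rfl),
      Subgroup.mul_mem_cancel_right _ (h.cube_mem_tail 1)] at h₁
    exact h₁
  -- Modulo `tail x y 2` commutators are central with trivial cube, so cubing is multiplicative
  -- there.
  have hmul : ∀ g k : G, g ^ 3 ∈ tail x y 2 → k ^ 3 ∈ tail x y 2 → (g * k) ^ 3 ∈ tail x y 2 := by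
    intro g k hg hk
    have hc : comm k g ∈ tail x y 1 := by
      rw [← h.commutator_eq_tail hG, comm_eq_commutatorElement, _root_.commutator_def]
      exact commutator_mem_commutator (mem_top _) (mem_top _)
    have hcen : ∀ r : G, Commute (QuotientGroup.mk' (tail x y 2) (comm k g))
        (QuotientGroup.mk' (tail x y 2) r) := fun r => by
      rw [← comm_eq_one_iff, ← map_comm]
      refine (QuotientGroup.eq_one_iff _).2 ?_
      rw [← h.commutator_tail_top hG le_rfl, comm_eq_commutatorElement]
      exact commutator_mem_commutator (inv_mem hc) (mem_top _)
    have e := congrArg (QuotientGroup.mk' (tail x y 2)) (mul_eq_mul_comm k g)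
    rw [map_mul, map_mul, map_mul] at e
    rw [hmk, map_mul, mul_cube e (hcen g) (hcen k), (hmk g).1 hg, (hmk k).1 hk,
      (hmk _).1 (h1 _ hc), one_mul, one_mul]
  have hg : g ∈ closure {x, y} := hG ▸ mem_top g
  induction hg using closure_induction with
  | mem g hg =>
    rcases hg with rfl | rfl
    · exact h.x_cube_mem (by omega)
    · exact hyx
  | one => rw [one_pow]; exact one_mem _
  | mul g k _ _ hg hk => exact hmul g k hg hk
  | inv g _ hg => rw [inv_pow]; exact inv_mem hg

theorem card_commutator (h : IsStandardPair m a z w x y) (hG : closure {x, y} = ⊤)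
    (hcard : Nat.card G = 3 ^ (m + 3)) : Nat.card (commutator G) = 3 ^ (m + 1) := by
  rw [h.commutator_eq_tail hG, h.card_tail hG hcard (i := m + 1) (by omega)]

theorem card_eq_nine_mul (h : IsStandardPair m a z w x y) (hG : closure {x, y} = ⊤)
    (hcard : Nat.card G = 3 ^ (m + 3)) : Nat.card G = 9 * Nat.card (commutator G) := by
  rw [h.card_commutator hG hcard, hcard]; ring

end IsStandardPair

end CoclassOne

namespace CoclassOne

open Subgroup

section DeepTransfer

variable {G : Type*} [Group G] [Finite G] {H : Subgroup G}

/-- The transfer `H → G'/G''`. -/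
noncomputable def deepTransfer (H : Subgroup G) :
    H →* Abelianization ((commutator G).subgroupOf H) :=
  MonoidHom.transfer Abelianization.of

theorem index_commutator_subgroupOf (hle : commutator G ≤ H)
    (hcard : Nat.card H = 3 * Nat.card (commutator G)) :
    ((commutator G).subgroupOf H).index = 3 := by
  have h₁ := card_mul_index ((commutator G).subgroupOf H)
  rw [Nat.card_congr (subgroupOfEquivOfLe hle).toEquiv, hcard, mul_comm] at h₁
  exact Nat.eq_of_mul_eq_mul_right Nat.card_pos h₁

theorem deepTransfer_eq_one_iff (hle : commutator G ≤ H)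
    (hcard : Nat.card H = 3 * Nat.card (commutator G))
    (hab : ∀ g ∈ commutator G, ∀ k ∈ commutator G, Commute g k) {g : H}
    (hg : (g : G) ∉ commutator G) : deepTransfer H g = 1 ↔ (g : G) ^ 3 = 1 := by
  have hidx := index_commutator_subgroupOf hle hcard
  have hbot : ⁅(commutator G).subgroupOf H, (commutator G).subgroupOf H⁆ = ⊥ := by
    rw [commutator_eq_bot_iff_le_centralizer]
    intro k hk
    rw [mem_centralizer_iff]
    exact fun l hl => Subtype.ext (hab l hl k hk)
  rw [deepTransfer, transfer_eq_of_notMem Nat.prime_three hidx _ hg (pow_index_mem hidx g),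
    of_eq_one_iff, hbot, mem_bot, Subtype.ext_iff]
  rfl

theorem card_ker_artinTransfer_mul (H : Subgroup G) :
    Nat.card (artinTransfer ((commutator G).subgroupOf H)).ker * Nat.card (⁅H, H⁆ : Subgroup G) =
      Nat.card (deepTransfer H).ker := by
  rw [← card_commutator_subgroup]
  exact card_ker_lift _

theorem ker_deepTransfer_eq_top (hle : commutator G ≤ H)
    (hcard : Nat.card H = 3 * Nat.card (commutator G))
    (hab : ∀ g ∈ commutator G, ∀ k ∈ commutator G, Commute g k)
    (h : ∀ g ∈ H, g ∉ commutator G → g ^ 3 = 1) : (deepTransfer H).ker = ⊤ :=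
  eq_top_of_forall_notMem (ne_top_of_index (index_commutator_subgroupOf hle hcard)) fun g hg =>
    (deepTransfer_eq_one_iff hle hcard hab hg).2 (h g g.2 hg)

/-- Off G' the transfer is cubing and never vanishes. On G' it is trivial, because xk and x have the
same cube and so the same image. -/
theorem ker_deepTransfer_eq_subgroupOf (hle : commutator G ≤ H)
    (hcard : Nat.card H = 3 * Nat.card (commutator G))
    (hab : ∀ g ∈ commutator G, ∀ k ∈ commutator G, Commute g k)
    (h : ∀ g ∈ H, g ∉ commutator G → g ^ 3 ≠ 1) {x : G} (hx : x ∈ H) (hx' : x ∉ commutator G)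
    (hxk : ∀ k ∈ commutator G, (x * k) ^ 3 = x ^ 3) :
    (deepTransfer H).ker = (commutator G).subgroupOf H := by
  have hidx := index_commutator_subgroupOf hle hcard
  refine le_antisymm (fun g hg => ?_) fun k hk => ?_
  · by_contra hg'
    exact h g g.2 hg' ((deepTransfer_eq_one_iff hle hcard hab hg').1 hg)
  · have hxk' : (⟨x, hx⟩ * k : H) ∉ (commutator G).subgroupOf H := fun h' =>
      hx' ((Subgroup.mul_mem_cancel_right _ hk).1 h')
    have e : deepTransfer H (⟨x, hx⟩ * k) = deepTransfer H ⟨x, hx⟩ := by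
      rw [deepTransfer, transfer_eq_of_notMem Nat.prime_three hidx _ hxk' (pow_index_mem hidx _),
        transfer_eq_of_notMem Nat.prime_three hidx _ (g := ⟨x, hx⟩) hx' (pow_index_mem hidx _)]
      congr 1
      exact Subtype.ext (Subtype.ext (hxk k hk))
    rwa [map_mul, mul_eq_left] at e

/-- If cubing is a homomorphism on H, it agrees with the transfer outside G', and therefore
everywhere. -/
theorem mem_ker_deepTransfer_iff (hle : commutator G ≤ H)
    (hcard : Nat.card H = 3 * Nat.card (commutator G))
    (hab : ∀ g ∈ commutator G, ∀ k ∈ commutator G, Commute g k) (f : H →* G)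
    (hf : ∀ g : H, f g = (g : G) ^ 3) : (deepTransfer H).ker = f.ker := by
  have hidx := index_commutator_subgroupOf hle hcard
  have hf' : ∀ g, f g ∈ commutator G := fun g => by
    rw [hf]; exact pow_index_mem hidx g
  let f' : H →* (commutator G).subgroupOf H :=
    { toFun := fun g => ⟨⟨f g, hle (hf' g)⟩, hf' g⟩
      map_one' := by simp
      map_mul' := fun g k => Subtype.ext (Subtype.ext (map_mul f g k)) }
  have heq : deepTransfer H = Abelianization.of.comp f' := by
    have : MonoidHom.eqLocus (deepTransfer H) (Abelianization.of.comp f') = ⊤ := by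
      refine eq_top_of_forall_notMem (ne_top_of_index hidx) fun g hg => ?_
      change deepTransfer H g = Abelianization.of (f' g)
      rw [deepTransfer, transfer_eq_of_notMem Nat.prime_three hidx _ hg (pow_index_mem hidx g)]
      congr 1
      exact Subtype.ext (Subtype.ext (hf g).symm)
    exact MonoidHom.ext fun g => this.ge (mem_top g)
  have hbot : ⁅(commutator G).subgroupOf H, (commutator G).subgroupOf H⁆ = ⊥ := by
    rw [commutator_eq_bot_iff_le_centralizer]
    intro k hk
    rw [mem_centralizer_iff]
    exact fun l hl => Subtype.ext (hab l hl k hk)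
  ext g
  rw [heq, MonoidHom.mem_ker, MonoidHom.mem_ker, MonoidHom.comp_apply, of_eq_one_iff, hbot,
    mem_bot, Subtype.ext_iff]
  rfl

end DeepTransfer

/-! ### Transfer kernels of a standard pair. -/

namespace IsStandardPair

variable {G : Type*} [Group G] {m : ℕ} {a z w : ℤ} {x y : G}

theorem x_cube_mem_commutator (h : IsStandardPair m a z w x y) (hG : closure {x, y} = ⊤) :
    x ^ 3 ∈ commutator G := by
  rw [h.commutator_eq_tail hG]; exact h.x_cube_mem (by omega)

theorem y_cube_mem_commutator (h : IsStandardPair m a z w x y) (hG : closure {x, y} = ⊤) :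
    y ^ 3 ∈ commutator G := by
  rw [h.commutator_eq_tail hG]; exact h.cube_mem_tail 0

theorem orderOf_last (h : IsStandardPair m a z w x y) (hG : closure {x, y} = ⊤)
    (hcard : Nat.card G = 3 ^ (m + 3)) : orderOf (iterComm x y (m + 1)) = 3 := by
  refine orderOf_eq_prime h.last_cube fun h1 => ?_
  have := h.card_tail hG hcard (i := 1) (j := m + 1) (by omega)
  rw [tail_eq_bot h1] at this
  simp at this

theorem last_zpow_eq_one_iff (h : IsStandardPair m a z w x y) (hG : closure {x, y} = ⊤)
    (hcard : Nat.card G = 3 ^ (m + 3)) (i : ℤ) :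
    iterComm x y (m + 1) ^ i = 1 ↔ (3 : ℤ) ∣ i := by
  rw [← orderOf_dvd_iff_zpow_eq_one, h.orderOf_last hG hcard]; rfl

theorem commute_of_mem_commutator (h : IsStandardPair m a z w x y) (hG : closure {x, y} = ⊤) :
    ∀ g ∈ commutator G, ∀ k ∈ commutator G, Commute g k := by
  rw [h.commutator_eq_tail hG]
  exact fun g hg k hk => h.commute_of_mem_tail_one hg hk

/-- The range of the cubing homomorphism on `H₁`. -/
theorem exists_cube_hom (h : IsStandardPair m a z w x y) (hG : closure {x, y} = ⊤) :
    ∃ f : maxSubgroup x y 0 →* G, (∀ g, f g = (g : G) ^ 3) ∧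
      (m = 0 ∨ m = 1 → (z - (m : ℤ)) ≡ 0 [ZMOD 3] → f.range = ⊥) ∧
      ((m = 0 → z ≡ 0 [ZMOD 3]) → (m = 1 → ¬ z ≡ 1 [ZMOD 3]) → f.range = tail x y 2) := by
  have h0 := h.maxSubgroup_zero_eq hG
  let f : maxSubgroup x y 0 →* G :=
    { toFun := fun g => (g : G) ^ 3
      map_one' := by simp
      map_mul' := fun g k => h.mul_cube_of_mem_zero hG (h0 ▸ g.2) (h0 ▸ k.2) }
  have hmem : ∀ {L : Subgroup G}, f.range ≤ L ↔ ∀ k, iterComm x y k ^ 3 ∈ L := by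
    intro L
    constructor
    · exact fun hL k => hL ⟨⟨iterComm x y k, h0 ▸ iterComm_mem_tail (Nat.zero_le k)⟩, rfl⟩
    · rintro hL _ ⟨⟨g, hg⟩, rfl⟩
      have hle : maxSubgroup x y 0 ≤ (L.comap f).map (maxSubgroup x y 0).subtype := by
        refine h0.le.trans (tail_le_iff.2 fun k _ => ?_)
        exact ⟨⟨iterComm x y k, h0 ▸ iterComm_mem_tail (Nat.zero_le k)⟩, hL k, rfl⟩
      obtain ⟨k, hk, hk'⟩ := hle hg
      have : k = ⟨g, hg⟩ := Subtype.ext hk'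
      rwa [← this]
  have hr : ∀ k, iterComm x y k ^ 3 ∈ f.range := hmem.1 le_rfl
  -- Up to t_1³, the cube of y is ζ^z t_2⁻¹: this is t_1^z for m = 0 and t_2^(z-1) for m = 1, whence
  -- the conditions on z; for m ≥ 2 it provides t_2 modulo the later terms.
  have hy : ∀ {L : Subgroup G}, iterComm x y 1 ^ 3 ∈ L → (y ^ 3 ∈ L ↔
      iterComm x y (m + 1) ^ z * (iterComm x y 2)⁻¹ ∈ L) := by
    intro L hL
    rw [← h.y_cube, mul_inv_cancel_right, Subgroup.mul_mem_cancel_right _ hL]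
  refine ⟨f, fun g => rfl, fun hm hz => ?_, fun hm0 hm1 => ?_⟩
  · rw [eq_bot_iff, hmem]
    have h1 : ∀ k, 1 ≤ k → iterComm x y k ^ 3 = 1 := by
      intro k hk
      rcases Nat.lt_or_ge k (m + 2) with hk2 | hk2
      · rcases Nat.lt_or_ge k (m + 1) with hk3 | hk3
        · obtain ⟨rfl, rfl⟩ : m = 1 ∧ k = 1 := by omega
          have := h.t_cube 1 le_rfl
          rw [h.last_cube, h.last, mul_one, mul_one] at this
          exact this
        · obtain rfl : k = m + 1 := by omega
          exact h.last_cube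
      · rw [h.eq_one hk2, one_pow]
    intro k
    rw [mem_bot]
    rcases Nat.eq_zero_or_pos k with rfl | hk
    · have hyc := h.y_cube
      rw [h1 1 le_rfl, mul_one] at hyc
      rw [iterComm_zero]
      rcases hm with rfl | rfl
      · rw [show iterComm x y 2 = 1 from h.last, mul_one] at hyc
        rw [hyc, h.last_zpow_eq (j := 0) (by simpa using hz), zpow_zero]
      · have hz1 : z ≡ 1 [ZMOD 3] := by
          have := hz.add_right 1
          simpa using this
        rw [h.last_zpow_eq hz1, zpow_one] at hyc
        exact mul_eq_right.1 hyc
    · exact h1 k hk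
  · refine le_antisymm (hmem.2 fun k => ?_) (tail_le_iff.2 fun k hk => ?_)
    · rcases Nat.eq_zero_or_pos k with rfl | hk
      · rw [iterComm_zero, hy (h.cube_mem_tail 1)]
        refine mul_mem ?_ (inv_mem (iterComm_mem_tail le_rfl))
        rcases Nat.eq_zero_or_pos m with rfl | hm
        · rw [h.last_zpow_eq (hm0 rfl), zpow_zero]; exact one_mem _
        · exact zpow_mem (iterComm_mem_tail (by omega)) _
      · exact tail_anti (by omega) (h.cube_mem_tail k)
    -- The cubing relations exhibit t_k, k ≥ 3, as products of cubes of elements of H₁ and their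
    -- inverses.
    · have h3 : ∀ k, 3 ≤ k → iterComm x y k ∈ f.range := by
        intro k hk
        obtain ⟨k, rfl⟩ := Nat.exists_eq_add_of_le' (by omega : 2 ≤ k)
        have := h.t_cube k (by omega)
        refine (Subgroup.mul_mem_cancel_left _ (mul_mem (hr k) (hr (k + 1)))).1 ?_
        rw [this]; exact one_mem _
      rcases hk.eq_or_lt with rfl | hk
      · have h₁ : iterComm x y (m + 1) ^ z * (iterComm x y 2)⁻¹ ∈ f.range :=
          (hy (hr 1)).1 (hr 0)
        rcases Nat.lt_or_ge m 2 with hm | hm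
        · obtain rfl | rfl : m = 0 ∨ m = 1 := by omega
          · rw [show iterComm x y 2 = 1 from h.last]; exact one_mem _
          · have hz := hm1 rfl
            have h₁' : iterComm x y 2 ^ (z - 1) ∈ f.range := by
              rw [zpow_sub_one]; exact h₁
            have hz' : z % 3 = 0 ∨ z % 3 = 2 := by
              rw [Int.ModEq] at hz
              omega
            rcases hz' with hz' | hz'
            · have e := h.last_zpow_eq (i := z - 1) (j := -1)
                (Int.modEq_iff_dvd.2 (by omega))
              rw [show iterComm x y 2 ^ (z - 1) = _ from e, zpow_neg_one, inv_mem_iff] at h₁'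
              exact h₁'
            · have e := h.last_zpow_eq (i := z - 1) (j := 1)
                (Int.modEq_iff_dvd.2 (by omega))
              rw [show iterComm x y 2 ^ (z - 1) = _ from e, zpow_one] at h₁'
              exact h₁'
        · rwa [Subgroup.mul_mem_cancel_left _ (zpow_mem (h3 _ (by omega)) _), inv_mem_iff] at h₁
      · exact h3 k hk

variable [Finite G]

theorem index_card_maxSubgroup (h : IsStandardPair m a z w x y) (hG : closure {x, y} = ⊤)
    (hcard : Nat.card G = 3 ^ (m + 3)) (i : Fin 4) :
    (maxSubgroup x y i).index = 3 ∧
      Nat.card (maxSubgroup x y i) = 3 * Nat.card (commutator G) :=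
  index_maxSubgroup hG (h.x_cube_mem_commutator hG) (h.y_cube_mem_commutator hG)
    (h.card_eq_nine_mul hG hcard) i

theorem injective_maxSubgroup (h : IsStandardPair m a z w x y) (hG : closure {x, y} = ⊤)
    (hcard : Nat.card G = 3 ^ (m + 3)) : Function.Injective (maxSubgroup x y) :=
  maxSubgroup_injective hG (h.x_cube_mem_commutator hG) (h.y_cube_mem_commutator hG)
    (h.card_eq_nine_mul hG hcard)

theorem notMem_maxSubgroup (h : IsStandardPair m a z w x y) (hG : closure {x, y} = ⊤)
    (hcard : Nat.card G = 3 ^ (m + 3)) {i j : Fin 4} (hij : i ≠ j) :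
    (![y, x, x * y, x * y ^ 2] : Fin 4 → G) i ∉ maxSubgroup x y j := fun hi =>
  ne_top_of_index (h.index_card_maxSubgroup hG hcard j).1
    (eq_top_of_mem_of_mem hij hG (h.y_cube_mem_commutator hG) (commutator_le_maxSubgroup j) hi
      (mem_maxSubgroup j))

/-- `H₁` is the two-step centralizer. -/
theorem coe_maxSubgroup_zero (h : IsStandardPair m a z w x y) (hG : closure {x, y} = ⊤)
    (hcard : Nat.card G = 3 ^ (m + 3)) (hm : 1 ≤ m) :
    (maxSubgroup x y 0 : Set G) = twoStepCentralizer G := by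
  have hN := h.normal_tail hG 3
  let C : Subgroup G := (centralizer
    (QuotientGroup.mk' (tail x y 3) '' (tail x y 1 : Set G))).comap (QuotientGroup.mk' (tail x y 3))
  have hC : ∀ g, g ∈ C ↔ ∀ k ∈ tail x y 1, comm g k ∈ tail x y 3 := by
    intro g
    rw [mem_comap, mem_centralizer_iff]
    have : ∀ k, comm g k ∈ tail x y 3 ↔ QuotientGroup.mk' (tail x y 3) k *
        QuotientGroup.mk' (tail x y 3) g =
        QuotientGroup.mk' (tail x y 3) g * QuotientGroup.mk' (tail x y 3) k := fun k => by
      rw [← QuotientGroup.eq_one_iff]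
      change QuotientGroup.mk' (tail x y 3) (comm g k) = 1 ↔ _
      rw [map_comm, comm_eq_one_iff]
      exact eq_comm
    simp only [this, Set.forall_mem_image, SetLike.mem_coe]
  have hset : twoStepCentralizer G = (C : Set G) := by
    ext g
    rw [SetLike.mem_coe, hC, twoStepCentralizer, Set.mem_ofPred_eq, h.commutator_eq_tail hG,
      h.lowerCentralSeries_three hG]
  have hle : maxSubgroup x y 0 ≤ C := fun g hg => by
    rw [h.maxSubgroup_zero_eq hG] at hg
    rw [hC]
    intro k hk
    have : comm g k ∈ ⁅tail x y 0, tail x y 0⁆ := by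
      rw [comm_eq_commutatorElement]
      exact commutator_mem_commutator (inv_mem hg) (inv_mem (tail_anti (by norm_num) hk))
    rw [h.commutator_tail_zero hG] at this
    exact zpowers_le.2 (h.last_zpow_mem_tail le_rfl) this
  rw [hset, SetLike.coe_set_eq]
  rcases (isCoatom_of_index (h.index_card_maxSubgroup hG hcard 0).1).le_iff.1 hle with h' | h'
  -- If x centralized G' modulo γ₄(G), then t_2 would lie in `tail x y 3`, and the chain would lose
  -- a step.
  · exfalso
    have h₁ := (hC x).1 (h' ▸ mem_top x) _ (iterComm_mem_tail (k := 1) le_rfl)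
    rw [← comm_inv, inv_mem_iff] at h₁
    have h₂ : tail x y 2 ≤ tail x y 3 := by
      rw [tail_eq_sup x y 2]
      exact sup_le le_rfl (zpowers_le.2 h₁)
    have h₃ := card_le_of_le h₂
    obtain ⟨m, rfl⟩ := Nat.exists_eq_add_of_le' hm
    rw [h.card_tail hG hcard (i := m + 1) (by omega),
      h.card_tail hG hcard (i := m) (by omega)] at h₃
    exact absurd h₃ (not_le.2 (Nat.pow_lt_pow_right (by norm_num) (by omega)))
  · exact h'.symm

/-! ### Deep transfers -/

/-- The deep transfer kernel of `H₂`. -/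
theorem deepTKT_one (h : IsStandardPair m a z w x y) (hG : closure {x, y} = ⊤)
    (hcard : Nat.card G = 3 ^ (m + 3)) : deepTKT x y 1 = if (3 : ℤ) ∣ w then 9 else 3 := by
  have hle := commutator_le_maxSubgroup (x := x) (y := y) 1
  have hM := (h.index_card_maxSubgroup hG hcard 1).2
  have hab := h.commute_of_mem_commutator hG
  have hcom := h.commutator_eq_tail hG
  have hmul := card_ker_artinTransfer_mul (maxSubgroup x y 1)
  rw [h.commutator_maxSubgroup_one hG, h.card_tail hG hcard (i := m) (by omega)] at hmul
  have hw := h.last_zpow_eq_one_iff hG hcard w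
  rw [← h.x_cube] at hw
  have hpos : 0 < 3 ^ m := by positivity
  refine Nat.eq_of_mul_eq_mul_right hpos (hmul.trans ?_)
  split_ifs with h3
  · rw [ker_deepTransfer_eq_top hle hM hab, card_top, hM, h.card_commutator hG hcard]
    · ring
    · intro g hg hg'
      rw [hcom] at hg'
      rcases h.cube_eq_or hG hg hg' with e | e
      · rw [e, hw.2 h3]
      · rw [e, hw.2 h3, inv_one]
  · rw [ker_deepTransfer_eq_subgroupOf hle hM hab (x := x) ?_ (mem_maxSubgroup 1)
      (fun hx => h.notMem_maxSubgroup hG hcard (by decide : (1 : Fin 4) ≠ 0)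
        (commutator_le_maxSubgroup 0 hx)) ?_,
      Nat.card_congr (subgroupOfEquivOfLe hle).toEquiv, h.card_commutator hG hcard]
    · ring
    · intro g hg hg' hg3
      rw [hcom] at hg'
      rcases h.cube_eq_or hG hg hg' with e | e
      · exact h3 (hw.1 (e ▸ hg3))
      · exact h3 (hw.1 (inv_eq_one.1 (e ▸ hg3)))
    · intro k hk
      exact h.mul_cube_of_mem (hcom ▸ hk)

theorem deepTKT_two (h : IsStandardPair m a z w x y) (hG : closure {x, y} = ⊤)
    (hcard : Nat.card G = 3 ^ (m + 3)) :
    deepTKT x y 2 = if (3 : ℤ) ∣ w + z - 5 * a then 9 else 3 :=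
  h.mul_left.deepTKT_one (closure_mul_left hG) hcard

theorem deepTKT_three (h : IsStandardPair m a z w x y) (hG : closure {x, y} = ⊤)
    (hcard : Nat.card G = 3 ^ (m + 3)) :
    deepTKT x y 3 = if (3 : ℤ) ∣ w + 2 * z - 11 * a then 9 else 3 := by
  have := h.mul_left.mul_left.deepTKT_one (closure_mul_left (closure_mul_left hG)) hcard
  -- The type of `artinTransfer` depends on the subgroup, so the equality of subgroups is
  -- transported at the level of cardinalities.
  have key : ∀ H K : Subgroup G, H = K →
      Nat.card (artinTransfer ((commutator G).subgroupOf H)).ker =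
        Nat.card (artinTransfer ((commutator G).subgroupOf K)).ker := by
    rintro H _ rfl; rfl
  refine (key _ _ maxSubgroup_three).trans (this.trans ?_)
  rw [show w + z - 5 * a + (z - a) - 5 * a = w + 2 * z - 11 * a by ring]

/-- The first two factors multiply to the order of the kernel of cubing on H₁, and H₁ itself has
order 3^{m+2}. -/
theorem deepTKT_zero_mul (h : IsStandardPair m a z w x y) (hG : closure {x, y} = ⊤)
    (hcard : Nat.card G = 3 ^ (m + 3)) {f : maxSubgroup x y 0 →* G}
    (hf : ∀ g, f g = (g : G) ^ 3) :
    deepTKT x y 0 * Nat.card (zpowers (iterComm x y (m + 1) ^ a)) * Nat.card f.range =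
      3 ^ (m + 2) := by
  have hle := commutator_le_maxSubgroup (x := x) (y := y) 0
  have hM := (h.index_card_maxSubgroup hG hcard 0).2
  have hmul := card_ker_artinTransfer_mul (maxSubgroup x y 0)
  have hc : ⁅maxSubgroup x y 0, maxSubgroup x y 0⁆ = zpowers (iterComm x y (m + 1) ^ a) := by
    rw [h.maxSubgroup_zero_eq hG, h.commutator_tail_zero hG]
  rw [hc, mem_ker_deepTransfer_iff hle hM (h.commute_of_mem_commutator hG) f hf] at hmul
  rw [deepTKT, hmul, ← index_ker, card_mul_index, hM, h.card_commutator hG hcard]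
  ring

/-- The deep transfer kernel of `H₁`. -/
theorem deepTKT_zero (h : IsStandardPair m a z w x y) (hG : closure {x, y} = ⊤)
    (hcard : Nat.card G = 3 ^ (m + 3)) (h0 : m = 0 → z ≡ 0 [ZMOD 3])
    (h1 : m = 1 → ¬ z ≡ 1 [ZMOD 3]) : deepTKT x y 0 = if (3 : ℤ) ∣ a then 9 else 3 := by
  obtain ⟨f, hf, -, hr⟩ := h.exists_cube_hom hG
  have hmul := h.deepTKT_zero_mul hG hcard hf
  rw [hr h0 h1, h.card_tail hG hcard (i := m) (by omega), Nat.card_zpowers] at hmul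
  have ha := h.last_zpow_eq_one_iff hG hcard a
  have hpos : 0 < 3 ^ m := by positivity
  have hmul' : deepTKT x y 0 * orderOf (iterComm x y (m + 1) ^ a) = 9 :=
    Nat.eq_of_mul_eq_mul_right hpos (hmul.trans (by ring))
  split_ifs with h3
  · rwa [ha.2 h3, orderOf_one, mul_one] at hmul'
  · rw [orderOf_eq_prime (p := 3) (by
      rw [← zpow_natCast, zpow_comm, zpow_natCast, h.last_cube, one_zpow])
      (fun h' => h3 (ha.1 h'))] at hmul'
    omega

/-- The deep transfer kernel of `H₁`, if `n = 4` and `H₁` is elementary abelian. -/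
theorem deepTKT_zero_of_eq_one (h : IsStandardPair 1 a z w x y) (hG : closure {x, y} = ⊤)
    (hcard : Nat.card G = 3 ^ 4) (hz : z ≡ 1 [ZMOD 3]) : deepTKT x y 0 = 27 := by
  obtain ⟨f, hf, hr, -⟩ := h.exists_cube_hom hG
  have hmul := h.deepTKT_zero_mul hG hcard hf
  rw [hr (Or.inr rfl) (by simpa using hz.sub_right 1), h.a_eq (by norm_num), zpow_zero] at hmul
  simpa using hmul

/-! ### Shallow transfers -/

/-- All cubes lie in γ₃(G) = H₂' when m ≥ 1; the substitution x ↦ xy gives the same for H₃ and H₄.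
-/
theorem ker_artinTransfer_of_ne_zero (h : IsStandardPair m a z w x y) (hG : closure {x, y} = ⊤)
    (hcard : Nat.card G = 3 ^ (m + 3)) (hm : 1 ≤ m) {i : Fin 4} (hi : i ≠ 0) :
    (artinTransfer (maxSubgroup x y i)).ker = ⊤ := by
  have key : ∀ {x : G} {z w : ℤ}, IsStandardPair m a z w x y → closure {x, y} = ⊤ →
      (artinTransfer (maxSubgroup x y 1)).ker = ⊤ := by
    intro x z w h hG
    have := maxSubgroup_normal (x := x) (y := y) 1
    refine ker_artinTransfer_eq_top (h.index_card_maxSubgroup hG hcard 1).1 fun g _ => ?_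
    rw [h.commutator_maxSubgroup_one hG]
    exact h.cube_mem_tail_two hG hm g
  have k₁ := key h hG
  have k₂ := key h.mul_left (closure_mul_left hG)
  have k₃ := key h.mul_left.mul_left (closure_mul_left (closure_mul_left hG))
  fin_cases i
  · exact absurd rfl hi
  · exact k₁
  · exact k₂
  · change (artinTransfer (maxSubgroup x y 3)).ker = ⊤
    rw [maxSubgroup_three]
    exact k₃

/-- The values of the transfer to `H₁` on the generators. -/
theorem artinTransfer_zero (h : IsStandardPair m a z w x y) (hG : closure {x, y} = ⊤)
    (hcard : Nat.card G = 3 ^ (m + 3)) :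
    (artinTransfer (maxSubgroup x y 0) (Abelianization.of x) = 1 ↔
      iterComm x y (m + 1) ^ w ∈ zpowers (iterComm x y (m + 1) ^ a)) ∧
    (artinTransfer (maxSubgroup x y 0) (Abelianization.of (x * y)) = 1 ↔
      iterComm x y (m + 1) ^ (w + z - 5 * a) ∈ zpowers (iterComm x y (m + 1) ^ a)) := by
  have := maxSubgroup_normal (x := x) (y := y) 0
  have hc : ⁅maxSubgroup x y 0, maxSubgroup x y 0⁆ = zpowers (iterComm x y (m + 1) ^ a) := by
    rw [h.maxSubgroup_zero_eq hG, h.commutator_tail_zero hG]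
  have hidx := (h.index_card_maxSubgroup hG hcard 0).1
  have h₁ := artinTransfer_eq_one_iff hidx (g := x)
    (h.notMem_maxSubgroup hG hcard (i := 1) (j := 0) (by decide))
  have h₂ := artinTransfer_eq_one_iff hidx (g := x * y)
    (h.notMem_maxSubgroup hG hcard (i := 2) (j := 0) (by decide))
  rw [h₁, h₂, hc, h.x_cube, h.mul_cube_eq]
  exact ⟨Iff.rfl, Iff.rfl⟩

theorem eq_top_of_mem {H : Subgroup G} (hG : closure {x, y} = ⊤)
    (hx : artinTransfer H (Abelianization.of x) = 1)
    (hy : artinTransfer H (Abelianization.of y) = 1) : (artinTransfer H).ker = ⊤ := by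
  have : (artinTransfer H).ker.comap Abelianization.of = ⊤ := by
    rw [eq_top_iff, ← hG, closure_le]
    rintro g (rfl | rfl)
    · exact hx
    · exact hy
  refine eq_top_iff.2 fun q _ => ?_
  obtain ⟨g, rfl⟩ := of_surjective q
  exact mem_comap.1 (this.ge (mem_top g))

theorem ker_eq_map_maxSubgroup (h : IsStandardPair m a z w x y) (hG : closure {x, y} = ⊤)
    (hcard : Nat.card G = 3 ^ (m + 3)) {H : Subgroup G} {j : Fin 4}
    (h₁ : artinTransfer H (Abelianization.of
      ((![y, x, x * y, x * y ^ 2] : Fin 4 → G) j)) = 1)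
    (h₂ : ∃ g, artinTransfer H (Abelianization.of g) ≠ 1) :
    (artinTransfer H).ker = (maxSubgroup x y j).map Abelianization.of := by
  refine ker_artinTransfer_eq_map
    (isCoatom_of_index (h.index_card_maxSubgroup hG hcard j).1) ?_ h₂
  have : maxSubgroup x y j ≤ (artinTransfer H).ker.comap Abelianization.of := by
    refine sup_le ((closure_le _).2 (Set.singleton_subset_iff.2 h₁)) fun g hg => ?_
    rw [← Abelianization.ker_of] at hg
    rw [mem_comap, MonoidHom.mem_ker.1 hg]
    exact one_mem _
  exact this

/-- If `a` is a unit or all other parameters vanish, the transfer to `H₁` is trivial. -/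
theorem ker_artinTransfer_zero_eq_top (h : IsStandardPair m a z w x y) (hG : closure {x, y} = ⊤)
    (hcard : Nat.card G = 3 ^ (m + 3)) (ha : a = 1 ∨ z = 0 ∧ w = 0 ∧ a = 0) :
    (artinTransfer (maxSubgroup x y 0)).ker = ⊤ := by
  have hmem : iterComm x y (m + 1) ^ w ∈ zpowers (iterComm x y (m + 1) ^ a) ∧
      iterComm x y (m + 1) ^ (w + z - 5 * a) ∈ zpowers (iterComm x y (m + 1) ^ a) := by
    rcases ha with rfl | ⟨rfl, rfl, rfl⟩
    · rw [zpow_one]; exact ⟨zpow_mem (mem_zpowers _) _, zpow_mem (mem_zpowers _) _⟩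
    · simp
  obtain ⟨h₁, h₂⟩ := h.artinTransfer_zero hG hcard
  have hx := h₁.2 hmem.1
  have hxy := h₂.2 hmem.2
  rw [map_mul, map_mul, hx, one_mul] at hxy
  exact eq_top_of_mem hG hx hxy

end IsStandardPair

end CoclassOne

namespace CoclassOne

open Subgroup

/-! ### Order 27 and evaluation of the rows of the table. -/

namespace IsStandardPair

variable {G : Type*} [Group G] {m : ℕ} {a z w : ℤ} {x y : G}

/-- Parameters of a nonabelian group of order `3^3` can be normalized to those of the table. -/
theorem exists_tableRow_zero (h : IsStandardPair 0 a z w x y) (hG : closure {x, y} = ⊤)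
    (hcard : Nat.card G = 3 ^ (0 + 3)) :
    ∃ a' z' w' x' y', Subgroup.closure {x', y'} = (⊤ : Subgroup G) ∧
      IsStandardPair 0 a' z' w' x' y' ∧ ∃ κs κd, TableRow (0 + 3) a' z' w' κs κd := by
  obtain rfl := h.a_eq (by norm_num)
  have main : ∀ {x y : G} {z w : ℤ}, IsStandardPair 0 0 z w x y → closure {x, y} = ⊤ →
      z ≡ 0 [ZMOD 3] → ∃ a' z' w' x' y', Subgroup.closure {x', y'} = (⊤ : Subgroup G) ∧
        IsStandardPair 0 a' z' w' x' y' ∧ ∃ κs κd, TableRow (0 + 3) a' z' w' κs κd := by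
    intro x y z w h hG hz
    obtain ⟨w₁, hw₁, hwmod⟩ := exists_mod_three w
    replace h := h.congr_params rfl hz hwmod h.a_eq
    rcases hw₁ with rfl | rfl | rfl
    · exact ⟨0, 0, 0, x, y, hG, h, _, _, .a1_mainline _ le_rfl⟩
    · exact ⟨0, 0, 1, x, y, hG, h, _, _, .A1⟩
    · refine ⟨0, 0, 1, x, y⁻¹, closure_inv_right hG, ?_, _, _, .A1⟩
      simpa using h.inv_right
  by_cases hz : z ≡ 0 [ZMOD 3]
  · exact main h hG hz
  -- Each substitution x ↦ xy adds z to w, and z² ≡ 1 modulo 3, so -wz of them make the cube of x'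
  -- trivial.
  · obtain ⟨x', w', hG', h', hw'⟩ := h.mul_left_iterate hG ((-w * z) % 3).toNat
    rw [Int.toNat_of_nonneg (Int.emod_nonneg _ (by norm_num))] at hw'
    have hw₀ : w' ≡ 0 [ZMOD 3] := by
      rw [hw' rfl]
      have h₁ : w + (-w * z) % 3 * z ≡ w + -w * z * z [ZMOD 3] :=
        ((Int.mod_modEq _ _).mul_right _).add_left _
      refine h₁.trans ?_
      have hzz : z * z ≡ 1 [ZMOD 3] := by
        obtain ⟨j, hj, hmod⟩ := exists_mod_three z
        refine (hmod.mul hmod).trans ?_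
        rcases hj with rfl | rfl | rfl
        · exact absurd hmod hz
        · rfl
        · rfl
      rw [mul_assoc]
      exact ((hzz.mul_left (-w)).add_left w).trans (by simp)
    have hx3 : x' ^ 3 = 1 := by rw [h'.x_cube, h'.last_zpow_eq hw₀, zpow_zero]
    have hxy : ¬ Commute x' y := fun hc => by
      have := h'.orderOf_last hG' hcard
      rw [show iterComm x' y (0 + 1) = 1 from comm_eq_one_iff.2 hc.symm, orderOf_one] at this
      omega
    -- The generators are exchanged: x' plays the part of y, and its trivial cube makes the new z
    -- vanish.
    obtain ⟨hG'', z'', w'', h''⟩ := isStandardPair_of_card_eq hcard hxy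
    refine main h'' hG'' ?_
    have e := h''.y_cube
    have e₁ : iterComm y x' 1 ^ 3 = 1 := h''.last_cube
    rw [hx3, e₁, show iterComm y x' 2 = 1 from h''.last, one_mul, one_mul] at e
    exact Int.modEq_zero_iff_dvd.2 ((h''.last_zpow_eq_one_iff hG'' hcard z'').1 e.symm)

/-- Cubing is the trivial homomorphism on H₁, so G' has exponent three, and elements of H₂ outside
G' have cube x³ or x⁻³, which is 1. The parameters (0, 0, 0) persist under x ↦ xy, and the four H_i
cover G. -/
theorem cube_eq_one (h : IsStandardPair 0 0 0 0 x y) (hG : closure {x, y} = ⊤) (g : G) :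
    g ^ 3 = 1 := by
  have key₀ : ∀ {x : G}, IsStandardPair 0 0 0 0 x y → closure {x, y} = ⊤ →
      ∀ g ∈ maxSubgroup x y 0, g ^ 3 = 1 := by
    intro x h hG g hg
    obtain ⟨f, hf, hr, -⟩ := h.exists_cube_hom hG
    have : f ⟨g, hg⟩ ∈ f.range := ⟨_, rfl⟩
    rw [hr (Or.inl rfl) rfl, mem_bot, hf] at this
    exact this
  have key : ∀ {x : G}, IsStandardPair 0 0 0 0 x y → closure {x, y} = ⊤ →
      ∀ g ∈ maxSubgroup x y 1, g ^ 3 = 1 := by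
    intro x h hG g hg
    by_cases hg' : g ∈ tail x y 1
    · rw [← h.commutator_eq_tail hG] at hg'
      exact key₀ h hG g (commutator_le_maxSubgroup 0 hg')
    · rcases h.cube_eq_or hG hg hg' with e | e
      · rw [e, h.x_cube, zpow_zero]
      · rw [e, h.x_cube, zpow_zero, inv_one]
  obtain ⟨i, hi⟩ := exists_mem_maxSubgroup hG (h.x_cube_mem_commutator hG)
    (h.y_cube_mem_commutator hG) g
  have h₂ : IsStandardPair 0 0 0 0 (x * y) y := h.mul_left
  fin_cases i
  · exact key₀ h hG g hi
  · exact key h hG g hi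
  · exact key h₂ (closure_mul_left hG) g hi
  · exact key h₂.mul_left (closure_mul_left (closure_mul_left hG)) g (maxSubgroup_three.le hi)

variable [Finite G]

theorem deepTKT_eq (h : IsStandardPair m a z w x y) (hG : closure {x, y} = ⊤)
    (hcard : Nat.card G = 3 ^ (m + 3)) (h0 : m = 0 → z ≡ 0 [ZMOD 3])
    (h1 : m = 1 → ¬ z ≡ 1 [ZMOD 3]) :
    deepTKT x y = ![if (3 : ℤ) ∣ a then 9 else 3, if (3 : ℤ) ∣ w then 9 else 3,
      if (3 : ℤ) ∣ w + z - 5 * a then 9 else 3, if (3 : ℤ) ∣ w + 2 * z - 11 * a then 9 else 3] := by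
  funext i
  fin_cases i
  · exact h.deepTKT_zero hG hcard h0 h1
  · exact h.deepTKT_one hG hcard
  · exact h.deepTKT_two hG hcard
  · exact h.deepTKT_three hG hcard

theorem deepTKT_eq_of_tableRow {κs κd : Fin 4 → ℕ} (h : IsStandardPair m a z w x y)
    (hG : closure {x, y} = ⊤) (hcard : Nat.card G = 3 ^ (m + 3))
    (hrow : TableRow (m + 3) a z w κs κd) : deepTKT x y = κd := by
  generalize hn : m + 3 = n at hrow
  cases hrow with
  | a1_root => omega
  | a3_star =>
    obtain rfl : m = 1 := by omega
    funext i
    fin_cases i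
    · exact h.deepTKT_zero_of_eq_one hG hcard rfl
    · exact (h.deepTKT_one hG hcard).trans (by decide)
    · exact (h.deepTKT_two hG hcard).trans (by decide)
    · exact (h.deepTKT_three hG hcard).trans (by decide)
  | a3_pos =>
    rw [h.deepTKT_eq hG hcard (by omega) (by omega)]
    norm_num
    try decide
  | _ =>
    rw [h.deepTKT_eq hG hcard (fun _ => by first | rfl | omega) (fun _ => by decide)]
    norm_num
    try decide

theorem artinTransfer_eq_of_pow_eq {H : Subgroup G} [H.Normal] (hH : H.index = 3) {g k : G}
    (hg : g ∉ H) (hk : k ∉ H) (hgk : g ^ 3 = k ^ 3) :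
    artinTransfer H (Abelianization.of g) = artinTransfer H (Abelianization.of k) := by
  rw [artinTransfer_of, artinTransfer_of,
    transfer_eq_of_notMem Nat.prime_three hH _ hg (pow_index_mem hH g),
    transfer_eq_of_notMem Nat.prime_three hH _ hk (pow_index_mem hH k)]
  congr 1
  exact Subtype.ext hgk

/-- With a = z = 0 the elements x and xy have the same cube, so y is in the kernel; x is not, as x³
= ζ ≠ 1 and H₁' is trivial. -/
theorem ker_artinTransfer_zero_of_cube_eq (h : IsStandardPair m 0 0 1 x y)
    (hG : closure {x, y} = ⊤) (hcard : Nat.card G = 3 ^ (m + 3)) :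
    (artinTransfer (maxSubgroup x y 0)).ker = (maxSubgroup x y 0).map Abelianization.of := by
  have := maxSubgroup_normal (x := x) (y := y) 0
  have hx : artinTransfer (maxSubgroup x y 0) (Abelianization.of x) ≠ 1 := by
    rw [Ne, (h.artinTransfer_zero hG hcard).1, zpow_zero, zpowers_one_eq_bot, mem_bot,
      h.last_zpow_eq_one_iff hG hcard]
    decide
  refine h.ker_eq_map_maxSubgroup hG hcard (j := 0) ?_ ⟨x, hx⟩
  have e := artinTransfer_eq_of_pow_eq (h.index_card_maxSubgroup hG hcard 0).1
    (g := x * y) (k := x) (h.notMem_maxSubgroup hG hcard (i := 2) (j := 0) (by decide))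
    (h.notMem_maxSubgroup hG hcard (i := 1) (j := 0) (by decide))
    (by rw [h.mul_cube_eq, h.x_cube]; rfl)
  rwa [map_mul, map_mul, mul_eq_left] at e

theorem ker_artinTransfer_zero_of_x_cube_eq_one (h : IsStandardPair m 0 z 0 x y)
    (hz : ¬ (3 : ℤ) ∣ z) (hG : closure {x, y} = ⊤) (hcard : Nat.card G = 3 ^ (m + 3)) :
    (artinTransfer (maxSubgroup x y 0)).ker = (maxSubgroup x y 1).map Abelianization.of := by
  obtain ⟨h₁, h₂⟩ := h.artinTransfer_zero hG hcard
  refine h.ker_eq_map_maxSubgroup hG hcard (j := 1) (h₁.2 (by simp)) ⟨x * y, fun he => hz ?_⟩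
  have := h₂.1 he
  rwa [zpow_zero, zpowers_one_eq_bot, mem_bot, h.last_zpow_eq_one_iff hG hcard, mul_zero, sub_zero,
    zero_add] at this

theorem commutator_maxSubgroup_eq_bot (h : IsStandardPair 0 a z w x y) (hG : closure {x, y} = ⊤)
    (hcard : Nat.card G = 3 ^ (0 + 3)) (i : Fin 4) :
    ⁅maxSubgroup x y i, maxSubgroup x y i⁆ = ⊥ := by
  have : Fact (Nat.Prime 3) := ⟨Nat.prime_three⟩
  have hc : Nat.card (maxSubgroup x y i) = 3 ^ 2 := by
    rw [(h.index_card_maxSubgroup hG hcard i).2, h.card_commutator hG hcard]; norm_num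
  have hcomm := IsPGroup.isMulCommutative_of_card_eq_prime_sq hc
  rw [commutator_eq_bot_iff_le_centralizer]
  intro k hk
  rw [mem_centralizer_iff]
  exact fun l hl => congrArg Subtype.val (hcomm.is_comm.comm ⟨l, hl⟩ ⟨k, hk⟩)

theorem isShallowTKT_of_cube_eq_one {x y : G} (hidx : ∀ i, (maxSubgroup x y i).index = 3)
    (h : ∀ g : G, g ^ 3 = 1) : IsShallowTKT x y ![0, 0, 0, 0] := fun i => by
  have := maxSubgroup_normal (x := x) (y := y) i
  refine Or.inl ⟨by fin_cases i <;> rfl, ker_artinTransfer_eq_top (hidx i) fun g _ => ?_⟩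
  rw [h]
  exact one_mem _

theorem isShallowTKT_extraspecial (h : IsStandardPair 0 0 0 1 x y) (hG : closure {x, y} = ⊤)
    (hcard : Nat.card G = 3 ^ (0 + 3)) : IsShallowTKT x y ![1, 1, 1, 1] := fun i => by
  have := maxSubgroup_normal (x := x) (y := y) i
  refine Or.inr ⟨0, by fin_cases i <;> rfl, ?_⟩
  by_cases hi : i = 0
  · subst hi
    exact h.ker_artinTransfer_zero_of_cube_eq hG hcard
  have hidx := (h.index_card_maxSubgroup hG hcard i).1
  have hbot := h.commutator_maxSubgroup_eq_bot hG hcard i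
  refine h.ker_eq_map_maxSubgroup hG hcard (j := 0) ?_ ?_
  · rw [artinTransfer_eq_one_iff hidx (h.notMem_maxSubgroup hG hcard (Ne.symm hi)), hbot, mem_bot]
    have e := h.y_cube
    have e₁ : iterComm x y 1 ^ 3 = 1 := h.last_cube
    rwa [e₁, show iterComm x y 2 = 1 from h.last, mul_one, mul_one, zpow_zero] at e
  · have h1 : iterComm x y (0 + 1) ^ (1 : ℤ) ≠ 1 := fun h' =>
      absurd ((h.last_zpow_eq_one_iff hG hcard 1).1 h') (by decide)
    -- The witness must lie outside H_i; x serves for H₃ and H₄, but for H₂ it is replaced by xy.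
    by_cases hi1 : i = 1
    · refine ⟨x * y, ?_⟩
      rw [Ne, artinTransfer_eq_one_iff hidx (g := x * y)
        (h.notMem_maxSubgroup hG hcard (i := 2) (by rw [hi1]; decide)), hbot, mem_bot,
        h.mul_cube_eq]
      exact h1
    · refine ⟨x, ?_⟩
      rw [Ne, artinTransfer_eq_one_iff hidx (g := x)
        (h.notMem_maxSubgroup hG hcard (i := 1) (Ne.symm hi1)), hbot, mem_bot, h.x_cube]
      exact h1

theorem isShallowTKT_of_zero (h : IsStandardPair m a z w x y) (hG : closure {x, y} = ⊤)
    (hcard : Nat.card G = 3 ^ (m + 3)) (hm : 1 ≤ m) {κ : Fin 4 → ℕ} (hκ : ∀ i, i ≠ 0 → κ i = 0)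
    (h₀ : (κ 0 = 0 ∧ (artinTransfer (maxSubgroup x y 0)).ker = ⊤) ∨
      ∃ j : Fin 4, κ 0 = (j : ℕ) + 1 ∧
        (artinTransfer (maxSubgroup x y 0)).ker = (maxSubgroup x y j).map Abelianization.of) :
    IsShallowTKT x y κ := fun i => by
  by_cases hi : i = 0
  · subst hi
    exact h₀
  · exact Or.inl ⟨hκ i hi, h.ker_artinTransfer_of_ne_zero hG hcard hm hi⟩

theorem isShallowTKT_of_tableRow {κs κd : Fin 4 → ℕ} (h : IsStandardPair m a z w x y)
    (hG : closure {x, y} = ⊤) (hcard : Nat.card G = 3 ^ (m + 3))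
    (hrow : TableRow (m + 3) a z w κs κd) : IsShallowTKT x y κs := by
  generalize hn : m + 3 = n at hrow
  have hκ : ∀ (k : ℕ) (i : Fin 4), i ≠ 0 → (![k, 0, 0, 0] : Fin 4 → ℕ) i = 0 := by
    intro k i hi
    fin_cases i
    · exact absurd rfl hi
    all_goals rfl
  cases hrow with
  | a1_root => omega
  | A1 =>
    obtain rfl : m = 0 := by omega
    exact h.isShallowTKT_extraspecial hG hcard
  | a1_mainline =>
    rcases Nat.eq_zero_or_pos m with rfl | hm
    · exact isShallowTKT_of_cube_eq_one (fun i => (h.index_card_maxSubgroup hG hcard i).1)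
        (h.cube_eq_one hG)
    · exact h.isShallowTKT_of_zero hG hcard hm (hκ 0) (Or.inl ⟨rfl,
        h.ker_artinTransfer_zero_eq_top hG hcard (Or.inr ⟨rfl, rfl, rfl⟩)⟩)
  | a2 =>
    exact h.isShallowTKT_of_zero hG hcard (by omega) (hκ 1) (Or.inr ⟨0, rfl,
      h.ker_artinTransfer_zero_of_cube_eq hG hcard⟩)
  | a1_zero | a1_neg | a1_pos =>
    exact h.isShallowTKT_of_zero hG hcard (by omega) (hκ 0) (Or.inl ⟨rfl,
      h.ker_artinTransfer_zero_eq_top hG hcard (Or.inl rfl)⟩)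
  | a3_neg | a3_pos | a3_star =>
    exact h.isShallowTKT_of_zero hG hcard (by omega) (hκ 2) (Or.inr ⟨1, rfl,
      h.ker_artinTransfer_zero_of_x_cube_eq_one (by decide) hG hcard⟩)

end IsStandardPair

end CoclassOne

namespace CoclassOne

open Subgroup

/-! ### The noncyclic group of order nine. -/

section OrderNine

variable {G : Type*} [Group G]

/-- For n = 2 every s_i is the empty word, so the relations reduce to x³ = y³ = [y, x] = 1. -/
theorem ParamGroup.cube_eq_one_and_commute :
    ParamGroup.x 2 0 0 0 ^ 3 = 1 ∧ ParamGroup.y 2 0 0 0 ^ 3 = 1 ∧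
      Commute (ParamGroup.y 2 0 0 0) (ParamGroup.x 2 0 0 0) := by
  have hS (i : ℕ) : PresentedGroup.mk (relators 2 0 0 0) (S 2 i) = 1 :=
    ParamGroup.s_eq_one (by omega)
  refine ⟨?_, ?_, ?_⟩
  · have := ParamGroup.mk_eq (Relation.x_cube (n := 2) (a := 0) (z := 0) (w := 0))
    rwa [map_pow, map_zpow, mk_X, zpow_zero] at this
  · have := ParamGroup.mk_eq (Relation.y_cube (n := 2) (a := 0) (z := 0) (w := 0))
    rwa [map_mul, map_mul, map_pow, map_pow, hS, hS, map_zpow, mk_Y, zpow_zero, one_pow, mul_one,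
      mul_one] at this
  · have := ParamGroup.mk_eq (Relation.s_two (n := 2) (a := 0) (z := 0) (w := 0))
    rw [hS, map_comm, mk_X, mk_Y] at this
    exact comm_eq_one_iff.1 this.symm

theorem finite_card_le_nine {x y : G} (hG : closure {x, y} = ⊤) (hx : x ^ 3 = 1) (hy : y ^ 3 = 1)
    (hxy : Commute y x) : Finite G ∧ Nat.card G ≤ 9 := by
  obtain ⟨h₁, h₂⟩ := finite_card_sup_zpowers (⊥ : Subgroup G) (g := y) (by simp [hy])
  rw [bot_sup_eq] at h₁ h₂
  have hN : (zpowers y).Normal := by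
    rw [← normalizer_eq_top_iff, eq_top_iff, ← hG, closure_le]
    have hle : (centralizer (zpowers y : Set G)) ≤ normalizer (zpowers y : Set G) :=
      centralizer_le_normalizer _
    rintro g (rfl | rfl)
    · refine hle ?_
      rw [mem_centralizer_iff]
      rintro _ ⟨i, rfl⟩
      exact (hxy.zpow_left i).eq
    · exact le_normalizer (mem_zpowers _)
  obtain ⟨h₃, h₄⟩ := finite_card_sup_zpowers (zpowers y) (g := x) (by rw [hx]; exact one_mem _)
  have htop : zpowers y ⊔ zpowers x = ⊤ := by
    rw [eq_top_iff, ← hG, closure_le]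
    rintro g (rfl | rfl)
    · exact mem_sup_right (mem_zpowers _)
    · exact mem_sup_left (mem_zpowers _)
  rw [htop] at h₃ h₄
  rw [card_top] at h₄
  rw [card_bot] at h₂
  exact ⟨Finite.of_equiv _ (topEquiv (G := G)).toEquiv, by omega⟩

theorem commute_of_card_eq_nine (hcard : Nat.card G = 9) (g k : G) : Commute g k := by
  have : Fact (Nat.Prime 3) := ⟨Nat.prime_three⟩
  exact (IsPGroup.isMulCommutative_of_card_eq_prime_sq (p := 3) hcard).is_comm.comm g k

theorem pow_three_eq_one_of_card_eq_nine (hcard : Nat.card G = 9) (hc : ¬ IsCyclic G) (g : G) :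
    g ^ 3 = 1 := by
  have hfin : Finite G := Nat.finite_of_card_ne_zero (by omega)
  have hdvd : orderOf g ∣ 3 ^ 2 := by
    have := orderOf_dvd_natCard g
    rwa [hcard] at this
  obtain ⟨k, hk, hk'⟩ := (Nat.dvd_prime_pow Nat.prime_three).1 hdvd
  rw [← orderOf_dvd_iff_pow_eq_one, hk']
  have : k ≠ 2 := by
    rintro rfl
    exact hc (isCyclic_of_orderOf_eq_card g (by rw [hk', hcard]; norm_num))
  exact (pow_dvd_pow 3 (by omega : k ≤ 1)).trans (by norm_num)

theorem nonempty_mulEquiv_of_card_eq_nine (hcard : Nat.card G = 9) (hc : ¬ IsCyclic G) :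
    Nonempty (ParamGroup 2 0 0 0 ≃* G) := by
  have hcube := pow_three_eq_one_of_card_eq_nine hcard hc
  have hcomm := commute_of_card_eq_nine hcard
  have hfin : Finite G := Nat.finite_of_card_ne_zero (by omega)
  have : Nontrivial G := Finite.one_lt_card_iff_nontrivial.1 (by omega)
  obtain ⟨x, hx⟩ := exists_ne (1 : G)
  have hox : orderOf x = 3 := orderOf_eq_prime (hcube x) hx
  obtain ⟨y, hy⟩ : ∃ y, y ∉ zpowers x := by
    by_contra! hall
    have : Nat.card (zpowers x) = Nat.card G := by rw [(Subgroup.eq_top_iff' _).2 hall, card_top]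
    rw [Nat.card_zpowers, hox, hcard] at this
    omega
  have hG : closure {x, y} = ⊤ := by
    have hlt : zpowers x < closure {x, y} := by
      refine lt_of_le_of_ne ?_ fun he => hy ?_
      · rw [zpowers_le]; exact subset_closure (by simp)
      · rw [he]; exact subset_closure (by simp)
    have hd : Nat.card (closure {x, y}) ∣ 3 ^ 2 := by
      have := card_subgroup_dvd_card (closure {x, y})
      rwa [hcard] at this
    have hl : Nat.card (zpowers x) < Nat.card (closure {x, y}) :=
      lt_of_le_of_ne (card_le_of_le hlt.le) fun he => hlt.ne (eq_of_le_of_card_ge hlt.le he.ge)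
    rw [Nat.card_zpowers, hox] at hl
    obtain ⟨k, hk, hk'⟩ := (Nat.dvd_prime_pow Nat.prime_three).1 hd
    apply eq_top_of_card_eq
    rw [hcard, hk']
    interval_cases k <;> simp_all
  let f : Gen 2 → G := fun g => match g with
    | .x => x
    | .y => y
    | .s _ _ _ => 1
  have fS (i : ℕ) : FreeGroup.lift f (S 2 i) = 1 := by
    rw [S, dif_neg (by omega), map_one]
  have hrel : ∀ r ∈ relators 2 0 0 0, FreeGroup.lift f r = 1 := by
    rintro _ ⟨u, v, huv, rfl⟩
    rw [map_mul, map_inv, mul_inv_eq_one]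
    have hcm : ∀ g k : G, comm g k = 1 := fun g k => comm_eq_one_iff.2 (hcomm g k)
    cases huv <;> simp [map_comm, fS, hcm, hcube]
  let F : ParamGroup 2 0 0 0 →* G := PresentedGroup.toGroup hrel
  have hsurj : Function.Surjective F := by
    rw [← MonoidHom.range_eq_top, eq_top_iff, ← hG, closure_le]
    rintro g (rfl | rfl)
    · exact ⟨ParamGroup.x _ _ _ _, PresentedGroup.toGroup.of hrel⟩
    · exact ⟨ParamGroup.y _ _ _ _, PresentedGroup.toGroup.of hrel⟩
  obtain ⟨h₁, h₂, h₃⟩ := ParamGroup.cube_eq_one_and_commute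
  obtain ⟨hfin', hle⟩ := finite_card_le_nine (ParamGroup.closure_eq_top _) h₁ h₂ h₃
  exact ⟨MulEquiv.ofBijective F ((Nat.bijective_iff_surjective_and_card F).2
    ⟨hsurj, le_antisymm (hle.trans hcard.ge) (Nat.card_le_card_of_surjective F hsurj)⟩)⟩

theorem commutator_eq_bot_of_card_eq_nine (hcard : Nat.card G = 9) : commutator G = ⊥ := by
  rw [_root_.commutator_def, commutator_eq_bot_iff_le_centralizer]
  intro k _
  rw [mem_centralizer_iff]
  exact fun l _ => commute_of_card_eq_nine hcard l k

theorem deepTKT_of_card_eq_nine [Finite G] (hcard : Nat.card G = 9) (hc : ¬ IsCyclic G) {x y : G}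
    (hidx : ∀ i, Nat.card (maxSubgroup x y i) = 3 * Nat.card (commutator G)) :
    deepTKT x y = ![3, 3, 3, 3] := by
  have hcom := commutator_eq_bot_of_card_eq_nine hcard
  have key : ∀ i, deepTKT x y i = 3 := by
    intro i
    have hmul := card_ker_artinTransfer_mul (maxSubgroup x y i)
    have hbot : ⁅maxSubgroup x y i, maxSubgroup x y i⁆ = ⊥ := by
      rw [eq_bot_iff, ← hcom]
      exact commutator_mono le_top le_top
    change Nat.card (artinTransfer ((commutator G).subgroupOf (maxSubgroup x y i))).ker = 3
    rw [hbot, card_bot, mul_one, ker_deepTransfer_eq_top (commutator_le_maxSubgroup i) (hidx i)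
      (fun g _ k _ => commute_of_card_eq_nine hcard g k)
      (fun g _ _ => pow_three_eq_one_of_card_eq_nine hcard hc g), card_top, hidx] at hmul
    rw [hmul, hcom, card_bot]
  funext i
  rw [key]
  fin_cases i <;> rfl

end OrderNine

end CoclassOne

/-! ### Assembly. -/

theorem mainTheorem1 {G : Type*} [Group G] [Finite G] (n : ℕ) (hn : 2 ≤ n)
    (hcard : Nat.card G = 3 ^ n)
    (hcoclass : Group.nilpotencyClass G + 1 = n)
    (hnoncyclic : ¬ IsCyclic G) :
    (∃ (a z w : ℤ) (κs κd : Fin 4 → ℕ), CoclassOne.TableRow n a z w κs κd ∧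
      Nonempty (CoclassOne.ParamGroup n a z w ≃* G)) ∧
    ∀ (a z w : ℤ) (κs κd : Fin 4 → ℕ), CoclassOne.TableRow n a z w κs κd →
      ∀ (φ : CoclassOne.ParamGroup n a z w ≃* G) (x y : G),
        x = φ (CoclassOne.ParamGroup.x n a z w) →
        y = φ (CoclassOne.ParamGroup.y n a z w) →
        Function.Injective (CoclassOne.maxSubgroup x y) ∧
        Set.range (CoclassOne.maxSubgroup x y) = {H : Subgroup G | IsCoatom H} ∧
        (4 ≤ n → (CoclassOne.maxSubgroup x y 0 : Set G) = CoclassOne.twoStepCentralizer G) ∧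
        CoclassOne.IsShallowTKT x y κs ∧
        CoclassOne.deepTKT x y = κd := by
  have hp : IsPGroup 3 G := IsPGroup.of_card hcard
  have hgen : ∀ (a z w : ℤ) (φ : CoclassOne.ParamGroup n a z w ≃* G),
      Subgroup.closure {φ (CoclassOne.ParamGroup.x n a z w),
        φ (CoclassOne.ParamGroup.y n a z w)} = (⊤ : Subgroup G) := by
    intro a z w φ
    have h := congrArg (Subgroup.map φ.toMonoidHom)
      (CoclassOne.ParamGroup.closure_eq_top (a := a) (z := z) (w := w) n)
    rw [MonoidHom.map_closure, Set.image_pair,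
      Subgroup.map_top_of_surjective _ φ.surjective] at h
    exact h
  rcases hn.eq_or_lt with rfl | hn
  · have hc9 : Nat.card G = 9 := hcard
    have hcube := CoclassOne.pow_three_eq_one_of_card_eq_nine hc9 hnoncyclic
    refine ⟨⟨0, 0, 0, _, _, .a1_root,
      CoclassOne.nonempty_mulEquiv_of_card_eq_nine hc9 hnoncyclic⟩, ?_⟩
    intro a z w κs κd hrow φ x y hx hy
    have hG := hgen a z w φ
    rw [← hx, ← hy] at hG
    have hx3 : x ^ 3 ∈ commutator G := by rw [hcube]; exact one_mem _
    have hy3 : y ^ 3 ∈ commutator G := by rw [hcube]; exact one_mem _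
    have hcc : Nat.card G = 9 * Nat.card (commutator G) := by
      rw [CoclassOne.commutator_eq_bot_of_card_eq_nine hc9, Subgroup.card_bot, hc9]
    have hidx := CoclassOne.index_maxSubgroup hG hx3 hy3 hcc
    have hκ : κs = ![0, 0, 0, 0] ∧ κd = ![3, 3, 3, 3] := by
      generalize hm : 2 = m at hrow
      cases hrow with
      | a1_root => exact ⟨rfl, rfl⟩
      | _ => omega
    rw [hκ.1, hκ.2]
    exact ⟨CoclassOne.maxSubgroup_injective hG hx3 hy3 hcc,
      CoclassOne.range_maxSubgroup hp hG hx3 hy3 hcc, by omega,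
      CoclassOne.IsStandardPair.isShallowTKT_of_cube_eq_one (fun i => (hidx i).1) hcube,
      CoclassOne.deepTKT_of_card_eq_nine hc9 hnoncyclic fun i => (hidx i).2⟩
  · obtain ⟨m, rfl⟩ := Nat.exists_eq_add_of_le' (show 3 ≤ n from hn)
    refine ⟨?_, ?_⟩
    · obtain ⟨x, y, a, z, w, hG, h⟩ := CoclassOne.exists_isStandardPair m hcard (by omega)
      have hrow : ∃ a' z' w' x' y', Subgroup.closure {x', y'} = (⊤ : Subgroup G) ∧
          CoclassOne.IsStandardPair m a' z' w' x' y' ∧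
          ∃ κs κd, CoclassOne.TableRow (m + 3) a' z' w' κs κd := by
        rcases Nat.eq_zero_or_pos m with rfl | hm
        · exact h.exists_tableRow_zero hG hcard
        · exact h.exists_tableRow hm hG
      obtain ⟨a', z', w', x', y', hG', h', κs, κd, hrow⟩ := hrow
      exact ⟨a', z', w', κs, κd, hrow, h'.nonempty_mulEquiv hG' hcard⟩
    · intro a z w κs κd hrow φ x y hx hy
      -- All rows with a = 1 have n ≥ 5; `IsStandardPair` needs this restriction.
      have ha : m < 2 → a = 0 := by
        generalize hk : m + 3 = k at hrow
        cases hrow with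
        | a1_zero | a1_neg | a1_pos => omega
        | _ => exact fun _ => rfl
      have hG := hgen a z w φ
      -- From here on only the fact that the images of the generators form a generating standard
      -- pair matters, so every isomorphism gives the same kernel types.
      have h := (CoclassOne.ParamGroup.isStandardPair (z := z) (w := w) ha).map φ.toMonoidHom
      change CoclassOne.IsStandardPair m a z w (φ (CoclassOne.ParamGroup.x (m + 3) a z w))
        (φ (CoclassOne.ParamGroup.y (m + 3) a z w)) at h
      rw [← hx, ← hy] at hG h
      exact ⟨h.injective_maxSubgroup hG hcard,
        CoclassOne.range_maxSubgroup hp hG (h.x_cube_mem_commutator hG)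
          (h.y_cube_mem_commutator hG) (h.card_eq_nine_mul hG hcard),
        fun hm => h.coe_maxSubgroup_zero hG hcard (by omega),
        h.isShallowTKT_of_tableRow hG hcard hrow, h.deepTKT_eq_of_tableRow hG hcard hrow⟩
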